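/- Let $m\ge 1$ and $n\ge 0$ be integers and work over $\mathbb C$. Let $A_{m,n}=\mathbb C[t_1,\dots,t_m]\otimes\Lambda(n)$, where $\Lambda(n)$ is the exterior algebra in odd variables $\xi_1,\dots,\xi_n$, and let $W=W_{m,n}$ be the Lie superalgebra of superderivations of $A_{m,n}$, with universal enveloping algebra $U(W)$. For $\alpha\in\mathbb Z_{\ge 0}^m$ write $t^\alpha=t_1^{\alpha_1}\cdots t_m^{\alpha_m}$; for $I=\{l_1<\dots<l_k\}\subseteq\{1,\dots,n\}$ write $\xi_I=\xi_{l_1}\cdots\xi_{l_k}$ (with $\xi_\varnothing=1$); let $e_j$ be the $j$-th standard basis vector of $\mathbb Z^m$ and let $$\mathcal D=\Big\{\tfrac{\partial}{\partial t_1},\dots,\tfrac{\partial}{\partial t_m},\tfrac{\partial}{\partial \xi_1},\dots,\tfrac{\partial}{\partial \xi_n}\Big\}.$$ For $r\ge 1$, $j\in\{1,\dots,m\}$, $\partial,\partial'\in\mathcal D$, $\alpha,\beta\in\mathbb Z_{\ge0}^m$ and $I,J\subseteq\{1,\dots,n\}$ put $$\omega^{r,j,\partial,\partial'}_{\alpha,\beta,I,J}=\sum_{i=0}^r(-1)^i\binom{r}{i}\,t^{\alpha+(r-i)e_j}\xi_I\partial\cdot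 t^{\beta+ie_j}\xi_J\partial'\in U(W).$$ Let $M$ be a bounded weight $W$-module. That is, $M$ is a $\mathbb Z_2$-graded $W$-module which is the direct sum of its weight spaces $$M_{(\lambda,\mu)}=\Big\{v\in M : t_i\tfrac{\partial}{\partial t_i}v=\lambda_i v\ (1\le i\le m),\ \ \xi_j\tfrac{\partial}{\partial\xi_j}v=\mu_j v\ (1\le j\le n)\Big\},\qquad \lambda\in\mathbb C^m,\ \mu\in\mathbb C^n,$$ and there is a constant $N$ with $\dim M_{(\lambda,\mu)}\le N$ for all $(\lambda,\mu)$. Then there is an integer $r\ge 1$ such that $$\omega^{r,j,\partial,\partial'}_{\alpha,\beta,I,J}\cdot M=0$$ for all $\alpha,\beta\in\mathbb Z_{\ge0}^m$, all $I,J\subseteq\{1,\dots,n\}$, all $j\in\{1,\dots,m\}$ and all $\partial,\partial'\in\mathcal D$. -/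

import Mathlib

open scoped TensorProduct

noncomputable section

namespace WittSuper

/-- The Koszul sign `(-1)^{pq}` for parities `p, q`. -/
def sgn (p q : ZMod 2) : ℂ := (-1) ^ (p.val * q.val)

theorem parity_cases : ∀ p : ZMod 2, p = 0 ∨ p = 1 := by decide

theorem sgn_add_right (p q r : ZMod 2) : sgn p (q + r) = sgn p q * sgn p r := by
  have h : ∀ p q r : ZMod 2, (-1 : ℤ) ^ (p.val * (q + r).val) =
      (-1) ^ (p.val * q.val) * (-1) ^ (p.val * r.val) := by decide
  have := congrArg (Int.cast : ℤ → ℂ) (h p q r)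
  push_cast at this
  exact this

theorem sgn_zero_left (q : ZMod 2) : sgn 0 q = 1 := by
  simp [sgn]

theorem sgn_one_one : sgn 1 1 = -1 := by
  simp [sgn, ZMod.val_one]

theorem sgn_comm (p q : ZMod 2) : sgn p q = sgn q p := by
  simp only [sgn, mul_comm]

theorem sgn_add_left (p q r : ZMod 2) : sgn (p + q) r = sgn p r * sgn q r := by
  rw [sgn_comm, sgn_add_right, sgn_comm r p, sgn_comm r q]

theorem sgn_mul_self (p q : ZMod 2) : sgn p q * sgn p q = 1 := by
  rw [← sgn_add_right, CharTwo.add_self_eq_zero]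
  simp [sgn]

/-- The exterior algebra `Λ(n)` in the odd variables `ξ_1, …, ξ_n`. -/
abbrev Ext (n : ℕ) : Type := ExteriorAlgebra ℂ (Fin n → ℂ)

/-- The even (`p = 0`) and odd (`p = 1`) parts of `Λ(n)`. -/
def extPart (n : ℕ) (p : ZMod 2) : Submodule ℂ (Ext n) :=
  CliffordAlgebra.evenOdd (0 : QuadraticForm ℂ (Fin n → ℂ)) p

/-- The superalgebra `A_{m,n} = ℂ[t_1, …, t_m] ⊗ Λ(n)`. As the polynomial factor is purely even,
the multiplication of the super tensor product is the ordinary one. -/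
abbrev A (m n : ℕ) : Type := MvPolynomial (Fin m) ℂ ⊗[ℂ] Ext n

/-- The homogeneous components of `A_{m,n}`. -/
def APart (m n : ℕ) (p : ZMod 2) : Submodule ℂ (A m n) :=
  Submodule.map₂ (TensorProduct.mk ℂ (MvPolynomial (Fin m) ℂ) (Ext n)) ⊤ (extPart n p)

/-- `(W_{m,n})_p`: the superderivations of `A_{m,n}` that are homogeneous of parity `p`, that is,
the linear maps `D` of parity `p` with `D(ab) = D(a)b + (-1)^{p|a|} a D(b)`. -/
def WPart (m n : ℕ) (p : ZMod 2) : Submodule ℂ (Module.End ℂ (A m n)) where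
  carrier := {D | (∀ q, ∀ a ∈ APart m n q, D a ∈ APart m n (p + q)) ∧
    ∀ q, ∀ a ∈ APart m n q, ∀ b, D (a * b) = D a * b + sgn p q • (a * D b)}
  zero_mem' := ⟨fun _ _ _ => Submodule.zero_mem _, by simp⟩
  add_mem' := by
    rintro D E ⟨hD, hD'⟩ ⟨hE, hE'⟩
    refine ⟨fun q a ha => Submodule.add_mem _ (hD q a ha) (hE q a ha), fun q a ha b => ?_⟩
    simp only [LinearMap.add_apply, hD' q a ha b, hE' q a ha b, add_mul, mul_add, smul_add]
    abel
  smul_mem' := by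
    rintro c D ⟨hD, hD'⟩
    refine ⟨fun q a ha => Submodule.smul_mem _ c (hD q a ha), fun q a ha b => ?_⟩
    simp only [LinearMap.smul_apply, hD' q a ha b, smul_add, smul_mul_assoc, mul_smul_comm]
    rw [smul_comm c]

/-- The Witt superalgebra `W_{m,n}` of superderivations of `A_{m,n}`. -/
def W (m n : ℕ) : Submodule ℂ (Module.End ℂ (A m n)) := WPart m n 0 ⊔ WPart m n 1

theorem WPart_le_W {m n : ℕ} (p : ZMod 2) : WPart m n p ≤ W m n := by
  obtain rfl | rfl := parity_cases p
  · exact le_sup_left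
  · exact le_sup_right

/-- The superbracket `[x, y] = xy - (-1)^{pq} yx` of superderivations of parities `p` and `q`. -/
def bracket {m n : ℕ} (p q : ZMod 2) (x y : Module.End ℂ (A m n)) : Module.End ℂ (A m n) :=
  x * y - sgn p q • (y * x)

theorem bracket_mem {m n : ℕ} {p q : ZMod 2} {x y : Module.End ℂ (A m n)}
    (hx : x ∈ WPart m n p) (hy : y ∈ WPart m n q) : bracket p q x y ∈ WPart m n (p + q) := by
  obtain ⟨hx1, hx2⟩ := hx
  obtain ⟨hy1, hy2⟩ := hy
  refine ⟨fun i a ha => ?_, fun i a ha b => ?_⟩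
  · have h1 := hx1 _ _ (hy1 i a ha)
    have h2 := hy1 _ _ (hx1 i a ha)
    rw [← add_assoc] at h1 h2
    rw [add_comm q p] at h2
    exact Submodule.sub_mem _ h1 (Submodule.smul_mem _ _ h2)
  · simp only [bracket, LinearMap.sub_apply, LinearMap.smul_apply, Module.End.mul_apply,
      hx2 i a ha, hy2 i a ha, map_add, map_smul, hx2 _ _ (hy1 i a ha), hy2 _ _ (hx1 i a ha),
      sgn_add_left, sgn_add_right, sub_mul, mul_sub, smul_add, smul_sub, smul_smul,
      smul_mul_assoc, mul_smul_comm, sgn_comm q p]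
    have h := sgn_mul_self p q
    simp only [← mul_assoc, h, one_mul]
    rw [mul_comm (sgn q i) (sgn p i)]
    module

/-- `∂/∂t_i` for `Sum.inl i` and the left derivative `∂/∂ξ_j` for `Sum.inr j`. -/
def partialD (m n : ℕ) : Fin m ⊕ Fin n → Module.End ℂ (A m n)
  | Sum.inl i => TensorProduct.map (MvPolynomial.pderiv i).toLinearMap LinearMap.id
  | Sum.inr j => TensorProduct.map LinearMap.id
      (CliffordAlgebra.contractLeft (LinearMap.proj j : Module.Dual ℂ (Fin n → ℂ)))

/-- The parity of `∂/∂t_i` is `0`, that of `∂/∂ξ_j` is `1`. -/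
def parD {m n : ℕ} : Fin m ⊕ Fin n → ZMod 2
  | Sum.inl _ => 0
  | Sum.inr _ => 1

/-- `ξ_j`. -/
def xi {n : ℕ} (j : Fin n) : Ext n := ExteriorAlgebra.ι ℂ (Pi.single j 1)

/-- `ξ_I = ξ_{l_1} ⋯ ξ_{l_k}` for `I = {l_1 < ⋯ < l_k}`, and `ξ_∅ = 1`. -/
def xiSet {n : ℕ} (I : Finset (Fin n)) : Ext n := ((I.sort (· ≤ ·)).map xi).prod

/-- `t^α ξ_I ∈ A_{m,n}`. -/
def monom {m n : ℕ} (α : Fin m →₀ ℕ) (I : Finset (Fin n)) : A m n :=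
  MvPolynomial.monomial α 1 ⊗ₜ[ℂ] xiSet I

theorem mul_mem_extPart {n : ℕ} {p q : ZMod 2} {x y : Ext n} (hx : x ∈ extPart n p)
    (hy : y ∈ extPart n q) : x * y ∈ extPart n (p + q) :=
  SetLike.mul_mem_graded (A := CliffordAlgebra.evenOdd (0 : QuadraticForm ℂ (Fin n → ℂ))) hx hy

theorem xi_mem {n : ℕ} (j : Fin n) : xi j ∈ extPart n 1 :=
  CliffordAlgebra.ι_mem_evenOdd_one _ _

theorem one_mem_extPart (n : ℕ) : (1 : Ext n) ∈ extPart n 0 :=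
  CliffordAlgebra.one_le_evenOdd_zero _ (Submodule.one_le.mp le_rfl)

theorem list_prod_mem {n : ℕ} (l : List (Fin n)) :
    (l.map xi).prod ∈ extPart n (l.length : ZMod 2) := by
  induction l with
  | nil => simpa using one_mem_extPart n
  | cons a l ih =>
    simp only [List.map_cons, List.prod_cons, List.length_cons, Nat.cast_add, Nat.cast_one]
    rw [add_comm]
    exact mul_mem_extPart (xi_mem a) ih

theorem xiSet_mem {n : ℕ} (I : Finset (Fin n)) : xiSet I ∈ extPart n (I.card : ZMod 2) := by
  have h := list_prod_mem (I.sort (· ≤ ·))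
  rwa [Finset.length_sort] at h

theorem involute_of_mem {n : ℕ} {p : ZMod 2} {x : Ext n} (hx : x ∈ extPart n p) :
    CliffordAlgebra.involute x = sgn p 1 • x := by
  obtain rfl | rfl := parity_cases p
  · exact (CliffordAlgebra.involute_eq_of_mem_even hx).trans
      (by rw [sgn_zero_left, one_smul])
  · exact (CliffordAlgebra.involute_eq_of_mem_odd hx).trans
      (by rw [sgn_one_one, neg_one_smul])

theorem ι_mul_eq {n : ℕ} (v : Fin n → ℂ) (x : Ext n) :
    ExteriorAlgebra.ι ℂ v * x = CliffordAlgebra.involute x * ExteriorAlgebra.ι ℂ v := by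
  induction x using CliffordAlgebra.left_induction with
  | algebraMap r => rw [AlgHom.commutes]; exact (Algebra.commutes r _).symm
  | add x y hx hy => rw [mul_add, map_add, add_mul, hx, hy]
  | ι_mul x w hx =>
    have h := ExteriorAlgebra.ι_add_mul_swap (R := ℂ) v w
    rw [map_mul, CliffordAlgebra.involute_ι, ← mul_assoc, mul_assoc _ (CliffordAlgebra.involute x),
      ← hx, ← mul_assoc]
    congr 1
    rw [neg_mul]
    exact eq_neg_of_add_eq_zero_left h

theorem extPart_comm {n : ℕ} {p q : ZMod 2} {x y : Ext n} (hx : x ∈ extPart n p)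
    (hy : y ∈ extPart n q) : x * y = sgn p q • (y * x) := by
  have key : ∀ v : Fin n → ℂ, ExteriorAlgebra.ι ℂ v * y = sgn q 1 • (y * ExteriorAlgebra.ι ℂ v) :=
    fun v => by rw [ι_mul_eq, involute_of_mem hy, smul_mul_assoc]
  have two : ∀ (v w : Fin n → ℂ) (z : Ext n) (c : ℂ), z * y = c • (y * z) →
      ExteriorAlgebra.ι ℂ v * ExteriorAlgebra.ι ℂ w * z * y =
        c • (y * (ExteriorAlgebra.ι ℂ v * ExteriorAlgebra.ι ℂ w * z)) := by
    intro v w z c hz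
    rw [mul_assoc _ z y, hz, mul_smul_comm, ← mul_assoc, mul_assoc _ _ y, key w, mul_smul_comm,
      ← mul_assoc, key v, smul_mul_assoc, smul_mul_assoc, smul_mul_assoc, smul_smul,
      smul_smul, mul_assoc c, sgn_mul_self, mul_one]
    simp only [mul_assoc]
  obtain rfl | rfl := parity_cases p
  · induction x, hx using CliffordAlgebra.even_induction with
    | algebraMap r =>
      rw [sgn_zero_left, one_smul]
      exact Algebra.commutes r y
    | add a b _ _ ha hb => rw [add_mul, mul_add, smul_add, ha, hb]
    | ι_mul_ι_mul v w z _ hz => exact two v w z _ hz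
  · induction x, hx using CliffordAlgebra.odd_induction with
    | ι v =>
      have := key v
      rw [sgn_comm] at this
      exact this
    | add a b _ _ ha hb => rw [add_mul, mul_add, smul_add, ha, hb]
    | ι_mul_ι_mul v w z _ hz => exact two v w z _ hz

theorem contract_mul {n : ℕ} (d : Module.Dual ℂ (Fin n → ℂ)) (x y : Ext n) :
    CliffordAlgebra.contractLeft d (x * y) = CliffordAlgebra.contractLeft d x * y +
      CliffordAlgebra.involute x * CliffordAlgebra.contractLeft d y := by
  induction x using CliffordAlgebra.left_induction with
  | algebraMap r =>
    rw [CliffordAlgebra.contractLeft_algebraMap_mul, CliffordAlgebra.contractLeft_algebraMap,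
      AlgHom.commutes, zero_mul, zero_add]
  | add a b ha hb =>
    simp only [add_mul, map_add, ha, hb]
    abel
  | ι_mul a v ha =>
    rw [mul_assoc, CliffordAlgebra.contractLeft_ι_mul, CliffordAlgebra.contractLeft_ι_mul, ha,
      map_mul, CliffordAlgebra.involute_ι, sub_mul, smul_mul_assoc, mul_add, neg_mul, neg_mul,
      mul_assoc, mul_assoc]
    abel

theorem contract_mem {n : ℕ} (d : Module.Dual ℂ (Fin n → ℂ)) {p : ZMod 2} {x : Ext n}
    (hx : x ∈ extPart n p) : CliffordAlgebra.contractLeft d x ∈ extPart n (1 + p) := by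
  have two : ∀ (v w : Fin n → ℂ) (z : Ext n) (q : ZMod 2), z ∈ extPart n q →
      CliffordAlgebra.contractLeft d z ∈ extPart n (1 + q) →
      CliffordAlgebra.contractLeft d
        (CliffordAlgebra.ι 0 v * CliffordAlgebra.ι 0 w * z) ∈ extPart n (1 + q) := by
    intro v w z q hz hdz
    have hι : ∀ u : Fin n → ℂ, (CliffordAlgebra.ι 0 u : Ext n) ∈ extPart n 1 :=
      fun u => CliffordAlgebra.ι_mem_evenOdd_one _ _
    rw [mul_assoc, CliffordAlgebra.contractLeft_ι_mul, CliffordAlgebra.contractLeft_ι_mul, mul_sub]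
    have h1 := mul_mem_extPart (hι w) hz
    have h2 := mul_mem_extPart (hι v) hz
    have h3 := mul_mem_extPart (hι v) (mul_mem_extPart (hι w) hdz)
    have e : (1 : ZMod 2) + (1 + (1 + q)) = 1 + q := by
      rw [← add_assoc, CharTwo.add_self_eq_zero, zero_add]
    rw [e] at h3
    refine Submodule.sub_mem _ (Submodule.smul_mem _ _ h1) (Submodule.sub_mem _ ?_ h3)
    rw [mul_smul_comm]
    exact Submodule.smul_mem _ _ h2
  obtain rfl | rfl := parity_cases p
  · induction x, hx using CliffordAlgebra.even_induction with
    | algebraMap r =>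
      rw [CliffordAlgebra.contractLeft_algebraMap]
      exact Submodule.zero_mem _
    | add a b _ _ ha hb => rw [map_add]; exact Submodule.add_mem _ ha hb
    | ι_mul_ι_mul v w z hz hdz => exact two v w z _ hz hdz
  · induction x, hx using CliffordAlgebra.odd_induction with
    | ι v =>
      rw [CliffordAlgebra.contractLeft_ι, Algebra.algebraMap_eq_smul_one]
      exact Submodule.smul_mem _ _ (one_mem_extPart n)
    | add a b _ _ ha hb => rw [map_add]; exact Submodule.add_mem _ ha hb
    | ι_mul_ι_mul v w z hz hdz => exact two v w z _ hz hdz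

theorem tmul_mem {m n : ℕ} {p : ZMod 2} (f : MvPolynomial (Fin m) ℂ) {x : Ext n}
    (hx : x ∈ extPart n p) : f ⊗ₜ[ℂ] x ∈ APart m n p :=
  Submodule.apply_mem_map₂ _ trivial hx

/-- An element of `A_{m,n}` of parity `p` is a sum of tensors `f ⊗ x` with `x` of parity `p`. -/
theorem APart_induction {m n : ℕ} {p : ZMod 2} {P : A m n → Prop}
    (h0 : P 0) (hadd : ∀ a b, P a → P b → P (a + b))
    (ht : ∀ (f : MvPolynomial (Fin m) ℂ) (x : Ext n), x ∈ extPart n p → P (f ⊗ₜ[ℂ] x))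
    {a : A m n} (ha : a ∈ APart m n p) : P a := by
  rw [APart, Submodule.map₂_eq_span_image2] at ha
  have key : ∀ c : ℂ, P (c • a) := by
    refine Submodule.span_induction (p := fun a _ => ∀ c : ℂ, P (c • a)) ?_ ?_ ?_ ?_ ha
    · rintro _ ⟨f, -, x, hx, rfl⟩ c
      have := ht (c • f) x hx
      rwa [← TensorProduct.smul_tmul'] at this
    · intro c
      rwa [smul_zero]
    · intro x y _ _ hx hy c
      rw [smul_add]
      exact hadd _ _ (hx c) (hy c)
    · intro d x _ hx c
      rw [smul_smul]
      exact hx _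
  simpa using key 1

theorem mul_mem_APart {m n : ℕ} {p q : ZMod 2} {a b : A m n} (ha : a ∈ APart m n p)
    (hb : b ∈ APart m n q) : a * b ∈ APart m n (p + q) := by
  refine APart_induction (P := fun a => a * b ∈ APart m n (p + q)) ?_ ?_ ?_ ha
  · rw [zero_mul]; exact Submodule.zero_mem _
  · intro a a' h h'
    rw [add_mul]; exact Submodule.add_mem _ h h'
  · intro f x hx
    refine APart_induction (P := fun b => f ⊗ₜ[ℂ] x * b ∈ APart m n (p + q)) ?_ ?_ ?_ hb
    · rw [mul_zero]; exact Submodule.zero_mem _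
    · intro a a' h h'
      rw [mul_add]; exact Submodule.add_mem _ h h'
    · intro g y hy
      rw [Algebra.TensorProduct.tmul_mul_tmul]
      exact tmul_mem _ (mul_mem_extPart hx hy)

theorem APart_comm {m n : ℕ} {p q : ZMod 2} {a b : A m n} (ha : a ∈ APart m n p)
    (hb : b ∈ APart m n q) : a * b = sgn p q • (b * a) := by
  refine APart_induction (P := fun a => a * b = sgn p q • (b * a)) ?_ ?_ ?_ ha
  · rw [zero_mul, mul_zero, smul_zero]
  · intro a a' h h'
    rw [add_mul, mul_add, smul_add, h, h']
  · intro f x hx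
    refine APart_induction (P := fun b => f ⊗ₜ[ℂ] x * b = sgn p q • (b * f ⊗ₜ[ℂ] x)) ?_ ?_ ?_ hb
    · rw [zero_mul, mul_zero, smul_zero]
    · intro a a' h h'
      rw [add_mul, mul_add, smul_add, h, h']
    · intro g y hy
      rw [Algebra.TensorProduct.tmul_mul_tmul, Algebra.TensorProduct.tmul_mul_tmul,
        extPart_comm hx hy, TensorProduct.tmul_smul, mul_comm f g]

theorem monom_mem {m n : ℕ} (α : Fin m →₀ ℕ) (I : Finset (Fin n)) :
    (monom α I : A m n) ∈ APart m n (I.card : ZMod 2) :=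
  tmul_mem _ (xiSet_mem I)

theorem partialD_mem {m n : ℕ} (s : Fin m ⊕ Fin n) : partialD m n s ∈ WPart m n (parD s) := by
  refine ⟨fun q a ha => ?_, fun q a ha b => ?_⟩
  · refine APart_induction (P := fun a => partialD m n s a ∈ APart m n (parD s + q)) ?_ ?_ ?_ ha
    · rw [map_zero]; exact Submodule.zero_mem _
    · intro a b h h'
      rw [map_add]; exact Submodule.add_mem _ h h'
    · intro f x hx
      cases s with
      | inl i =>
        simp only [partialD, parD, TensorProduct.map_tmul, zero_add]
        exact tmul_mem _ hx
      | inr j =>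
        simp only [partialD, parD, TensorProduct.map_tmul]
        exact tmul_mem _ (contract_mem _ hx)
  · refine APart_induction (P := fun a => partialD m n s (a * b) =
      partialD m n s a * b + sgn (parD s) q • (a * partialD m n s b)) ?_ ?_ ?_ ha
    · simp
    · intro a a' h h'
      simp only [add_mul, map_add, h, h', smul_add]
      abel
    · intro f x hx
      induction b using TensorProduct.induction_on with
      | zero => simp
      | add b b' h h' =>
        simp only [mul_add, map_add, h, h', smul_add]
        abel
      | tmul g y =>
        cases s with
        | inl i =>
          simp only [partialD, parD, TensorProduct.map_tmul, Algebra.TensorProduct.tmul_mul_tmul,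
            LinearMap.id_apply, sgn_zero_left, one_smul]
          rw [← TensorProduct.add_tmul]
          congr 1
          change MvPolynomial.pderiv i (f * g) = MvPolynomial.pderiv i f * g +
            f * MvPolynomial.pderiv i g
          rw [Derivation.leibniz, smul_eq_mul, smul_eq_mul, add_comm, mul_comm g]
        | inr j =>
          simp only [partialD, parD, TensorProduct.map_tmul, Algebra.TensorProduct.tmul_mul_tmul,
            LinearMap.id_apply]
          rw [contract_mul, involute_of_mem hx, TensorProduct.tmul_add, smul_mul_assoc,
            TensorProduct.tmul_smul, sgn_comm]

theorem mulLeft_mem {m n : ℕ} {p q : ZMod 2} {a : A m n} {D : Module.End ℂ (A m n)}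
    (ha : a ∈ APart m n p) (hD : D ∈ WPart m n q) :
    LinearMap.mulLeft ℂ a ∘ₗ D ∈ WPart m n (p + q) := by
  refine ⟨fun i b hb => ?_, fun i b hb c => ?_⟩
  · have := mul_mem_APart ha (hD.1 i b hb)
    rwa [← add_assoc] at this
  · simp only [LinearMap.comp_apply, LinearMap.mulLeft_apply, hD.2 i b hb c]
    rw [mul_add, mul_smul_comm, ← mul_assoc, ← mul_assoc, APart_comm ha hb, sgn_add_left,
      smul_mul_assoc, smul_smul, mul_comm (sgn q i), mul_assoc b]

/-- The operator `t^α ξ_I ∂` on `A_{m,n}`. -/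
def vecD {m n : ℕ} (α : Fin m →₀ ℕ) (I : Finset (Fin n)) (s : Fin m ⊕ Fin n) :
    Module.End ℂ (A m n) :=
  LinearMap.mulLeft ℂ (monom α I) ∘ₗ partialD m n s

theorem vecD_mem {m n : ℕ} (α : Fin m →₀ ℕ) (I : Finset (Fin n)) (s : Fin m ⊕ Fin n) :
    (vecD α I s : Module.End ℂ (A m n)) ∈ WPart m n (I.card + parD s) :=
  mulLeft_mem (monom_mem α I) (partialD_mem s)

/-- The element `t^α ξ_I ∂` of `W_{m,n}`. -/
def vec {m n : ℕ} (α : Fin m →₀ ℕ) (I : Finset (Fin n)) (s : Fin m ⊕ Fin n) : W m n :=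
  ⟨vecD α I s, WPart_le_W _ (vecD_mem α I s)⟩

/-- The relations `xy - (-1)^{|x||y|} yx = [x, y]`, for homogeneous `x, y ∈ W_{m,n}`, that define
the universal enveloping algebra. -/
inductive URel (m n : ℕ) : TensorAlgebra ℂ (W m n) → TensorAlgebra ℂ (W m n) → Prop
  | bracket {p q : ZMod 2} {x y : Module.End ℂ (A m n)}
      (hx : x ∈ WPart m n p) (hy : y ∈ WPart m n q) :
      URel m n
        (TensorAlgebra.ι ℂ (⟨x, WPart_le_W p hx⟩ : W m n) *
            TensorAlgebra.ι ℂ (⟨y, WPart_le_W q hy⟩ : W m n) -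
          sgn p q • (TensorAlgebra.ι ℂ (⟨y, WPart_le_W q hy⟩ : W m n) *
            TensorAlgebra.ι ℂ (⟨x, WPart_le_W p hx⟩ : W m n)))
        (TensorAlgebra.ι ℂ (⟨bracket p q x y, WPart_le_W _ (bracket_mem hx hy)⟩ : W m n))

/-- The universal enveloping algebra `U(W_{m,n})`. -/
abbrev U (m n : ℕ) : Type := RingQuot (URel m n)

/-- The canonical map `W_{m,n} → U(W_{m,n})`. -/
def toU {m n : ℕ} (x : W m n) : U m n :=
  RingQuot.mkAlgHom ℂ (URel m n) (TensorAlgebra.ι ℂ x)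

/-- The element
`ω = ∑_{i=0}^r (-1)^i (r choose i) t^{α+(r-i)e_j} ξ_I ∂ · t^{β+i e_j} ξ_J ∂'` of `U(W_{m,n})`. -/
def omega {m n : ℕ} (r : ℕ) (j : Fin m) (s s' : Fin m ⊕ Fin n) (α β : Fin m →₀ ℕ)
    (I J : Finset (Fin n)) : U m n :=
  ∑ i ∈ Finset.range (r + 1), ((-1 : ℂ) ^ i * (r.choose i : ℂ)) •
    (toU (vec (α + Finsupp.single j (r - i)) I s) * toU (vec (β + Finsupp.single j i) J s'))

/-- The structure of a (`ℤ/2`-graded) module over the Lie superalgebra `W_{m,n}` on `M`. -/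
structure WModule (m n : ℕ) (M : Type*) [AddCommGroup M] [Module ℂ M] where
  /-- the homogeneous components of `M` -/
  part : ZMod 2 → Submodule ℂ M
  isInternal : DirectSum.IsInternal part
  /-- the action of `W_{m,n}` -/
  act : W m n →ₗ[ℂ] Module.End ℂ M
  act_mem : ∀ (p q : ZMod 2) (x : W m n), (x : Module.End ℂ (A m n)) ∈ WPart m n p →
    ∀ v ∈ part q, act x v ∈ part (p + q)
  act_bracket : ∀ (p q : ZMod 2) (x y : Module.End ℂ (A m n)) (hx : x ∈ WPart m n p)
    (hy : y ∈ WPart m n q),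
    act ⟨bracket p q x y, WPart_le_W _ (bracket_mem hx hy)⟩ =
      act ⟨x, WPart_le_W p hx⟩ * act ⟨y, WPart_le_W q hy⟩ -
        sgn p q • (act ⟨y, WPart_le_W q hy⟩ * act ⟨x, WPart_le_W p hx⟩)

namespace WModule

variable {m n : ℕ} {M : Type*} [AddCommGroup M] [Module ℂ M] (ρ : WModule m n M)

/-- The action of `U(W_{m,n})` on `M` that extends the action of `W_{m,n}`. -/
def actU : U m n →ₐ[ℂ] Module.End ℂ M :=
  RingQuot.liftAlgHom ℂ ⟨TensorAlgebra.lift ℂ ρ.act, by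
    rintro _ _ ⟨hx, hy⟩
    simp only [map_sub, map_mul, map_smul, TensorAlgebra.lift_ι_apply]
    exact (ρ.act_bracket _ _ _ _ hx hy).symm⟩

theorem actU_toU (x : W m n) : ρ.actU (toU x) = ρ.act x := by
  simp [actU, toU]

/-- The weight space `M_{(λ, μ)}`: the vectors `v` with `d_i v = λ_i v` and `δ_j v = μ_j v`, where
`d_i = t_i ∂/∂t_i` and `δ_j = ξ_j ∂/∂ξ_j`. -/
def weightSpace (w : (Fin m → ℂ) × (Fin n → ℂ)) : Submodule ℂ M where
  carrier := {v | (∀ i, ρ.act (vec (Finsupp.single i 1) ∅ (Sum.inl i)) v = w.1 i • v) ∧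
    ∀ j, ρ.act (vec 0 {j} (Sum.inr j)) v = w.2 j • v}
  zero_mem' := by simp
  add_mem' := by
    rintro u v ⟨h1, h2⟩ ⟨h3, h4⟩
    exact ⟨fun i => by rw [map_add, h1, h3, smul_add], fun j => by rw [map_add, h2, h4, smul_add]⟩
  smul_mem' := by
    rintro c v ⟨h1, h2⟩
    exact ⟨fun i => by rw [map_smul, h1, smul_comm], fun j => by rw [map_smul, h2, smul_comm]⟩

open Classical in
/-- `M` is a weight module: it is the direct sum of its weight spaces. -/
def IsWeight : Prop := DirectSum.IsInternal ρ.weightSpace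

/-- `M` is a bounded weight module: the dimensions of its weight spaces are finite and uniformly
bounded. -/
def IsBounded : Prop :=
  ρ.IsWeight ∧ ∃ N : ℕ, ∀ w, Module.rank ℂ (ρ.weightSpace w) ≤ N

end WModule

end WittSuper

end

/-! Quadratic expressions in two families of operators are encoded by polynomials: `word₂ f g` sends
x^a y^b to f_a g_b. By the binomial theorem ω acts as the value of such a map at (x-y)^r times a
monomial, the families being t_j^k a ∂ and t_j^k b ∂' with a, b free of t_j (`actU_omega`). The task
is to kill the whole ideal of (x-y)^r, with one r for all families.

Rank one comes first: both families are E_a = t_j^a ∂/∂t_j. Put D = E_0 and let J_r (`diagSpan`) be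
the set of values on the ideal of (x-y)^r. Three facts combine.

(1) Reversing three letters of a word by transpositions produces a shorter word as the only
correction. Used twice, this gives J_{4r} ⊆ J_r J_r for r ≥ 2 (`diagSpan_le_mul`), so high exponents
give long products.

(2) The word of (x-y)^4, times D^2, is 2[D E_2, D^2 E_3] (`WittRel.word₂_four`), and D E_2, D^2 E_3
act on each finite-dimensional weight space. The matrix coefficients of D^{K-1} E_K / K! satisfy
difference equations in K which show that, to leading order as K grows, right multiplication by D
E_2 and by D^2 E_3 acts as a polynomial in the Euler operator (K+1)Δ. Such polynomials commute, so
the commutator lowers the order of growth and maps into a proper invariant subspace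
(`IsRec.exists_proper`). Iteration gives a chain of length at most N in every weight space. Elements
of J_4 push these chains down, up to powers of D, so by (1) the word of a high power of x-y vanishes
after right multiplication by some D^n (`WittWeights.exists_word₂_mul_pow`).

(3) To remove D^n, filter M by the D-nilpotent vectors and, among them, the infinitely D-divisible
ones. The word from (2) commutes with D, so it maps M into the first space, and it kills the second,
whose vectors are of the form D^n u. On the quotient of the first by the second every E_a acts as
zero (`WittWeights.apply_mem_nilpCore`), by an sl_2 argument in weights far in the direction of t_j.
Hence a product of three elements of the corresponding J vanishes, and (1) yields J_r = 0 for an r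
depending only on N (`WittWeights.diagSpan_eq_bot`).

Finally, supercommuting this relation with fields t_j^c a ∂ replaces the two families by arbitrary
ones; the exponent grows by at most 4 (`killsDiag_fam`). -/

noncomputable section

namespace WittSuper

open MvPolynomial

/-! ### Words encoded by polynomials, and the cost of exchanging letters -/

section Words

variable {R : Type*} [Ring R] [Algebra ℂ R]

/-- The linear map sending `∏ X_i ^ (a i)` to the ordered product `f 0 (a 0) * f 1 (a 1) * ⋯`. -/
def wordMap {k : ℕ} (f : Fin k → ℕ → R) : MvPolynomial (Fin k) ℂ →ₗ[ℂ] R :=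
  (basisMonomials (Fin k) ℂ).constr ℂ fun s => (List.ofFn fun i => f i (s i)).prod

theorem prod_X_pow_eq {k : ℕ} (a : Fin k → ℕ) :
    (∏ i, X i ^ a i : MvPolynomial (Fin k) ℂ) = monomial (Finsupp.equivFunOnFinite.symm a) 1 := by
  rw [monomial_eq, C_1, one_mul, Finsupp.prod_fintype _ _ (fun _ => pow_zero _)]
  rfl

theorem wordMap_prod {k : ℕ} (f : Fin k → ℕ → R) (a : Fin k → ℕ) :
    wordMap f (∏ i, X i ^ a i) = (List.ofFn fun i => f i (a i)).prod := by
  rw [prod_X_pow_eq, wordMap]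
  have := (basisMonomials (Fin k) ℂ).constr_basis ℂ
    (fun s => (List.ofFn fun i => f i (s i)).prod) (Finsupp.equivFunOnFinite.symm a)
  rw [coe_basisMonomials] at this
  exact this

theorem linearMap_ext_prod {k : ℕ} {V : Type*} [AddCommGroup V] [Module ℂ V]
    {f g : MvPolynomial (Fin k) ℂ →ₗ[ℂ] V}
    (h : ∀ a : Fin k → ℕ, f (∏ i, X i ^ a i) = g (∏ i, X i ^ a i)) : f = g := by
  refine (basisMonomials (Fin k) ℂ).ext fun s => ?_
  have := h s
  rw [prod_X_pow_eq] at this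
  rw [coe_basisMonomials]
  convert this using 3 <;> simp

theorem mem_of_prod {k : ℕ} {S : Submodule ℂ (MvPolynomial (Fin k) ℂ)}
    (h : ∀ a : Fin k → ℕ, ∏ i, X i ^ a i ∈ S) (p : MvPolynomial (Fin k) ℂ) : p ∈ S := by
  have : (Submodule.mkQ S) = 0 := linearMap_ext_prod fun a => by
    simpa using h a
  have := LinearMap.congr_fun this p
  simpa using this

/-- Words in two letters. -/
def word₂ (f g : ℕ → R) : MvPolynomial (Fin 2) ℂ →ₗ[ℂ] R := wordMap ![f, g]

/-- Words in three letters. -/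
def word₃ (f g h : ℕ → R) : MvPolynomial (Fin 3) ℂ →ₗ[ℂ] R := wordMap ![f, g, h]

/-- Words in four letters. -/
def word₄ (f g h c : ℕ → R) : MvPolynomial (Fin 4) ℂ →ₗ[ℂ] R := wordMap ![f, g, h, c]

theorem word₂_apply (f g : ℕ → R) (a b : ℕ) : word₂ f g (X 0 ^ a * X 1 ^ b) = f a * g b := by
  have := wordMap_prod ![f, g] ![a, b]
  simpa [Fin.prod_univ_two, List.ofFn_succ, word₂] using this

theorem word₃_apply (f g h : ℕ → R) (a b c : ℕ) :
    word₃ f g h (X 0 ^ a * X 1 ^ b * X 2 ^ c) = f a * g b * h c := by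
  have := wordMap_prod ![f, g, h] ![a, b, c]
  simpa [Fin.prod_univ_three, List.ofFn_succ, word₃, mul_assoc] using this

theorem word₄_apply (f g h k : ℕ → R) (a b c d : ℕ) :
    word₄ f g h k (X 0 ^ a * X 1 ^ b * X 2 ^ c * X 3 ^ d) = f a * g b * h c * k d := by
  have := wordMap_prod ![f, g, h, k] ![a, b, c, d]
  simpa [Fin.prod_univ_four, List.ofFn_succ, word₄, mul_assoc] using this

theorem ext₂ {V : Type*} [AddCommGroup V] [Module ℂ V] {f g : MvPolynomial (Fin 2) ℂ →ₗ[ℂ] V}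
    (h : ∀ a b, f (X 0 ^ a * X 1 ^ b) = g (X 0 ^ a * X 1 ^ b)) : f = g :=
  linearMap_ext_prod fun a => by simpa [Fin.prod_univ_two] using h (a 0) (a 1)

theorem ext₃ {V : Type*} [AddCommGroup V] [Module ℂ V] {f g : MvPolynomial (Fin 3) ℂ →ₗ[ℂ] V}
    (h : ∀ a b c, f (X 0 ^ a * X 1 ^ b * X 2 ^ c) = g (X 0 ^ a * X 1 ^ b * X 2 ^ c)) : f = g :=
  linearMap_ext_prod fun a => by simpa [Fin.prod_univ_three] using h (a 0) (a 1) (a 2)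

theorem ext₄ {V : Type*} [AddCommGroup V] [Module ℂ V] {f g : MvPolynomial (Fin 4) ℂ →ₗ[ℂ] V}
    (h : ∀ a b c d, f (X 0 ^ a * X 1 ^ b * X 2 ^ c * X 3 ^ d) =
      g (X 0 ^ a * X 1 ^ b * X 2 ^ c * X 3 ^ d)) : f = g :=
  linearMap_ext_prod fun a => by simpa [Fin.prod_univ_four] using h (a 0) (a 1) (a 2) (a 3)

theorem mem_of_prod₂ {S : Submodule ℂ (MvPolynomial (Fin 2) ℂ)}
    (h : ∀ a b, X 0 ^ a * X 1 ^ b ∈ S) (p : MvPolynomial (Fin 2) ℂ) : p ∈ S :=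
  mem_of_prod (fun a => by simpa [Fin.prod_univ_two] using h (a 0) (a 1)) p

theorem mem_of_prod₄ {S : Submodule ℂ (MvPolynomial (Fin 4) ℂ)}
    (h : ∀ a b c d, X 0 ^ a * X 1 ^ b * X 2 ^ c * X 3 ^ d ∈ S) (p : MvPolynomial (Fin 4) ℂ) :
    p ∈ S :=
  mem_of_prod (fun a => by simpa [Fin.prod_univ_four] using h (a 0) (a 1) (a 2) (a 3)) p

/-- The relations of the operators `t^a d/dt`, up to sign. -/
def WittRel (E : ℕ → R) : Prop :=
  ∀ a b, E a * E b - E b * E a = ((b : ℂ) - a) • E (a + b - 1)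

variable {E : ℕ → R}

/-- The Wronskian form of the bracket of x^a d/dx and x^b d/dx. The truncated exponent is harmless:
for a = b = 0 its coefficient vanishes. -/
theorem contract_eq {k : ℕ} (x : MvPolynomial (Fin k) ℂ) (a b : ℕ) :
    x ^ a * ((b : ℂ) • x ^ (b - 1)) - ((a : ℂ) • x ^ (a - 1)) * x ^ b =
      ((b : ℂ) - a) • x ^ (a + b - 1) := by
  rcases a with _ | a <;> rcases b with _ | b
  · simp
  · simp
  · simp [← neg_smul, add_comm]
  · have h1 : a + 1 + (b + 1) - 1 = a + b + 1 := by omega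
    simp only [Nat.add_sub_cancel, h1]
    rw [sub_smul, mul_smul_comm, smul_mul_assoc]
    ring_nf

/-- The bracket of two letters is a Wronskian, that is, the restriction to the diagonal of the
difference of the two partial derivatives. By linearity this describes the correction for every
polynomial at once. -/
theorem word₄_swap_left (hE : WittRel E) (f c : ℕ → R) (p : MvPolynomial (Fin 4) ℂ) :
    word₄ E E f c p - word₄ E E f c (aeval ![X 1, X 0, X 2, X 3] p) =
      word₃ E f c (aeval ![X 0, X 0, X 1, X 2] (pderiv 1 p - pderiv 0 p)) := by
  let L₁ : MvPolynomial (Fin 4) ℂ →ₗ[ℂ] R := word₄ E E f c -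
    word₄ E E f c ∘ₗ (aeval ![X 1, X 0, X 2, X 3] : MvPolynomial (Fin 4) ℂ →ₐ[ℂ] _).toLinearMap
  let L₂ : MvPolynomial (Fin 4) ℂ →ₗ[ℂ] R := word₃ E f c ∘ₗ
    (aeval ![X 0, X 0, X 1, X 2] : MvPolynomial (Fin 4) ℂ →ₐ[ℂ] _).toLinearMap ∘ₗ
      ((pderiv 1).toLinearMap - (pderiv 0).toLinearMap)
  suffices h : L₁ = L₂ from LinearMap.congr_fun h p
  refine ext₄ fun a b d e => ?_
  have h1 : (X 1 ^ a * X 0 ^ b * X 2 ^ d * X 3 ^ e : MvPolynomial (Fin 4) ℂ) =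
    X 0 ^ b * X 1 ^ a * X 2 ^ d * X 3 ^ e := by ring
  have key := contract_eq (X 0 : MvPolynomial (Fin 3) ℂ) a b
  have h2 : (aeval ![X 0, X 0, X 1, X 2] : MvPolynomial (Fin 4) ℂ →ₐ[ℂ] MvPolynomial (Fin 3) ℂ)
      (pderiv 1 (X 0 ^ a * X 1 ^ b * X 2 ^ d * X 3 ^ e) -
        pderiv 0 (X 0 ^ a * X 1 ^ b * X 2 ^ d * X 3 ^ e)) =
      ((b : ℂ) - a) • (X 0 ^ (a + b - 1) * X 1 ^ d * X 2 ^ e) := by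
    rw [← smul_mul_assoc, ← smul_mul_assoc, ← key]
    simp [Derivation.leibniz_pow, pderiv_X, Algebra.smul_def]
    ring
  simp only [L₁, L₂, LinearMap.sub_apply, LinearMap.comp_apply, AlgHom.toLinearMap_apply,
    Derivation.coeFn_coe]
  rw [h2, map_smul, word₃_apply, word₄_apply]
  simp only [map_mul, map_pow, aeval_X]
  simp only [Matrix.cons_val]
  rw [h1, word₄_apply, ← smul_mul_assoc, ← smul_mul_assoc, ← hE]
  noncomm_ring

theorem word₄_swap_mid (hE : WittRel E) (f c : ℕ → R) (p : MvPolynomial (Fin 4) ℂ) :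
    word₄ f E E c p - word₄ f E E c (aeval ![X 0, X 2, X 1, X 3] p) =
      word₃ f E c (aeval ![X 0, X 1, X 1, X 2] (pderiv 2 p - pderiv 1 p)) := by
  let L₁ : MvPolynomial (Fin 4) ℂ →ₗ[ℂ] R := word₄ f E E c -
    word₄ f E E c ∘ₗ (aeval ![X 0, X 2, X 1, X 3] : MvPolynomial (Fin 4) ℂ →ₐ[ℂ] _).toLinearMap
  let L₂ : MvPolynomial (Fin 4) ℂ →ₗ[ℂ] R := word₃ f E c ∘ₗ
    (aeval ![X 0, X 1, X 1, X 2] : MvPolynomial (Fin 4) ℂ →ₐ[ℂ] _).toLinearMap ∘ₗ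
      ((pderiv 2).toLinearMap - (pderiv 1).toLinearMap)
  suffices h : L₁ = L₂ from LinearMap.congr_fun h p
  refine ext₄ fun d a b e => ?_
  have h1 : (X 0 ^ d * X 2 ^ a * X 1 ^ b * X 3 ^ e : MvPolynomial (Fin 4) ℂ) =
    X 0 ^ d * X 1 ^ b * X 2 ^ a * X 3 ^ e := by ring
  have key := contract_eq (X 1 : MvPolynomial (Fin 3) ℂ) a b
  have h2 : (aeval ![X 0, X 1, X 1, X 2] : MvPolynomial (Fin 4) ℂ →ₐ[ℂ] MvPolynomial (Fin 3) ℂ)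
      (pderiv 2 (X 0 ^ d * X 1 ^ a * X 2 ^ b * X 3 ^ e) -
        pderiv 1 (X 0 ^ d * X 1 ^ a * X 2 ^ b * X 3 ^ e)) =
      ((b : ℂ) - a) • (X 0 ^ d * X 1 ^ (a + b - 1) * X 2 ^ e) := by
    rw [← smul_mul_assoc, ← mul_smul_comm, ← key]
    simp [Derivation.leibniz_pow, pderiv_X, Algebra.smul_def]
    ring
  simp only [L₁, L₂, LinearMap.sub_apply, LinearMap.comp_apply, AlgHom.toLinearMap_apply,
    Derivation.coeFn_coe]
  rw [h2, map_smul, word₃_apply, word₄_apply]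
  simp only [map_mul, map_pow, aeval_X]
  simp only [Matrix.cons_val]
  rw [h1, word₄_apply, ← smul_mul_assoc, ← mul_smul_comm, ← hE]
  noncomm_ring

/-- First derivatives of a multiple of (X 0 - X 1)^2 vanish on the diagonal, so this exchange is
free of correction. -/
theorem word₄_swap_left_of_sq (hE : WittRel E) (f c : ℕ → R) (g : MvPolynomial (Fin 4) ℂ) :
    word₄ E E f c ((X 0 - X 1) ^ 2 * g) =
      word₄ E E f c ((X 0 - X 1) ^ 2 * aeval ![X 1, X 0, X 2, X 3] g) := by
  have h := word₄_swap_left hE f c ((X 0 - X 1) ^ 2 * g)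
  have h2 : (aeval ![X 0, X 0, X 1, X 2] : MvPolynomial (Fin 4) ℂ →ₐ[ℂ] MvPolynomial (Fin 3) ℂ)
      (pderiv 1 ((X 0 - X 1) ^ 2 * g) - pderiv 0 ((X 0 - X 1) ^ 2 * g)) = 0 := by
    simp [Derivation.leibniz_pow]
  rw [h2, map_zero, sub_eq_zero] at h
  rw [h]
  congr 1
  simp only [map_mul, map_pow, map_sub, aeval_X, Matrix.cons_val]
  ring

/-- Moving the first letter past the second and the third leaves a shorter word. -/
theorem word₃_mem (hE : WittRel E) (c : ℕ → R) (Q : Submodule ℂ R) (g : MvPolynomial (Fin 4) ℂ)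
    (h1 : word₄ E E E c ((X 0 - X 2) * ((X 0 - X 1) ^ 2 * (X 1 - X 2) ^ 2 * g)) ∈ Q)
    (h2 : word₄ E E E c (aeval ![X 2, X 1, X 0, X 3]
      ((X 0 - X 2) * ((X 0 - X 1) ^ 2 * (X 1 - X 2) ^ 2 * g))) ∈ Q) :
    word₃ E E c (aeval ![X 1, X 0, X 1, X 2] ((X 0 - X 1) ^ 2 * (X 1 - X 2) ^ 2 * g)) ∈ Q := by
  set s : MvPolynomial (Fin 4) ℂ →ₐ[ℂ] MvPolynomial (Fin 4) ℂ := aeval ![X 1, X 0, X 2, X 3]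
    with hs
  set t : MvPolynomial (Fin 4) ℂ →ₐ[ℂ] MvPolynomial (Fin 4) ℂ := aeval ![X 0, X 2, X 1, X 3]
    with ht
  have e1 : word₄ E E E c ((X 0 - X 2) * ((X 0 - X 1) ^ 2 * (X 1 - X 2) ^ 2 * g)) =
      word₄ E E E c ((X 0 - X 1) ^ 2 * ((X 1 - X 2) * (X 0 - X 2) ^ 2 * s g)) := by
    have := word₄_swap_left_of_sq hE E c ((X 0 - X 2) * (X 1 - X 2) ^ 2 * g)
    convert this using 2
    · ring
    · simp [hs]
  -- The reversal is a product of three transpositions, and only this middle one costs anything: `X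
  -- 1 - X 2` now occurs to the first power, so its derivative, the -2 of `e4`, survives on the
  -- diagonal.
  have e2 := word₄_swap_mid hE E c ((X 0 - X 1) ^ 2 * ((X 1 - X 2) * (X 0 - X 2) ^ 2 * s g))
  have e3 : word₄ E E E c (t ((X 0 - X 1) ^ 2 * ((X 1 - X 2) * (X 0 - X 2) ^ 2 * s g))) =
      word₄ E E E c (aeval ![X 2, X 1, X 0, X 3]
      ((X 0 - X 2) * ((X 0 - X 1) ^ 2 * (X 1 - X 2) ^ 2 * g))) := by
    have := word₄_swap_left_of_sq hE E c ((X 0 - X 2) ^ 2 * (X 2 - X 1) * t (s g))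
    have hc : (s.comp t).comp s = aeval ![X 2, X 1, X 0, X 3] := by
      refine MvPolynomial.algHom_ext fun i => ?_
      fin_cases i <;> simp [hs, ht]
    convert this using 2
    · simp [ht]
      ring
    · have : s (t (s g)) = (aeval ![X 2, X 1, X 0, X 3] : MvPolynomial (Fin 4) ℂ →ₐ[ℂ] _) g := by
        rw [← hc]; rfl
      rw [map_mul s, this]
      simp [hs]
      ring
  have hc' : (aeval ![X 0, X 1, X 1, X 2] : MvPolynomial (Fin 4) ℂ →ₐ[ℂ]
      MvPolynomial (Fin 3) ℂ).comp s = aeval ![X 1, X 0, X 1, X 2] := by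
    refine MvPolynomial.algHom_ext fun i => ?_
    fin_cases i <;> simp [hs]
  have e4 : (aeval ![X 0, X 1, X 1, X 2] : MvPolynomial (Fin 4) ℂ →ₐ[ℂ] MvPolynomial (Fin 3) ℂ)
      (pderiv 2 ((X 0 - X 1) ^ 2 * ((X 1 - X 2) * (X 0 - X 2) ^ 2 * s g)) -
        pderiv 1 ((X 0 - X 1) ^ 2 * ((X 1 - X 2) * (X 0 - X 2) ^ 2 * s g))) =
      (-2 : ℂ) • aeval ![X 1, X 0, X 1, X 2] ((X 0 - X 1) ^ 2 * (X 1 - X 2) ^ 2 * g) := by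
    rw [← hc']
    generalize hp : s g = p
    simp [Derivation.leibniz_pow, -aeval_eq_bind₁, pderiv_X, ← Nat.cast_smul_eq_nsmul ℂ, hp]
    simp only [hs, aeval_X, Matrix.cons_val, Algebra.smul_def, map_ofNat]
    ring
  rw [e4, map_smul, ← ht, e3, ← e1] at e2
  have := Q.sub_mem h1 h2
  rw [e2] at this
  exact (Q.smul_mem_iff (by norm_num)).mp this

end Words

/-! ### The spaces J_r and their products -/

section Products

variable {R : Type*} [Ring R] [Algebra ℂ R] {E : ℕ → R}

/-- The values of `word₂ f g` on the ideal generated by `(X 0 - X 1) ^ r`. -/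
def diagSpan (f g : ℕ → R) (r : ℕ) : Submodule ℂ R :=
  LinearMap.range (word₂ f g ∘ₗ LinearMap.mulLeft ℂ ((X 0 - X 1) ^ r))

theorem word₂_mem_diagSpan (f g : ℕ → R) (r : ℕ) (q : MvPolynomial (Fin 2) ℂ) :
    word₂ f g ((X 0 - X 1) ^ r * q) ∈ diagSpan f g r :=
  ⟨q, rfl⟩

theorem word₄_mul (f g h k : ℕ → R) (p q : MvPolynomial (Fin 2) ℂ) :
    word₄ f g h k (aeval ![X 0, X 1] p * aeval ![X 2, X 3] q) = word₂ f g p * word₂ h k q := by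
  let L₁ : MvPolynomial (Fin 2) ℂ →ₗ[ℂ] MvPolynomial (Fin 2) ℂ →ₗ[ℂ] R :=
    LinearMap.compr₂ ((LinearMap.mul ℂ (MvPolynomial (Fin 4) ℂ)).compl₁₂
      (aeval ![X 0, X 1] : MvPolynomial (Fin 2) ℂ →ₐ[ℂ] _).toLinearMap
      (aeval ![X 2, X 3] : MvPolynomial (Fin 2) ℂ →ₐ[ℂ] _).toLinearMap) (word₄ f g h k)
  let L₂ : MvPolynomial (Fin 2) ℂ →ₗ[ℂ] MvPolynomial (Fin 2) ℂ →ₗ[ℂ] R :=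
    (LinearMap.mul ℂ R).compl₁₂ (word₂ f g) (word₂ h k)
  suffices H : L₁ = L₂ from LinearMap.congr_fun (LinearMap.congr_fun H p) q
  refine ext₂ fun a b => ext₂ fun c d => ?_
  simp only [L₁, L₂, LinearMap.compr₂_apply, LinearMap.compl₁₂_apply, LinearMap.mul_apply',
    AlgHom.toLinearMap_apply, word₂_apply]
  simp only [map_mul, map_pow, aeval_X, Matrix.cons_val]
  rw [← mul_assoc, word₄_apply, mul_assoc]

theorem word₄_mem_mul (f g h k : ℕ → R) (r : ℕ) (q : MvPolynomial (Fin 4) ℂ) :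
    word₄ f g h k ((X 0 - X 1) ^ r * (X 2 - X 3) ^ r * q) ∈ diagSpan f g r * diagSpan h k r := by
  suffices H : q ∈ (diagSpan f g r * diagSpan h k r).comap
      (word₄ f g h k ∘ₗ LinearMap.mulLeft ℂ ((X 0 - X 1) ^ r * (X 2 - X 3) ^ r)) by
    rwa [Submodule.mem_comap, LinearMap.comp_apply, LinearMap.mulLeft_apply] at H
  refine mem_of_prod₄ (fun a b c d => ?_) q
  rw [Submodule.mem_comap, LinearMap.comp_apply, LinearMap.mulLeft_apply]
  have e : ((X 0 - X 1) ^ r * (X 2 - X 3) ^ r * (X 0 ^ a * X 1 ^ b * X 2 ^ c * X 3 ^ d) :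
      MvPolynomial (Fin 4) ℂ) = aeval ![X 0, X 1] ((X 0 - X 1) ^ r * (X 0 ^ a * X 1 ^ b) :
      MvPolynomial (Fin 2) ℂ) * aeval ![X 2, X 3] ((X 0 - X 1) ^ r * (X 0 ^ c * X 1 ^ d) :
      MvPolynomial (Fin 2) ℂ) := by
    simp only [map_mul, map_pow, map_sub, aeval_X, Matrix.cons_val]
    ring
  rw [e, word₄_mul]
  exact Submodule.mul_mem_mul (word₂_mem_diagSpan _ _ _ _) (word₂_mem_diagSpan _ _ _ _)

/-- Padding by the constant letter 1 makes the four-letter identities available for three letters.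
-/
theorem word₄_const (f g h : ℕ → R) (q : MvPolynomial (Fin 3) ℂ) :
    word₄ f g h (fun _ => 1) (aeval ![X 0, X 1, X 2] q) = word₃ f g h q := by
  suffices H : word₄ f g h (fun _ => 1) ∘ₗ
    (aeval ![X 0, X 1, X 2] : MvPolynomial (Fin 3) ℂ →ₐ[ℂ] _).toLinearMap = word₃ f g h from
    LinearMap.congr_fun H q
  refine ext₃ fun a b c => ?_
  simp only [LinearMap.comp_apply, AlgHom.toLinearMap_apply, map_mul, map_pow, aeval_X,
    Matrix.cons_val, word₃_apply]
  have := word₄_apply f g h (fun _ => 1) a b c 0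
  rwa [pow_zero, mul_one, mul_one] at this

theorem word₃_const (f g : ℕ → R) (q : MvPolynomial (Fin 3) ℂ) :
    word₃ f g (fun _ => 1) q = word₂ f g (aeval ![X 0, X 1, 1] q) := by
  suffices H : word₃ f g (fun _ => 1) = word₂ f g ∘ₗ
    (aeval ![X 0, X 1, 1] : MvPolynomial (Fin 3) ℂ →ₐ[ℂ] _).toLinearMap from
    LinearMap.congr_fun H q
  refine ext₃ fun a b c => ?_
  simp only [LinearMap.comp_apply, AlgHom.toLinearMap_apply, map_mul, map_pow, aeval_X,
    Matrix.cons_val, word₃_apply, one_pow, mul_one, word₂_apply]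

/-- A four-letter word lies in the product of the two spaces as soon as its polynomial vanishes to
order k + 2 along X 0 = X 1 and along X 2 = X 3. If this holds before and after reversing the first
three letters, `word₃_mem` gives the three-letter word obtained by setting X 2 = X 0. -/
theorem word₃_mem_mul (hE : WittRel E) (k : ℕ) (g : MvPolynomial (Fin 3) ℂ) :
    word₃ E E E ((X 0 - X 1) ^ (2 * (k + 2)) * (X 1 - X 2) ^ (2 * (k + 2)) * g) ∈
      diagSpan E E (k + 2) * diagSpan E E (k + 2) := by
  have h := word₃_mem hE E (diagSpan E E (k + 2) * diagSpan E E (k + 2))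
    -- The missing two powers of X 0 - X 1 and X 1 - X 2 are supplied by `word₃_mem`. The reversal
    -- turns X 1 - X 2 and X 0 - X 3 into X 1 - X 0 and X 2 - X 3, the factors required for the
    -- second membership.
    ((X 0 - X 1) ^ k * (X 1 - X 2) ^ k * (X 2 - X 3) ^ (k + 2) * (X 0 - X 3) ^ (k + 2) *
      aeval ![X 1, X 2, X 3] g) ?_ ?_
  · have e : (aeval ![X 1, X 0, X 1, X 2] : MvPolynomial (Fin 4) ℂ →ₐ[ℂ] MvPolynomial (Fin 3) ℂ)
        (aeval ![X 1, X 2, X 3] g) = g := by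
      have : (aeval ![X 1, X 0, X 1, X 2] : MvPolynomial (Fin 4) ℂ →ₐ[ℂ]
          MvPolynomial (Fin 3) ℂ).comp (aeval ![X 1, X 2, X 3]) =
          AlgHom.id ℂ (MvPolynomial (Fin 3) ℂ) := by
        refine MvPolynomial.algHom_ext fun i => ?_
        fin_cases i <;> simp
      exact AlgHom.congr_fun this g
    simp only [map_mul, e] at h
    simp only [map_pow, map_sub, aeval_X, Matrix.cons_val] at h
    have e2 : (-1 : ℂ) ^ (k + 2) • ((X 0 - X 1) ^ (2 * (k + 2)) * (X 1 - X 2) ^ (2 * (k + 2)) * g) =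
        (X 1 - X 0) ^ 2 * (X 0 - X 1) ^ 2 * ((X 1 - X 0) ^ k * (X 0 - X 1) ^ k *
          (X 1 - X 2) ^ (k + 2) * (X 1 - X 2) ^ (k + 2) * g) := by
      have e3 : (X 1 - X 0 : MvPolynomial (Fin 3) ℂ) = -1 * (X 0 - X 1) := by ring
      rw [Algebra.smul_def, e3]
      simp only [mul_pow, map_pow, map_neg, map_one]
      ring
    rw [← e2, map_smul] at h
    exact (Submodule.smul_mem_iff _ (pow_ne_zero _ (by norm_num))).mp h
  · convert word₄_mem_mul E E E E (k + 2) ((X 0 - X 2) * (X 1 - X 2) ^ (k + 2) *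
      (X 0 - X 3) ^ (k + 2) * aeval ![X 1, X 2, X 3] g) using 2
    ring
  · have e3 : (X 1 - X 0 : MvPolynomial (Fin 4) ℂ) = -1 * (X 0 - X 1) := by ring
    convert word₄_mem_mul E E E E (k + 2) ((-1) ^ (k + 2) * (X 2 - X 0) * (X 2 - X 1) ^ (k + 2) *
      (X 0 - X 3) ^ (k + 2) *
      aeval ![X 2, X 1, X 0, X 3] (aeval ![X 1, X 2, X 3] g : MvPolynomial (Fin 4) ℂ)) using 2
    rw [map_mul, map_mul, map_mul, map_mul, map_mul, map_mul, map_mul]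
    simp only [map_pow, map_sub, aeval_X, Matrix.cons_val]
    rw [e3]
    simp only [mul_pow]
    ring

/-- This is `word₃_mem` with the last letter constant, one letter lower. -/
theorem word₂_mem (hE : WittRel E) (Q : Submodule ℂ R) (p g : MvPolynomial (Fin 3) ℂ)
    (hp : p = (X 0 - X 1) ^ 2 * (X 1 - X 2) ^ 2 * g)
    (h1 : word₃ E E E ((X 0 - X 2) * p) ∈ Q)
    (h2 : word₃ E E E (aeval ![X 2, X 1, X 0] ((X 0 - X 2) * p)) ∈ Q) :
    word₂ E E (aeval ![X 1, X 0, X 1] p) ∈ Q := by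
  have ep : (aeval ![X 0, X 1, X 2] : MvPolynomial (Fin 3) ℂ →ₐ[ℂ] MvPolynomial (Fin 4) ℂ) p =
      (X 0 - X 1) ^ 2 * (X 1 - X 2) ^ 2 * aeval ![X 0, X 1, X 2] g := by
    rw [hp]
    simp only [map_mul, map_pow, map_sub, aeval_X, Matrix.cons_val]
  have ep' : (aeval ![X 0, X 1, X 2] : MvPolynomial (Fin 3) ℂ →ₐ[ℂ] MvPolynomial (Fin 4) ℂ)
      ((X 0 - X 2) * p) = (X 0 - X 2) * aeval ![X 0, X 1, X 2] p := by
    simp only [map_mul, map_sub, aeval_X, Matrix.cons_val]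
  have c1 : (aeval ![X 2, X 1, X 0, X 3] : MvPolynomial (Fin 4) ℂ →ₐ[ℂ]
      MvPolynomial (Fin 4) ℂ).comp (aeval ![X 0, X 1, X 2]) =
      (aeval ![X 0, X 1, X 2] : MvPolynomial (Fin 3) ℂ →ₐ[ℂ] MvPolynomial (Fin 4) ℂ).comp
        (aeval ![X 2, X 1, X 0] : MvPolynomial (Fin 3) ℂ →ₐ[ℂ] _) := by
    refine MvPolynomial.algHom_ext fun i => ?_
    fin_cases i <;> simp
  have c2 : (aeval ![X 0, X 1, 1] : MvPolynomial (Fin 3) ℂ →ₐ[ℂ] MvPolynomial (Fin 2) ℂ).comp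
      ((aeval ![X 1, X 0, X 1, X 2] : MvPolynomial (Fin 4) ℂ →ₐ[ℂ]
      MvPolynomial (Fin 3) ℂ).comp (aeval ![X 0, X 1, X 2])) =
      (aeval ![X 1, X 0, X 1] : MvPolynomial (Fin 3) ℂ →ₐ[ℂ] MvPolynomial (Fin 2) ℂ) := by
    refine MvPolynomial.algHom_ext fun i => ?_
    fin_cases i <;> simp
  have h := word₃_mem hE (fun _ => 1) Q (aeval ![X 0, X 1, X 2] g)
    (by rwa [← ep, ← ep', word₄_const])
    (by
      rw [← ep, ← ep']
      have := AlgHom.congr_fun c1 ((X 0 - X 2) * p)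
      rw [AlgHom.comp_apply, AlgHom.comp_apply] at this
      rwa [this, word₄_const])
  rw [← ep, word₃_const] at h
  have := AlgHom.congr_fun c2 p
  rw [AlgHom.comp_apply, AlgHom.comp_apply] at this
  rwa [this] at h

theorem sub_pow_two_mul_comm {k : ℕ} (i j : Fin k) (r : ℕ) :
    (X i - X j : MvPolynomial (Fin k) ℂ) ^ (2 * r) = (X j - X i) ^ (2 * r) := by
  rw [← neg_sub, (even_two_mul _).neg_pow]

/-- The multiplier (X 0 - X 1)^{2(k+2)} (X 1 - X 2)^{2(k+2)} is invariant under reversal, so both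
orders of the three-letter word lie in the product by `word₃_mem_mul`. Setting X 2 = X 0 merges the
two factors into exponent 4(k+2). -/
theorem diagSpan_le_mul (hE : WittRel E) (k : ℕ) :
    diagSpan E E (4 * (k + 2)) ≤ diagSpan E E (k + 2) * diagSpan E E (k + 2) := by
  rintro _ ⟨g, rfl⟩
  rw [LinearMap.comp_apply, LinearMap.mulLeft_apply]
  have e : (aeval ![X 1, X 0, X 1] : MvPolynomial (Fin 3) ℂ →ₐ[ℂ] MvPolynomial (Fin 2) ℂ)
      (aeval ![X 1, X 2] g) = g := by
    have : (aeval ![X 1, X 0, X 1] : MvPolynomial (Fin 3) ℂ →ₐ[ℂ]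
        MvPolynomial (Fin 2) ℂ).comp (aeval ![X 1, X 2]) = AlgHom.id ℂ _ := by
      refine MvPolynomial.algHom_ext fun i => ?_
      fin_cases i <;> simp
    exact AlgHom.congr_fun this g
  have e' : (aeval ![X 2, X 1, X 0] : MvPolynomial (Fin 3) ℂ →ₐ[ℂ] MvPolynomial (Fin 3) ℂ)
      (aeval ![X 1, X 2] g) = aeval ![X 1, X 0] g := by
    have : (aeval ![X 2, X 1, X 0] : MvPolynomial (Fin 3) ℂ →ₐ[ℂ]
        MvPolynomial (Fin 3) ℂ).comp (aeval ![X 1, X 2]) =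
        (aeval ![X 1, X 0] : MvPolynomial (Fin 2) ℂ →ₐ[ℂ] _) := by
      refine MvPolynomial.algHom_ext fun i => ?_
      fin_cases i <;> simp
    exact AlgHom.congr_fun this g
  have h1 := word₃_mem_mul hE k ((X 0 - X 2) * aeval ![X 1, X 2] g)
  have h2 := word₃_mem_mul hE k ((X 2 - X 0) * aeval ![X 1, X 0] g)
  have h := word₂_mem hE (diagSpan E E (k + 2) * diagSpan E E (k + 2))
    ((X 0 - X 1) ^ (2 * (k + 2)) * (X 1 - X 2) ^ (2 * (k + 2)) * aeval ![X 1, X 2] g)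
    ((X 0 - X 1) ^ (2 * k + 2) * (X 1 - X 2) ^ (2 * k + 2) * aeval ![X 1, X 2] g) (by ring)
    (by rw [mul_left_comm]; exact h1)
    (by
      simp only [map_mul, e']
      simp only [map_pow, map_sub, aeval_X, Matrix.cons_val]
      rw [sub_pow_two_mul_comm 2 1, sub_pow_two_mul_comm 1 0]
      rw [mul_left_comm, mul_comm ((X 1 - X 2 : MvPolynomial (Fin 3) ℂ) ^ _)]
      exact h2)
  simp only [map_mul, e] at h
  simp only [map_pow, map_sub, aeval_X, Matrix.cons_val] at h
  rw [sub_pow_two_mul_comm 1 0, ← pow_add, ← two_mul, ← mul_assoc] at h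
  exact h

/-- Each application of `diagSpan_le_mul` quadruples the exponent and doubles the number of factors.
-/
theorem diagSpan_le_pow (hE : WittRel E) (k : ℕ) :
    diagSpan E E (4 ^ (k + 1)) ≤ diagSpan E E 4 ^ 2 ^ k := by
  induction k with
  | zero => simp
  | succ k ih =>
    have h := diagSpan_le_mul hE (4 ^ (k + 1) - 2)
    have : 4 ^ (k + 1) - 2 + 2 = 4 ^ (k + 1) := Nat.sub_add_cancel
      (le_trans (by norm_num) (Nat.pow_le_pow_right (by norm_num) (Nat.le_add_left 1 k)))
    rw [this] at h
    rw [pow_succ 4 (k + 1), mul_comm, pow_succ 2 k, pow_mul, sq]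
    exact h.trans (mul_le_mul' ih ih)

end Products

/-! ### The adjoint action on two-letter words -/

/-- The action of `x^c d/dx` on vector fields `q d/dx` in the first variable. -/
def lieX (c : ℕ) : Module.End ℂ (MvPolynomial (Fin 2) ℂ) :=
  LinearMap.mulLeft ℂ (X 0 ^ c) ∘ₗ (pderiv 0).toLinearMap -
    (c : ℂ) • LinearMap.mulLeft ℂ (X 0 ^ (c - 1))

/-- The action of `y^c d/dy` on vector fields `q d/dy` in the second variable. -/
def lieY (c : ℕ) : Module.End ℂ (MvPolynomial (Fin 2) ℂ) :=
  LinearMap.mulLeft ℂ (X 1 ^ c) ∘ₗ (pderiv 1).toLinearMap -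
    (c : ℂ) • LinearMap.mulLeft ℂ (X 1 ^ (c - 1))

theorem lieX_apply (c : ℕ) (q : MvPolynomial (Fin 2) ℂ) :
    lieX c q = X 0 ^ c * pderiv 0 q - (c : ℂ) • (X 0 ^ (c - 1) * q) := rfl

theorem lieY_apply (c : ℕ) (q : MvPolynomial (Fin 2) ℂ) :
    lieY c q = X 1 ^ c * pderiv 1 q - (c : ℂ) • (X 1 ^ (c - 1) * q) := rfl

section Words

variable {R : Type*} [Ring R] [Algebra ℂ R]

theorem word₂_shift_left (f g : ℕ → R) (c : ℕ) (q : MvPolynomial (Fin 2) ℂ) :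
    word₂ (fun a => f (a + c)) g q = word₂ f g (X 0 ^ c * q) := by
  suffices H : word₂ (fun a => f (a + c)) g =
    word₂ f g ∘ₗ LinearMap.mulLeft ℂ (X 0 ^ c) from LinearMap.congr_fun H q
  refine ext₂ fun a b => ?_
  rw [LinearMap.comp_apply, LinearMap.mulLeft_apply, ← mul_assoc, ← pow_add, word₂_apply,
    word₂_apply, add_comm]

theorem word₂_shift_right (f g : ℕ → R) (c : ℕ) (q : MvPolynomial (Fin 2) ℂ) :
    word₂ f (fun a => g (a + c)) q = word₂ f g (X 1 ^ c * q) := by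
  suffices H : word₂ f (fun a => g (a + c)) =
    word₂ f g ∘ₗ LinearMap.mulLeft ℂ (X 1 ^ c) from LinearMap.congr_fun H q
  refine ext₂ fun a b => ?_
  rw [LinearMap.comp_apply, LinearMap.mulLeft_apply, mul_left_comm, ← pow_add, word₂_apply,
    word₂_apply, add_comm]

theorem word₂_smul_left (f g : ℕ → R) (z : ℂ) (q : MvPolynomial (Fin 2) ℂ) :
    word₂ (fun a => z • f a) g q = z • word₂ f g q := by
  suffices H : word₂ (fun a => z • f a) g = z • word₂ f g from LinearMap.congr_fun H q
  refine ext₂ fun a b => ?_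
  rw [LinearMap.smul_apply, word₂_apply, word₂_apply, smul_mul_assoc]

theorem word₂_smul_right (f g : ℕ → R) (z : ℂ) (q : MvPolynomial (Fin 2) ℂ) :
    word₂ f (fun a => z • g a) q = z • word₂ f g q := by
  suffices H : word₂ f (fun a => z • g a) = z • word₂ f g from LinearMap.congr_fun H q
  refine ext₂ fun a b => ?_
  rw [LinearMap.smul_apply, word₂_apply, word₂_apply, mul_smul_comm]

theorem word₂_sub_right (f g h : ℕ → R) (q : MvPolynomial (Fin 2) ℂ) :
    word₂ f (fun a => g a - h a) q = word₂ f g q - word₂ f h q := by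
  suffices H : word₂ f (fun a => g a - h a) = word₂ f g - word₂ f h from LinearMap.congr_fun H q
  refine ext₂ fun a b => ?_
  rw [LinearMap.sub_apply, word₂_apply, word₂_apply, word₂_apply, mul_sub]

theorem word₂_sub_left (f g h : ℕ → R) (q : MvPolynomial (Fin 2) ℂ) :
    word₂ (fun a => f a - h a) g q = word₂ f g q - word₂ h g q := by
  suffices H : word₂ (fun a => f a - h a) g = word₂ f g - word₂ h g from LinearMap.congr_fun H q
  refine ext₂ fun a b => ?_
  rw [LinearMap.sub_apply, word₂_apply, word₂_apply, word₂_apply, sub_mul]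

theorem lieX_monomial (a b c : ℕ) :
    lieX c (X 0 ^ a * X 1 ^ b) = ((a : ℂ) - c) • (X 0 ^ (a + c - 1) * X 1 ^ b) := by
  rw [lieX_apply, ← smul_mul_assoc ((a : ℂ) - c), add_comm a c, ← contract_eq]
  simp [Derivation.leibniz_pow, pderiv_X, Algebra.smul_def]
  ring

theorem lieY_monomial (a b c : ℕ) :
    lieY c (X 0 ^ a * X 1 ^ b) = ((b : ℂ) - c) • (X 0 ^ a * X 1 ^ (b + c - 1)) := by
  rw [lieY_apply, ← mul_smul_comm ((b : ℂ) - c), add_comm b c, ← contract_eq]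
  simp [Derivation.leibniz_pow, pderiv_X, Algebra.smul_def]
  ring

theorem word₂_lieX (f g : ℕ → R) (c : ℕ) (q : MvPolynomial (Fin 2) ℂ) :
    word₂ (fun a => ((a : ℂ) - c) • f (a + c - 1)) g q = word₂ f g (lieX c q) := by
  suffices H : word₂ (fun a => ((a : ℂ) - c) • f (a + c - 1)) g =
    word₂ f g ∘ₗ lieX c from LinearMap.congr_fun H q
  refine ext₂ fun a b => ?_
  rw [LinearMap.comp_apply, lieX_monomial, map_smul, word₂_apply, word₂_apply, smul_mul_assoc]

theorem word₂_lieY (f g : ℕ → R) (c : ℕ) (q : MvPolynomial (Fin 2) ℂ) :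
    word₂ f (fun a => ((a : ℂ) - c) • g (a + c - 1)) q = word₂ f g (lieY c q) := by
  suffices H : word₂ f (fun a => ((a : ℂ) - c) • g (a + c - 1)) =
    word₂ f g ∘ₗ lieY c from LinearMap.congr_fun H q
  refine ext₂ fun a b => ?_
  rw [LinearMap.comp_apply, lieY_monomial, map_smul, word₂_apply, word₂_apply, mul_smul_comm]

/-- Supercommuting an operator past a word. -/
theorem mul_word₂ (F : R) {f g f' g' : ℕ → R} {z z' : ℂ}
    (hf : ∀ a, F * f a - z • (f a * F) = f' a) (hg : ∀ a, F * g a - z' • (g a * F) = g' a)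
    (q : MvPolynomial (Fin 2) ℂ) :
    F * word₂ f g q - (z * z') • (word₂ f g q * F) = word₂ f' g q + z • word₂ f g' q := by
  suffices H : LinearMap.mulLeft ℂ F ∘ₗ word₂ f g - (z * z') • (LinearMap.mulRight ℂ F ∘ₗ
      word₂ f g) = word₂ f' g + z • word₂ f g' from LinearMap.congr_fun H q
  refine ext₂ fun a b => ?_
  simp only [LinearMap.sub_apply, LinearMap.smul_apply, LinearMap.comp_apply, LinearMap.add_apply,
    LinearMap.mulLeft_apply, LinearMap.mulRight_apply, word₂_apply]
  rw [← hf, ← hg]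
  simp only [sub_mul, mul_sub, smul_mul_assoc, mul_smul_comm, smul_sub, smul_smul, mul_assoc]
  abel

variable {E : ℕ → R}

/-- Closure of a space of words under commutators with E_c becomes closure of its polynomials under
the diagonal action `lieX c + lieY c`. -/
theorem comm_word₂ (hE : WittRel E) (c : ℕ) (q : MvPolynomial (Fin 2) ℂ) :
    E c * word₂ E E q - word₂ E E q * E c = word₂ E E (lieX c q + lieY c q) := by
  have h : ∀ a, E c * E a - (1 : ℂ) • (E a * E c) = ((a : ℂ) - c) • E (a + c - 1) := fun a => by
    rw [one_smul, hE, add_comm]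
  have := mul_word₂ (E c) h h q
  rwa [mul_one, one_smul, one_smul, word₂_lieX, word₂_lieY, ← map_add] at this

/-- These polynomials are antisymmetric and divisible by (X 0 - X 1)^2. The exchange of letters
therefore preserves the word and also changes its sign. -/
theorem word₂_odd (hE : WittRel E) (s k : ℕ) :
    word₂ E E ((X 0 - X 1) ^ (2 * s + 3) * (X 0 + X 1) ^ k) = 0 := by
  have e : ∀ q, word₄ E E (fun _ => 1) (fun _ => 1) (aeval ![X 0, X 1] q) = word₂ E E q := by
    intro q
    have h := word₄_mul E E (fun _ => (1 : R)) (fun _ => 1) q 1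
    have h1 := word₂_apply (fun _ => (1 : R)) (fun _ => 1) 0 0
    rw [pow_zero, pow_zero, mul_one] at h1
    rwa [h1, map_one, mul_one, mul_one, mul_one] at h
  have h := word₄_swap_left_of_sq hE (fun _ => 1) (fun _ => 1)
    ((X 0 - X 1) ^ (2 * s + 1) * (X 0 + X 1) ^ k)
  simp only [map_mul, map_pow, map_sub, map_add, aeval_X, Matrix.cons_val] at h
  have e1 : ((X 0 - X 1) ^ 2 * ((X 1 - X 0) ^ (2 * s + 1) * (X 1 + X 0) ^ k) :
      MvPolynomial (Fin 4) ℂ) =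
      -((X 0 - X 1) ^ 2 * ((X 0 - X 1) ^ (2 * s + 1) * (X 0 + X 1) ^ k)) := by
    rw [← neg_sub (X 0) (X 1), (odd_two_mul_add_one s).neg_pow, add_comm (X 1)]
    ring
  rw [e1, map_neg, eq_neg_iff_add_eq_zero, ← two_smul ℂ,
    smul_eq_zero_iff_right (two_ne_zero' ℂ)] at h
  rw [← e, ← h]
  congr 1
  simp only [map_mul, map_pow, map_sub, map_add, aeval_X, Matrix.cons_val]
  ring

end Words

/-! ### Generating the ideal from one even power of x - y -/

section Generation

theorem lie_two_apply (s k : ℕ) :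
    (2 : ℂ) • (lieX 2 + lieY 2) ((X 0 - X 1) ^ s * (X 0 + X 1) ^ k) =
      (2 * (s : ℂ) - 4 + k) • ((X 0 - X 1) ^ s * (X 0 + X 1) ^ (k + 1)) +
        (k : ℂ) • ((X 0 - X 1) ^ (s + 2) * (X 0 + X 1) ^ (k - 1)) := by
  rw [LinearMap.add_apply, lieX_apply, lieY_apply]
  have h2 : (C 2 : MvPolynomial (Fin 2) ℂ) = 2 := map_ofNat C 2
  have h4 : (C 4 : MvPolynomial (Fin 2) ℂ) = 4 := map_ofNat C 4
  rcases s with _ | s <;> rcases k with _ | k <;>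
  · simp [Algebra.smul_def, Derivation.leibniz_pow, pderiv_X]
    simp only [h2, h4]
    ring

theorem lie_three_apply (s : ℕ) :
    (4 : ℂ) • (lieX 3 + lieY 3) ((X 0 - X 1) ^ s) =
      (3 * (s : ℂ) - 6) • ((X 0 - X 1) ^ s * (X 0 + X 1) ^ 2) +
        ((s : ℂ) - 6) • ((X 0 - X 1) ^ (s + 2)) := by
  rw [LinearMap.add_apply, lieX_apply, lieY_apply]
  have h3 : (C 3 : MvPolynomial (Fin 2) ℂ) = 3 := map_ofNat C 3
  have h4 : (C 4 : MvPolynomial (Fin 2) ℂ) = 4 := map_ofNat C 4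
  have h6 : (C 6 : MvPolynomial (Fin 2) ℂ) = 6 := map_ofNat C 6
  rcases s with _ | s <;>
  · simp [Algebra.smul_def, Derivation.leibniz_pow, pderiv_X]
    simp only [h3, h4, h6]
    ring

/-- A space of bivectors containing an even power of `x - y` and all antisymmetric elements of the
ideal `(x - y)^2`, and closed under `x^2 d/dx + y^2 d/dy` and `x^3 d/dx + y^3 d/dy`, contains the
ideal generated by that power. -/
theorem mem_of_lie_closed {S : Submodule ℂ (MvPolynomial (Fin 2) ℂ)}
    (hodd : ∀ s k : ℕ, (X 0 - X 1) ^ (2 * s + 3) * (X 0 + X 1) ^ k ∈ S)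
    (h2 : ∀ q ∈ S, (lieX 2 + lieY 2) q ∈ S) (h3 : ∀ q ∈ S, (lieX 3 + lieY 3) q ∈ S)
    {r : ℕ} (hr : (X 0 - X 1) ^ (2 * r + 4) ∈ S) (q : MvPolynomial (Fin 2) ℂ) :
    (X 0 - X 1) ^ (2 * r + 4) * q ∈ S := by
  have hstep : ∀ p : ℕ, (X 0 - X 1) ^ (2 * p + 4) ∈ S → (X 0 - X 1) ^ (2 * (p + 1) + 4) ∈ S := by
    intro p hp
    set s := 2 * p + 4 with hs
    have es : (s : ℂ) = 2 * p + 4 := by rw [hs]; push_cast; ring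
    have a1 := S.smul_mem 2 (h2 _ hp)
    have e1 := lie_two_apply s 0
    rw [pow_zero, mul_one] at e1
    simp only [Nat.cast_zero, zero_smul, add_zero, zero_add, pow_one] at e1
    rw [e1] at a1
    have c1 : (2 * (s : ℂ) - 4) ≠ 0 := by
      rw [es]
      have : (2 * (2 * (p : ℂ) + 4) - 4) = ((4 * p + 4 : ℕ) : ℂ) := by push_cast; ring
      rw [this]
      exact Nat.cast_ne_zero.mpr (by omega)
    have a2 := (S.smul_mem_iff c1).mp a1
    have a3 := S.smul_mem 2 (h2 _ a2)
    have e3 := lie_two_apply s 1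
    rw [pow_one] at e3
    rw [e3] at a3
    simp only [Nat.sub_self, pow_zero, mul_one, Nat.cast_one, one_smul, Nat.reduceAdd] at a3
    have a4 := S.smul_mem 4 (h3 _ hp)
    rw [lie_three_apply] at a4
    -- Eliminating (x-y)^s (x+y)^2 between the two images leaves a multiple of (x-y)^{s+2}.
    have a5 := S.sub_mem (S.smul_mem (2 * (s : ℂ) - 4 + 1) a4) (S.smul_mem (3 * (s : ℂ) - 6) a3)
    have e5 : (2 * (s : ℂ) - 4 + 1) • ((3 * (s : ℂ) - 6) • ((X 0 - X 1) ^ s * (X 0 + X 1) ^ 2) +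
        ((s : ℂ) - 6) • ((X 0 - X 1) ^ (s + 2))) - (3 * (s : ℂ) - 6) •
        ((2 * (s : ℂ) - 4 + 1) • ((X 0 - X 1) ^ s * (X 0 + X 1) ^ 2) + (X 0 - X 1) ^ (s + 2)) =
        ((2 * (s : ℂ) - 4 + 1) * ((s : ℂ) - 6) - (3 * (s : ℂ) - 6)) •
          ((X 0 - X 1) ^ (s + 2) : MvPolynomial (Fin 2) ℂ) := by
      module
    rw [e5] at a5
    have c5 : ((2 * (s : ℂ) - 4 + 1) * ((s : ℂ) - 6) - (3 * (s : ℂ) - 6)) ≠ 0 := by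
      rw [es]
      have : ((2 * (2 * (p : ℂ) + 4) - 4 + 1) * ((2 * (p : ℂ) + 4) - 6) -
        (3 * (2 * (p : ℂ) + 4) - 6)) = ((8 * p * p - 4 * p - 16 : ℤ) : ℂ) := by push_cast; ring
      rw [this]
      refine Int.cast_ne_zero.mpr fun h => ?_
      -- The quadratic 2p^2 - p - 4 has discriminant 33 and hence no integer root.
      have h' : (2 * p * p : ℤ) = p + 4 := by linarith
      rcases Nat.lt_or_ge p 2 with hp | hp
      · interval_cases p <;> norm_num at h'
      · rcases Nat.lt_or_ge p 3 with hp' | hp'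
        · interval_cases p
          norm_num at h'
        · nlinarith
    exact (S.smul_mem_iff c5).mp a5
  have hpow : ∀ p : ℕ, (X 0 - X 1) ^ (2 * (r + p) + 4) ∈ S := by
    intro p
    induction p with
    | zero => exact hr
    | succ p ih => exact hstep _ ih
  have heven : ∀ k p : ℕ, (X 0 - X 1) ^ (2 * (r + p) + 4) * (X 0 + X 1) ^ k ∈ S := by
    intro k
    induction k using Nat.strong_induction_on with
    | _ k ih =>
      intro p
      rcases k with _ | k
      · simpa using hpow p
      · have a1 := S.smul_mem 2 (h2 _ (ih k (by omega) p))
        rw [lie_two_apply] at a1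
        -- The second term of `lie_two_apply` has a higher power of x - y but a lower power of x +
        -- y, so strong induction on the latter covers it. For k = 0 the truncated exponent has
        -- coefficient zero.
        have a2 : (k : ℂ) • ((X 0 - X 1) ^ (2 * (r + p) + 4 + 2) * (X 0 + X 1) ^ (k - 1)) ∈ S :=
          S.smul_mem _ (ih (k - 1) (by omega) (p + 1))
        have a3 := (S.add_mem_iff_left a2).mp a1
        refine (S.smul_mem_iff ?_).mp a3
        have : (2 * ((2 * (r + p) + 4 : ℕ) : ℂ) - 4 + k) = ((4 * (r + p) + 4 + k : ℕ) : ℂ) := by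
          push_cast; ring
        rw [this]
        exact Nat.cast_ne_zero.mpr (by omega)
  have hall : ∀ s k : ℕ, (X 0 - X 1) ^ (2 * r + 4) * ((X 0 - X 1) ^ s * (X 0 + X 1) ^ k) ∈ S := by
    intro s k
    rw [← mul_assoc, ← pow_add]
    obtain ⟨p, rfl | rfl⟩ := Nat.even_or_odd' s
    · have := heven k p
      rwa [show 2 * (r + p) + 4 = 2 * r + 4 + 2 * p by ring] at this
    · have := hodd (r + p + 1) k
      rwa [show 2 * (r + p + 1) + 3 = 2 * r + 4 + (2 * p + 1) by ring] at this
  -- The change of coordinates to x - y and x + y, under which the elements of `hall` become all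
  -- monomials.
  let φ : MvPolynomial (Fin 2) ℂ →ₐ[ℂ] MvPolynomial (Fin 2) ℂ := aeval ![X 0 - X 1, X 0 + X 1]
  let ψ : MvPolynomial (Fin 2) ℂ →ₐ[ℂ] MvPolynomial (Fin 2) ℂ :=
    aeval ![(2 : ℂ)⁻¹ • (X 0 + X 1), (2 : ℂ)⁻¹ • (X 1 - X 0)]
  have hφψ : φ (ψ q) = q := by
    have : φ.comp ψ = AlgHom.id ℂ _ := by
      refine MvPolynomial.algHom_ext fun i => ?_
      fin_cases i
      · simp only [φ, ψ, AlgHom.comp_apply, aeval_X, map_smul, map_add, AlgHom.id_apply,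
          Fin.zero_eta, Matrix.cons_val]
        module
      · simp only [φ, ψ, AlgHom.comp_apply, aeval_X, map_smul, map_sub, AlgHom.id_apply,
          Fin.mk_one, Matrix.cons_val]
        module
    exact AlgHom.congr_fun this q
  have hmem := mem_of_prod₂ (S := S.comap (LinearMap.mulLeft ℂ ((X 0 - X 1) ^ (2 * r + 4)) ∘ₗ
    φ.toLinearMap)) (fun s k => by
      simp only [Submodule.mem_comap, LinearMap.comp_apply, LinearMap.mulLeft_apply,
        AlgHom.toLinearMap_apply, map_mul, map_pow, φ, aeval_X, Matrix.cons_val]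
      exact hall s k) (ψ q)
  simp only [Submodule.mem_comap, LinearMap.comp_apply, LinearMap.mulLeft_apply,
    AlgHom.toLinearMap_apply, hφψ] at hmem
  exact hmem

end Generation

/-! ### Discrete symbol classes -/

section Differences

open Asymptotics Filter

/-- The forward difference. -/
def fdiff : Module.End ℂ (ℕ → ℂ) where
  toFun f K := f (K + 1) - f K
  map_add' f g := by
    funext K
    simp only [Pi.add_apply]
    ring
  map_smul' c f := by
    funext K
    simp only [Pi.smul_apply, RingHom.id_apply, smul_eq_mul]
    ring

/-- The discrete Euler operator. -/
def euler : Module.End ℂ (ℕ → ℂ) where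
  toFun f K := (K + 1) * (f (K + 1) - f K)
  map_add' f g := by
    funext K
    simp only [Pi.add_apply]
    ring
  map_smul' c f := by
    funext K
    simp only [Pi.smul_apply, RingHom.id_apply, smul_eq_mul]
    ring

theorem fdiff_apply (f : ℕ → ℂ) (K : ℕ) : fdiff f K = f (K + 1) - f K := rfl

theorem euler_apply (f : ℕ → ℂ) (K : ℕ) : euler f K = (K + 1) * (f (K + 1) - f K) := rfl

/-- The commutator of the Euler operator with the difference consists of differences again; this
drives the inductions that follow. -/
theorem euler_fdiff (f : ℕ → ℂ) :
    euler (fdiff f) = fdiff (euler f) - fdiff f - fdiff (fdiff f) := by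
  funext K
  simp only [Pi.sub_apply, fdiff_apply, euler_apply]
  push_cast
  ring

/-- The sequences of order `N`. -/
def bigOSub (N : ℕ → ℝ) : Submodule ℂ (ℕ → ℂ) where
  carrier := {f | f =O[atTop] N}
  zero_mem' := isBigO_zero _ _
  add_mem' hf hg := hf.add hg
  smul_mem' c _ hf := hf.const_smul_left c

theorem mem_bigOSub {N : ℕ → ℝ} {f : ℕ → ℂ} : f ∈ bigOSub N ↔ f =O[atTop] N := Iff.rfl

/-- The sequences all of whose iterated Euler derivatives are of order `N`. -/
def symbolSub (N : ℕ → ℝ) : Submodule ℂ (ℕ → ℂ) := ⨅ i : ℕ, (bigOSub N).comap (euler ^ i)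

theorem mem_symbolSub {N : ℕ → ℝ} {f : ℕ → ℂ} :
    f ∈ symbolSub N ↔ ∀ i : ℕ, (euler ^ i) f ∈ bigOSub N := by
  simp [symbolSub]

theorem euler_pow_succ (i : ℕ) (f : ℕ → ℂ) : (euler ^ (i + 1)) f = (euler ^ i) (euler f) := by
  rw [pow_succ, Module.End.mul_apply]

theorem euler_mem_symbolSub {N : ℕ → ℝ} {f : ℕ → ℂ} (hf : f ∈ symbolSub N) :
    euler f ∈ symbolSub N := by
  rw [mem_symbolSub] at hf ⊢
  intro i
  rw [← euler_pow_succ]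
  exact hf _

theorem fdiff_mem_bigOSub {N : ℕ → ℝ} (hN : (fun K => N (K + 1)) =O[atTop] N) {f : ℕ → ℂ}
    (hf : f ∈ bigOSub N) : fdiff f ∈ bigOSub N := by
  rw [mem_bigOSub] at hf ⊢
  have h1 : (fun K => f (K + 1)) =O[atTop] N :=
    (hf.comp_tendsto (tendsto_add_atTop_nat 1)).trans hN
  exact h1.sub hf

theorem euler_pow_fdiff_mem {N : ℕ → ℝ} (hN : (fun K => N (K + 1)) =O[atTop] N) (i : ℕ) :
    ∀ f : ℕ → ℂ, (∀ j ≤ i, (euler ^ j) f ∈ bigOSub N) → (euler ^ i) (fdiff f) ∈ bigOSub N := by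
  induction i using Nat.strong_induction_on with
  | _ i ih =>
    intro f hf
    rcases i with _ | i
    · exact fdiff_mem_bigOSub hN (hf 0 le_rfl)
    · rw [euler_pow_succ, euler_fdiff, map_sub, map_sub]
      refine Submodule.sub_mem _ (Submodule.sub_mem _ (ih i (by omega) _ fun j hj => ?_)
        (ih i (by omega) _ fun j hj => hf j (by omega))) (ih i (by omega) _ fun j hj => ?_)
      · rw [← euler_pow_succ]
        exact hf _ (by omega)
      · exact ih j (by omega) _ fun l hl => hf l (by omega)

/-- A difference is an Euler derivative divided by K + 1, which gains one order. By `euler_fdiff`,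
further Euler derivatives of it reduce to differences of members of the same class. -/
theorem euler_pow_fdiff_mem_small {N : ℕ → ℝ} (hN : (fun K => N (K + 1)) =O[atTop] N) (i : ℕ) :
    ∀ f ∈ symbolSub N, (euler ^ i) (fdiff f) ∈ bigOSub fun K => N K / (K + 1) := by
  induction i with
  | zero =>
    intro f hf
    rw [pow_zero, Module.End.one_apply, mem_bigOSub]
    have h1 := mem_symbolSub.mp hf 1
    rw [pow_one, mem_bigOSub] at h1
    have h3 : (fun K : ℕ => ((K : ℂ) + 1)⁻¹) =O[atTop] (fun K : ℕ => ((K : ℝ) + 1)⁻¹) := by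
      refine IsBigO.of_bound 1 (Eventually.of_forall fun K => ?_)
      rw [norm_inv, norm_inv, one_mul]
      norm_cast
    refine ((h1.mul h3).congr_left fun K => ?_).congr_right fun K => ?_
    · rw [euler_apply, fdiff_apply, mul_comm, ← mul_assoc,
        inv_mul_cancel₀ (Nat.cast_add_one_ne_zero K), one_mul]
    · rw [div_eq_mul_inv]
  | succ i ih =>
    intro f hf
    rw [euler_pow_succ, euler_fdiff, map_sub, map_sub]
    refine Submodule.sub_mem _ (Submodule.sub_mem _ (ih _ (euler_mem_symbolSub hf)) (ih _ hf))
      (ih _ (mem_symbolSub.mpr fun j => euler_pow_fdiff_mem hN j f fun l _ =>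
        mem_symbolSub.mp hf l))

theorem fdiff_mem_symbolSub {N : ℕ → ℝ} (hN : (fun K => N (K + 1)) =O[atTop] N) {f : ℕ → ℂ}
    (hf : f ∈ symbolSub N) : fdiff f ∈ symbolSub N :=
  mem_symbolSub.mpr fun j => euler_pow_fdiff_mem hN j f fun l _ => mem_symbolSub.mp hf l

theorem fdiff_mem_symbolSub_small {N : ℕ → ℝ} (hN : (fun K => N (K + 1)) =O[atTop] N)
    {f : ℕ → ℂ} (hf : f ∈ symbolSub N) : fdiff f ∈ symbolSub fun K => N K / (K + 1) :=
  mem_symbolSub.mpr fun i => euler_pow_fdiff_mem_small hN i f hf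

end Differences

/-! ### The difference equations of the matrix coefficients -/

section Recursion

open Asymptotics Filter

variable {Φ S : Type*} [AddCommGroup Φ] [Module ℂ Φ] [AddCommGroup S] [Module ℂ S]

/-- The sequence that is summed by the action of `D E_2`. -/
def recG (l : ℂ) (L : Module.End ℂ Φ) (z : Φ →ₗ[ℂ] S →ₗ[ℂ] (ℕ → ℂ)) (φ : Φ) (v : S) (K : ℕ) : ℂ :=
  z (L φ) v K + (K - 1) * (K + 2 * l) * z φ v K - (K - 2) * (K + 1) * z φ v (K + 1)

/-- The sequence that is summed twice by the action of `D^2 E_3`. -/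
def recH (l : ℂ) (L L' : Module.End ℂ Φ) (z : Φ →ₗ[ℂ] S →ₗ[ℂ] (ℕ → ℂ)) (φ : Φ) (v : S)
    (K : ℕ) : ℂ :=
  z (L' φ) v K + 3 * (K - 1) * (z (L φ) v K + (2 * l + 2) * z φ v K) +
    (3 * (K - 1) * (K - 2) * (l + 2) + (K - 1) * (K - 2) * (K - 3)) * z φ v K -
    (K - 3) * (K + 2) * (K + 1) * z φ v (K + 2)

/-- The recursion satisfied by the matrix coefficients of `D^{K-1} E_K / K!`. -/
structure IsRec (l : ℂ) (L L' : Module.End ℂ Φ) (R R' : Module.End ℂ S)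
    (z : Φ →ₗ[ℂ] S →ₗ[ℂ] (ℕ → ℂ)) : Prop where
  fst_zero : ∀ φ v, z φ (R v) 0 = recG l L z φ v 0
  fst_succ : ∀ φ v K, z φ (R v) (K + 1) = recG l L z φ v (K + 1) - recG l L z φ v K
  snd_zero : ∀ φ v, z φ (R' v) 0 = recH l L L' z φ v 0
  snd_one : ∀ φ v, z φ (R' v) 1 = recH l L L' z φ v 1 - 2 * recH l L L' z φ v 0
  snd_add_two : ∀ φ v K, z φ (R' v) (K + 2) =
    recH l L L' z φ v (K + 2) - 2 * recH l L L' z φ v (K + 1) + recH l L L' z φ v K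

variable {l : ℂ} {L L' : Module.End ℂ Φ} {R R' : Module.End ℂ S} {z : Φ →ₗ[ℂ] S →ₗ[ℂ] (ℕ → ℂ)}

/-- Solved for `R`, this says that `R` acts on the sequences as a quadratic polynomial in the Euler
operator, up to a difference, which is of lower order. -/
theorem IsRec.euler_euler (h : IsRec l L L' R R' z) (φ : Φ) (v : S) :
    euler (euler (z φ v)) = (2 * l) • z φ v + (2 * l - 1) • euler (z φ v) - z φ (R v) +
      fdiff (z (L φ) v - (2 * l - 2) • z φ v + (2 : ℂ) • euler (z φ v) - z φ (R v)) := by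
  funext K
  have h1 := h.fst_succ φ v K
  simp only [recG] at h1
  simp only [Pi.sub_apply, Pi.add_apply, Pi.smul_apply, fdiff_apply, euler_apply, smul_eq_mul]
  push_cast at h1 ⊢
  linear_combination h1

theorem IsRec.snd_eq (h : IsRec l L L' R R' z) (φ : Φ) (v : S) :
    z φ (R' v) = (6 * l) • z φ v + (9 * l - 4) • euler (z φ v) +
      (3 * l - 6) • euler (euler (z φ v)) - (2 : ℂ) • euler (euler (euler (z φ v))) +
      fdiff (fdiff (z (L' φ) v) + (3 : ℂ) • (z (L φ) v + (2 * l + 2) • z φ v +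
        euler (z (L φ) v + (2 * l + 2) • z φ v) - fdiff (z (L φ) v + (2 * l + 2) • z φ v)) -
        (6 * l) • (z φ v + euler (z φ v)) + (6 * l + 12) • fdiff (z φ v) +
        (euler (z φ v) + euler (euler (z φ v))) + (9 : ℂ) • fdiff (euler (z φ v)) -
        (euler (euler (z φ v)) + euler (euler (euler (z φ v)))) +
        (3 : ℂ) • fdiff (euler (euler (z φ v))) - (2 : ℂ) • z φ (R' v) - fdiff (z φ (R' v))) := by
  funext K
  have h1 := h.snd_add_two φ v K
  simp only [recH] at h1
  simp only [Pi.sub_apply, Pi.add_apply, Pi.smul_apply, fdiff_apply, euler_apply, smul_eq_mul,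
    map_add, map_smul]
  push_cast at h1 ⊢
  simp only [add_assoc, Nat.reduceAdd] at h1 ⊢
  linear_combination h1

/-- Replacing the sequence by its partial sums preserves the shape of the recursion. -/
theorem IsRec.sum (h : IsRec l L L' R R' z) {y : Φ →ₗ[ℂ] S →ₗ[ℂ] (ℕ → ℂ)}
    (hy : ∀ φ v K, y φ v K = ∑ i ∈ Finset.range (K + 1), z φ v i) :
    IsRec (l + 1) (L + (2 * l + 2) • 1) (L' + (3 : ℂ) • L + (6 * l + 6) • 1)
      (R + (2 * l + 2) • 1) (R' + (3 : ℂ) • R + (6 * l + 6) • 1) y := by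
  have hy0 : ∀ φ v, z φ v 0 = y φ v 0 := fun φ v => by simp [hy]
  have hys : ∀ φ v K, z φ v (K + 1) = y φ v (K + 1) - y φ v K := fun φ v K => by
    rw [hy, hy, Finset.sum_range_succ _ (K + 1)]
    ring
  -- The recursion makes z φ (R v) a difference of `recG`, with `recG` taken as zero before the
  -- start; summation therefore telescopes. For `R'` only one of the two differences is undone.
  have hR : ∀ φ v K, y φ (R v) K = recG l L z φ v K := by
    intro φ v K
    induction K with
    | zero => rw [← hy0, h.fst_zero]
    | succ K ih =>
      have := h.fst_succ φ v K
      rw [hys, ih] at this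
      linear_combination this
  have hR0 : ∀ φ v, y φ (R' v) 0 = recH l L L' z φ v 0 := fun φ v => by
    rw [← hy0, h.snd_zero]
  have hR' : ∀ φ v K, y φ (R' v) (K + 1) = recH l L L' z φ v (K + 1) - recH l L L' z φ v K := by
    intro φ v K
    induction K with
    | zero =>
      have h1 := h.snd_one φ v
      rw [hys φ (R' v) 0, hR0] at h1
      linear_combination h1
    | succ K ih =>
      have := h.snd_add_two φ v K
      rw [hys, ih] at this
      linear_combination this
  have e1 : ∀ φ, (L + (2 * l + 2) • (1 : Module.End ℂ Φ)) φ = L φ + (2 * l + 2) • φ :=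
    fun _ => rfl
  have e2 : ∀ φ, (L' + (3 : ℂ) • L + (6 * l + 6) • (1 : Module.End ℂ Φ)) φ =
    L' φ + (3 : ℂ) • L φ + (6 * l + 6) • φ := fun _ => rfl
  have e3 : ∀ v, (R + (2 * l + 2) • (1 : Module.End ℂ S)) v = R v + (2 * l + 2) • v :=
    fun _ => rfl
  have e4 : ∀ v, (R' + (3 : ℂ) • R + (6 * l + 6) • (1 : Module.End ℂ S)) v =
    R' v + (3 : ℂ) • R v + (6 * l + 6) • v := fun _ => rfl
  refine ⟨fun φ v => ?_, fun φ v K => ?_, fun φ v => ?_, fun φ v => ?_, fun φ v K => ?_⟩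
  · simp only [recG, e1, e3, map_add, map_smul, LinearMap.add_apply, LinearMap.smul_apply,
      Pi.add_apply, Pi.smul_apply, smul_eq_mul, hR]
    simp only [hys, hy0]
    push_cast
    ring
  · simp only [recG, e1, e3, map_add, map_smul, LinearMap.add_apply, LinearMap.smul_apply,
      Pi.add_apply, Pi.smul_apply, smul_eq_mul, hR]
    simp only [hys]
    push_cast
    ring
  · simp only [recH, e1, e2, e4, map_add, map_smul, LinearMap.add_apply, LinearMap.smul_apply,
      Pi.add_apply, Pi.smul_apply, smul_eq_mul, hR, hR0]
    simp only [recG, hys, hy0]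
    push_cast
    ring
  · simp only [recH, e1, e2, e4, map_add, map_smul, LinearMap.add_apply, LinearMap.smul_apply,
      Pi.add_apply, Pi.smul_apply, smul_eq_mul, hR, show ∀ φ v, y φ (R' v) 1 = recH l L L' z φ v 1 - recH l L L' z φ v 0 from
        fun φ v => hR' φ v 0]
    simp only [recG, hy0, Nat.reduceAdd, zero_add,
      show ∀ φ v, z φ v 1 = y φ v 1 - y φ v 0 from fun φ v => hys φ v 0,
      show ∀ φ v, z φ v 2 = y φ v 2 - y φ v 1 from fun φ v => hys φ v 1,
      show ∀ φ v, z φ v 3 = y φ v 3 - y φ v 2 from fun φ v => hys φ v 2]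
    push_cast
    ring
  · simp only [recH, e1, e2, e4, map_add, map_smul, LinearMap.add_apply, LinearMap.smul_apply,
      Pi.add_apply, Pi.smul_apply, smul_eq_mul, hR, show K + 2 = K + 1 + 1 from rfl, hR']
    simp only [recG, hys]
    push_cast
    ring

end Recursion

/-! ### Growth of the coefficients and the proper invariant subspace -/

section Asymptotic

open Asymptotics Filter

variable {Φ S : Type*} [AddCommGroup Φ] [Module ℂ Φ] [AddCommGroup S] [Module ℂ S]
  {l : ℂ} {L L' : Module.End ℂ Φ} {R R' : Module.End ℂ S} {z : Φ →ₗ[ℂ] S →ₗ[ℂ] (ℕ → ℂ)}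

theorem fdiff_mem_of_euler_mem {N : ℕ → ℝ} {f : ℕ → ℂ} (hf : euler f ∈ bigOSub N) :
    fdiff f ∈ bigOSub N := by
  rw [mem_bigOSub] at hf ⊢
  refine IsBigO.trans (IsBigO.of_bound 1 (Eventually.of_forall fun K => ?_)) hf
  rw [euler_apply, fdiff_apply, norm_mul, one_mul]
  refine le_mul_of_one_le_left (norm_nonneg _) ?_
  rw [show ((K : ℂ) + 1) = ((K + 1 : ℕ) : ℂ) by push_cast; rfl, Complex.norm_natCast]
  push_cast
  linarith [Nat.cast_nonneg (α := ℝ) K]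

/-- The hypothesis says (K-1) Δf = u, and K + 1 ≤ 2(K-1) for K ≥ 3. -/
theorem mem_bigOSub_of_euler_euler {N : ℕ → ℝ} {f u : ℕ → ℂ} (hu : u ∈ bigOSub N)
    (h : euler f = u + (2 : ℂ) • fdiff f) : euler f ∈ bigOSub N := by
  rw [mem_bigOSub] at hu ⊢
  refine IsBigO.trans (IsBigO.of_bound 2 ?_) hu
  filter_upwards [eventually_ge_atTop 3] with K hK
  have h1 := congrFun h K
  have h2 : euler f K = (K + 1) * fdiff f K := rfl
  have h3 : u K = ((K : ℂ) - 1) * fdiff f K := by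
    rw [Pi.add_apply, Pi.smul_apply, smul_eq_mul, h2] at h1
    linear_combination -h1
  rw [h2, h3, norm_mul, norm_mul, ← mul_assoc]
  refine mul_le_mul_of_nonneg_right ?_ (norm_nonneg _)
  obtain ⟨k, rfl⟩ := Nat.exists_eq_add_of_le hK
  rw [show (((3 + k : ℕ) : ℂ) + 1) = ((k + 4 : ℕ) : ℂ) by push_cast; ring,
    show (((3 + k : ℕ) : ℂ) - 1) = ((k + 2 : ℕ) : ℂ) by push_cast; ring, Complex.norm_natCast,
    Complex.norm_natCast]
  push_cast
  linarith [Nat.cast_nonneg (α := ℝ) k]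

theorem mem_of_basis {ι κ : Type*} (b : Module.Basis ι ℂ Φ) (c : Module.Basis κ ℂ S)
    (z : Φ →ₗ[ℂ] S →ₗ[ℂ] (ℕ → ℂ)) (P : Submodule ℂ (ℕ → ℂ)) (h : ∀ i j, z (b i) (c j) ∈ P)
    (φ : Φ) (v : S) : z φ v ∈ P := by
  have h1 : ∀ j φ, z φ (c j) ∈ P := fun j φ => by
    have : (⊤ : Submodule ℂ Φ) ≤ P.comap (z.flip (c j)) := by
      rw [← b.span_eq, Submodule.span_le]
      rintro _ ⟨i, rfl⟩
      exact h i j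
    exact this trivial
  have : (⊤ : Submodule ℂ S) ≤ P.comap (z φ) := by
    rw [← c.span_eq, Submodule.span_le]
    rintro _ ⟨j, rfl⟩
    exact h1 j φ
  exact this trivial

/-- The coefficients are measured against their own joint size N, so all of them are symbols of
order N. The vectors whose coefficients all drop to order N/(K+1) form the subspace: modulo that
order `R` and `R'` act by commuting polynomials in the Euler operator. It is proper because N cannot
be of order N/(K+1) unless it eventually vanishes. -/
theorem IsRec.exists_proper_of_frequently [FiniteDimensional ℂ Φ] [FiniteDimensional ℂ S]
    (h : IsRec l L L' R R' z) (hz : ¬ ∃ K₀, ∀ K ≥ K₀, ∀ φ v, z φ v K = 0) :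
    ∃ W : Submodule ℂ S, W ≠ ⊤ ∧ (∀ v ∈ W, R v ∈ W) ∧ (∀ v ∈ W, R' v ∈ W) ∧
      ∀ v, R (R' v) - R' (R v) ∈ W := by
  let b := Module.finBasis ℂ Φ
  let c := Module.finBasis ℂ S
  -- Including the first Euler derivatives puts both initial data of the second-order recursion
  -- under control.
  let N : ℕ → ℝ := fun K => ∑ i, ∑ j, (‖z (b i) (c j) K‖ + ‖euler (z (b i) (c j)) K‖)
  have hNle : ∀ i j K, ‖z (b i) (c j) K‖ + ‖euler (z (b i) (c j)) K‖ ≤ N K := by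
    intro i j K
    refine le_trans ?_ (Finset.single_le_sum (f := fun i => ∑ j, (‖z (b i) (c j) K‖ +
      ‖euler (z (b i) (c j)) K‖)) (fun i _ => Finset.sum_nonneg fun j _ => by positivity)
      (Finset.mem_univ i))
    exact Finset.single_le_sum (f := fun j => ‖z (b i) (c j) K‖ + ‖euler (z (b i) (c j)) K‖)
      (fun j _ => by positivity) (Finset.mem_univ j)
  have hN0 : ∀ K, 0 ≤ N K := fun K => Finset.sum_nonneg fun i _ => Finset.sum_nonneg fun j _ => by
    positivity
  have hf0 : ∀ φ v, z φ v ∈ bigOSub N := mem_of_basis b c z _ fun i j =>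
    IsBigO.of_bound 1 (Eventually.of_forall fun K => by
      rw [one_mul, Real.norm_of_nonneg (hN0 K)]
      linarith [hNle i j K, norm_nonneg (euler (z (b i) (c j)) K)])
  have hf1 : ∀ φ v, euler (z φ v) ∈ bigOSub N :=
    mem_of_basis b c z ((bigOSub N).comap euler) fun i j =>
      IsBigO.of_bound 1 (Eventually.of_forall fun K => by
        rw [one_mul, Real.norm_of_nonneg (hN0 K)]
        linarith [hNle i j K, norm_nonneg (z (b i) (c j) K)])
  have hf2 : ∀ φ v, euler (euler (z φ v)) ∈ bigOSub N := fun φ v => by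
    refine mem_bigOSub_of_euler_euler (u := (2 * l) • z φ v + (2 * l - 1) • euler (z φ v) -
      z φ (R v) + fdiff (z (L φ) v - (2 * l - 2) • z φ v - z φ (R v))) ?_ ?_
    · refine Submodule.add_mem _ (Submodule.sub_mem _ (Submodule.add_mem _
        (Submodule.smul_mem _ _ (hf0 _ _)) (Submodule.smul_mem _ _ (hf1 _ _))) (hf0 _ _))
        (fdiff_mem_of_euler_mem ?_)
      rw [map_sub, map_sub, map_smul]
      exact Submodule.sub_mem _ (Submodule.sub_mem _ (hf1 _ _)
        (Submodule.smul_mem _ _ (hf1 _ _))) (hf1 _ _)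
    · rw [h.euler_euler φ v, add_assoc _ (fdiff _), ← map_smul fdiff, ← map_add fdiff]
      congr 2
      abel
  -- A shift adds a difference, which an Euler derivative dominates. As N already contains first
  -- derivatives, this uses the bound `hf2` on second ones.
  have hσ : (fun K => N (K + 1)) =O[atTop] N := by
    have key : ∀ f : ℕ → ℂ, f ∈ bigOSub N → euler f ∈ bigOSub N →
        (fun K => ‖f (K + 1)‖) =O[atTop] N := fun f h0 h1 => by
      have := ((bigOSub N).add_mem h0 (fdiff_mem_of_euler_mem h1))
      rw [mem_bigOSub] at this
      refine (this.congr_left fun K => ?_).norm_left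
      rw [Pi.add_apply, fdiff_apply]
      ring
    refine IsBigO.fun_sum fun i _ => IsBigO.fun_sum fun j _ => ?_
    exact (key _ (hf0 _ _) (hf1 _ _)).add (key _ (hf1 _ _) (hf2 _ _))
  have hall : ∀ (i : ℕ) φ v, ∀ j ≤ i, (euler ^ j) (z φ v) ∈ bigOSub N := by
    intro i
    induction i with
    | zero =>
      intro φ v j hj
      obtain rfl : j = 0 := by omega
      exact hf0 φ v
    | succ i ih =>
      -- The recursion expresses the second Euler derivative, so orders 0 and 1 are base cases;
      -- higher orders come from applying powers of `euler` to it.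
      rcases i with _ | i
      · intro φ v j hj
        interval_cases j
        · exact hf0 φ v
        · exact hf1 φ v
      · intro φ v j hj
        rcases Nat.lt_or_ge j (i + 2) with hj' | hj'
        · exact ih φ v j (by omega)
        obtain rfl : j = i + 2 := by omega
        rw [euler_pow_succ, euler_pow_succ, h.euler_euler]
        simp only [map_add (euler ^ i), map_sub (euler ^ i), map_smul (euler ^ i)]
        refine Submodule.add_mem _ (Submodule.sub_mem _ (Submodule.add_mem _
          (Submodule.smul_mem _ _ (ih _ _ _ (by omega)))
          (Submodule.smul_mem _ _ ?_)) (ih _ _ _ (by omega))) (euler_pow_fdiff_mem hσ i _ ?_)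
        · rw [← euler_pow_succ]
          exact ih _ _ _ (by omega)
        · intro j hj
          simp only [map_add (euler ^ j), map_sub (euler ^ j), map_smul (euler ^ j)]
          rw [← euler_pow_succ]
          exact Submodule.sub_mem _ (Submodule.add_mem _ (Submodule.sub_mem _
            (ih _ _ _ (by omega)) (Submodule.smul_mem _ _ (ih _ _ _ (by omega))))
            (Submodule.smul_mem _ _ (ih _ _ _ (by omega)))) (ih _ _ _ (by omega))
  have hsym : ∀ φ v, z φ v ∈ symbolSub N := fun φ v => mem_symbolSub.mpr fun i =>
    hall i φ v i le_rfl
  let N' : ℕ → ℝ := fun K => N K / (K + 1)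
  -- The leading parts of `R` and `R'` read off from `euler_euler` and `snd_eq`.
  let P₁ : Module.End ℂ (ℕ → ℂ) := (2 * l) • 1 + (2 * l - 1) • euler - euler * euler
  let P₂ : Module.End ℂ (ℕ → ℂ) := (6 * l) • 1 + (9 * l - 4) • euler +
    (3 * l - 6) • (euler * euler) - (2 : ℂ) • (euler * euler * euler)
  have hP : P₁ * P₂ = P₂ * P₁ := by
    simp only [P₁, P₂, mul_add, add_mul, mul_sub, sub_mul, smul_mul_assoc, mul_smul_comm,
      one_mul, mul_one, smul_add, smul_sub, smul_smul, mul_assoc]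
    module
  have hPmem₁ : ∀ f ∈ symbolSub N', P₁ f ∈ symbolSub N' := fun f hf =>
    Submodule.sub_mem _ (Submodule.add_mem _ (Submodule.smul_mem _ _ hf)
      (Submodule.smul_mem _ _ (euler_mem_symbolSub hf)))
      (euler_mem_symbolSub (euler_mem_symbolSub hf))
  have hPmem₂ : ∀ f ∈ symbolSub N', P₂ f ∈ symbolSub N' := fun f hf =>
    Submodule.sub_mem _ (Submodule.add_mem _ (Submodule.add_mem _ (Submodule.smul_mem _ _ hf)
      (Submodule.smul_mem _ _ (euler_mem_symbolSub hf)))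
      (Submodule.smul_mem _ _ (euler_mem_symbolSub (euler_mem_symbolSub hf))))
      (Submodule.smul_mem _ _ (euler_mem_symbolSub
        (euler_mem_symbolSub (euler_mem_symbolSub hf))))
  have hd : ∀ f ∈ symbolSub N, fdiff f ∈ symbolSub N := fun f hf => fdiff_mem_symbolSub hσ hf
  have he : ∀ f ∈ symbolSub N, euler f ∈ symbolSub N := fun f hf => euler_mem_symbolSub hf
  have hR : ∀ φ v, z φ (R v) - P₁ (z φ v) ∈ symbolSub N' := fun φ v => by
    have e : z φ (R v) - P₁ (z φ v) = fdiff (z (L φ) v - (2 * l - 2) • z φ v +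
        (2 : ℂ) • euler (z φ v) - z φ (R v)) := by
      have := h.euler_euler φ v
      simp only [P₁, LinearMap.sub_apply, LinearMap.add_apply, LinearMap.smul_apply,
        Module.End.one_apply, Module.End.mul_apply]
      rw [this]
      abel
    rw [e]
    exact fdiff_mem_symbolSub_small hσ (Submodule.sub_mem _ (Submodule.add_mem _
      (Submodule.sub_mem _ (hsym _ _) (Submodule.smul_mem _ _ (hsym _ _)))
      (Submodule.smul_mem _ _ (he _ (hsym _ _)))) (hsym _ _))
  have hR' : ∀ φ v, z φ (R' v) - P₂ (z φ v) ∈ symbolSub N' := fun φ v => by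
    obtain ⟨G, hG, e⟩ : ∃ G ∈ symbolSub N, z φ (R' v) = P₂ (z φ v) + fdiff G := by
      refine ⟨_, ?_, h.snd_eq φ v⟩
      have h1 := hsym φ v
      have h2 := (symbolSub N).add_mem (hsym (L φ) v) ((symbolSub N).smul_mem (2 * l + 2) h1)
      have h3 := hsym φ (R' v)
      refine Submodule.sub_mem _ (Submodule.sub_mem _ (Submodule.add_mem _ (Submodule.sub_mem _
        (Submodule.add_mem _ (Submodule.add_mem _ (Submodule.add_mem _ (Submodule.sub_mem _
        (Submodule.add_mem _ (hd _ (hsym _ _)) ?_) ?_) ?_) ?_) ?_) ?_) ?_) ?_) (hd _ h3)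
      · exact Submodule.smul_mem _ _ (Submodule.sub_mem _ (Submodule.add_mem _ h2 (he _ h2))
          (hd _ h2))
      · exact Submodule.smul_mem _ _ (Submodule.add_mem _ h1 (he _ h1))
      · exact Submodule.smul_mem _ _ (hd _ h1)
      · exact Submodule.add_mem _ (he _ h1) (he _ (he _ h1))
      · exact Submodule.smul_mem _ _ (hd _ (he _ h1))
      · exact Submodule.add_mem _ (he _ (he _ h1)) (he _ (he _ (he _ h1)))
      · exact Submodule.smul_mem _ _ (hd _ (he _ (he _ h1)))
      · exact Submodule.smul_mem _ _ h3
    rw [e, add_sub_cancel_left]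
    exact fdiff_mem_symbolSub_small hσ hG
  refine ⟨⨅ φ, (symbolSub N').comap (z φ), fun hW => hz ?_, fun v hv => ?_, fun v hv => ?_,
    fun v => ?_⟩
  · have hmem : ∀ φ v, z φ v ∈ symbolSub N' := fun φ v => by
      have : v ∈ ⨅ φ, (symbolSub N').comap (z φ) := hW ▸ trivial
      rw [Submodule.mem_iInf] at this
      exact this φ
    -- If the subspace were everything, then N K ≤ C N K / (K+1) for large K, which forces N K = 0
    -- once K + 1 exceeds C.
    have hNN : N =O[atTop] N' := by
      refine IsBigO.fun_sum fun i _ => IsBigO.fun_sum fun j _ => ?_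
      have h0 := mem_symbolSub.mp (hmem (b i) (c j)) 0
      have h1 := mem_symbolSub.mp (hmem (b i) (c j)) 1
      rw [pow_zero, Module.End.one_apply, mem_bigOSub] at h0
      rw [pow_one, mem_bigOSub] at h1
      exact h0.norm_left.add h1.norm_left
    obtain ⟨C, hC⟩ := hNN.bound
    obtain ⟨K₀, hK₀⟩ := eventually_atTop.mp hC
    obtain ⟨K₁, hK₁⟩ := exists_nat_gt C
    refine ⟨max K₀ K₁, fun K hK φ v => ?_⟩
    have h1 := hK₀ K (le_trans (le_max_left _ _) hK)
    have hK1 : (0 : ℝ) < K + 1 := by positivity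
    have hNK : N K = 0 := by
      rw [Real.norm_of_nonneg (hN0 K), Real.norm_of_nonneg (div_nonneg (hN0 K) hK1.le),
        ← mul_div_assoc, le_div_iff₀ hK1] at h1
      have h2 : (C : ℝ) < K + 1 := by
        have : (K₁ : ℝ) ≤ K := Nat.cast_le.mpr (le_trans (le_max_right _ _) hK)
        linarith
      nlinarith [hN0 K]
    have h3 : ∀ i j, z (b i) (c j) K = 0 := fun i j => by
      have := hNle i j K
      rw [hNK] at this
      exact norm_le_zero_iff.mp (by linarith [norm_nonneg (euler (z (b i) (c j)) K)])
    exact mem_of_basis b c z (LinearMap.ker (LinearMap.proj (R := ℂ) (φ := fun _ : ℕ => ℂ) K))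
      (fun i j => h3 i j) φ v
  · rw [Submodule.mem_iInf] at hv ⊢
    intro φ
    have := Submodule.add_mem _ (hR φ v) (hPmem₁ _ (hv φ))
    rwa [sub_add_cancel] at this
  · rw [Submodule.mem_iInf] at hv ⊢
    intro φ
    have := Submodule.add_mem _ (hR' φ v) (hPmem₂ _ (hv φ))
    rwa [sub_add_cancel] at this
  · rw [Submodule.mem_iInf]
    intro φ
    rw [Submodule.mem_comap, map_sub]
    have h1 := Submodule.add_mem _ (hR φ (R' v)) (hPmem₁ _ (hR' φ v))
    have h2 := Submodule.add_mem _ (hR' φ (R v)) (hPmem₂ _ (hR φ v))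
    have h3 := Submodule.sub_mem _ h1 h2
    have e : P₁ (P₂ (z φ v)) = P₂ (P₁ (z φ v)) := LinearMap.congr_fun hP _
    rw [map_sub P₁, map_sub P₂, e] at h3
    convert h3 using 1
    abel

/-- Partial sums. -/
def partialSums : Module.End ℂ (ℕ → ℂ) where
  toFun f K := ∑ i ∈ Finset.range (K + 1), f i
  map_add' f g := by
    funext K
    simp [Finset.sum_add_distrib]
  map_smul' c f := by
    funext K
    simp [Finset.mul_sum]

/-- When the coefficients vanish eventually there is no growth to compare. Partial sums satisfy a
recursion of the same shape, and either do not vanish eventually or vanish from one index earlier.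
Since the coefficient at 0 is preserved and nonzero, this stops. -/
theorem IsRec.exists_proper [FiniteDimensional ℂ Φ] [FiniteDimensional ℂ S]
    (h : IsRec l L L' R R' z) (hz : ∃ φ v, z φ v 0 ≠ 0) :
    ∃ W : Submodule ℂ S, W ≠ ⊤ ∧ (∀ v ∈ W, R v ∈ W) ∧ (∀ v ∈ W, R' v ∈ W) ∧
      ∀ v, R (R' v) - R' (R v) ∈ W := by
  by_cases hz' : ∃ K₀, ∀ K ≥ K₀, ∀ φ v, z φ v K = 0
  · obtain ⟨K₀, hK₀⟩ := hz'
    induction K₀ generalizing l L L' R R' z with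
    | zero =>
      obtain ⟨φ, v, hv⟩ := hz
      exact absurd (hK₀ 0 le_rfl φ v) hv
    | succ K₀ ih =>
      let y := z.compr₂ partialSums
      have hy : ∀ φ v K, y φ v K = ∑ i ∈ Finset.range (K + 1), z φ v i := fun _ _ _ => rfl
      have h' := h.sum hy
      -- The summed operators are R plus a scalar and R' plus a combination of R and a scalar, so
      -- invariant subspaces and the commutator are unchanged.
      have back : (∃ W : Submodule ℂ S, W ≠ ⊤ ∧
          (∀ v ∈ W, (R + (2 * l + 2) • (1 : Module.End ℂ S)) v ∈ W) ∧
          (∀ v ∈ W, (R' + (3 : ℂ) • R + (6 * l + 6) • (1 : Module.End ℂ S)) v ∈ W) ∧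
          ∀ v, (R + (2 * l + 2) • (1 : Module.End ℂ S))
            ((R' + (3 : ℂ) • R + (6 * l + 6) • (1 : Module.End ℂ S)) v) -
            (R' + (3 : ℂ) • R + (6 * l + 6) • (1 : Module.End ℂ S))
            ((R + (2 * l + 2) • (1 : Module.End ℂ S)) v) ∈ W) →
          ∃ W : Submodule ℂ S, W ≠ ⊤ ∧ (∀ v ∈ W, R v ∈ W) ∧ (∀ v ∈ W, R' v ∈ W) ∧
            ∀ v, R (R' v) - R' (R v) ∈ W := by
        rintro ⟨W, h1, h2, h3, h4⟩
        have h2' : ∀ v ∈ W, R v ∈ W := fun v hv => by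
          have := h2 v hv
          rw [LinearMap.add_apply, LinearMap.smul_apply, Module.End.one_apply] at this
          exact (W.add_mem_iff_left (W.smul_mem _ hv)).mp this
        refine ⟨W, h1, h2', fun v hv => ?_, fun v => ?_⟩
        · have := h3 v hv
          rw [LinearMap.add_apply, LinearMap.add_apply, LinearMap.smul_apply, LinearMap.smul_apply,
            Module.End.one_apply, add_assoc] at this
          exact (W.add_mem_iff_left (W.add_mem (W.smul_mem _ (h2' v hv)) (W.smul_mem _ hv))).mp this
        · convert h4 v using 1
          simp only [LinearMap.add_apply, LinearMap.smul_apply, Module.End.one_apply, map_add,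
            map_smul, smul_add]
          module
      by_cases hy' : ∃ K₁, ∀ K ≥ K₁, ∀ φ v, y φ v K = 0
      · refine back (ih h' ?_ fun K hK φ v => ?_)
        · obtain ⟨φ, v, hv⟩ := hz
          exact ⟨φ, v, by rwa [hy, zero_add, Finset.sum_range_one]⟩
        · obtain ⟨K₁, hK₁⟩ := hy'
          -- From index K₀ on the partial sums are constant, so eventual vanishing gives vanishing
          -- from K₀.
          have hconst : ∀ d, y φ v (K + d) = y φ v K := fun d => by
            induction d with
            | zero => rfl
            | succ d ihd =>
              rw [hy, ← add_assoc, Finset.sum_range_succ, ← hy, ihd, hK₀ _ (by omega), add_zero]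
          rw [← hconst K₁]
          exact hK₁ _ (by omega) φ v
      · exact back (h'.exists_proper_of_frequently hy')
  · exact h.exists_proper_of_frequently hz'

end Asymptotic

/-! ### Operator identities for E_0, E_1, E_2, E_3 -/

section Identities

variable {R : Type*} [Ring R] [Algebra ℂ R] {E : ℕ → R}

theorem WittRel.zero_mul (h : WittRel E) (k : ℕ) :
    E 0 * E k = E k * E 0 + (k : ℂ) • E (k - 1) := by
  have := h 0 k
  rw [Nat.cast_zero, sub_zero, zero_add] at this
  rw [← this]
  abel

theorem WittRel.zero_mul_one (h : WittRel E) : E 0 * E 1 = E 1 * E 0 + E 0 := by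
  have := h.zero_mul 1
  simpa using this

theorem WittRel.zero_mul_two (h : WittRel E) : E 0 * E 2 = E 2 * E 0 + (2 : ℂ) • E 1 := by
  have := h.zero_mul 2
  simpa using this

theorem WittRel.zero_mul_three (h : WittRel E) : E 0 * E 3 = E 3 * E 0 + (3 : ℂ) • E 2 := by
  have := h.zero_mul 3
  simpa using this

theorem WittRel.sq_mul_two (h : WittRel E) :
    E 0 * (E 0 * E 2) = E 0 * E 2 * E 0 + (2 : ℂ) • (E 1 * E 0) + (2 : ℂ) • E 0 := by
  have h1 := h.zero_mul_one
  rw [h.zero_mul_two, mul_add, mul_smul_comm, h1, ← mul_assoc, h.zero_mul_two]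
  module

/-- This form and `pow_mul_three` leave a weight-preserving factor on the left of the power of E_0,
for computing coefficients. In `two_mul_pow` and `three_mul_pow` that factor stands on the right,
for the filtration. -/
theorem WittRel.pow_mul_two (h : WittRel E) (n : ℕ) :
    E 0 ^ (n + 1) * E 2 = (E 0 * E 2 + (2 * (n : ℂ)) • (E 1 + 1) + ((n : ℂ) * (n - 1)) • 1) *
      E 0 ^ n := by
  induction n with
  | zero => simp
  | succ n ih =>
    rw [pow_succ' (E 0) (n + 1), mul_assoc, ih, ← mul_assoc, mul_add, mul_add, h.sq_mul_two,
      pow_succ' (E 0) n, mul_smul_comm, mul_add, h.zero_mul_one]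
    simp only [add_mul, mul_assoc, mul_smul_comm, smul_mul_assoc, one_mul, mul_one]
    push_cast
    module

theorem WittRel.cube_mul_three (h : WittRel E) :
    E 0 * (E 0 * E 0 * E 3) = E 0 * E 0 * E 3 * E 0 + (3 : ℂ) • (E 0 * E 2 * E 0) +
      (6 : ℂ) • (E 1 * E 0) + (6 : ℂ) • E 0 := by
  have e1 : E 1 * E 0 = E 0 * E 1 - E 0 := by rw [h.zero_mul_one]; abel
  have e2 : E 2 * E 0 = E 0 * E 2 - (2 : ℂ) • E 1 := by rw [h.zero_mul_two]; abel
  have e3 : E 3 * E 0 = E 0 * E 3 - (3 : ℂ) • E 2 := by rw [h.zero_mul_three]; abel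
  simp only [mul_assoc, mul_sub, mul_smul_comm, e1, e2, e3]
  module

theorem WittRel.pow_mul_three (h : WittRel E) (n : ℕ) :
    E 0 ^ (n + 2) * E 3 = (E 0 * E 0 * E 3 + (3 * (n : ℂ)) • (E 0 * E 2 + (2 : ℂ) • (E 1 + 1)) +
      (3 * (n : ℂ) * (n - 1)) • (E 1 + (2 : ℂ) • 1) +
      ((n : ℂ) * (n - 1) * (n - 2)) • 1) * E 0 ^ n := by
  induction n with
  | zero => simp [pow_two]
  | succ n ih =>
    rw [show n + 1 + 2 = (n + 2) + 1 from rfl, pow_succ' (E 0) (n + 2), mul_assoc, ih, ← mul_assoc,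
      mul_add, mul_add, mul_add, h.cube_mul_three, pow_succ' (E 0) n]
    simp only [mul_add, mul_smul_comm, mul_one, h.sq_mul_two, h.zero_mul_one]
    simp only [add_mul, mul_assoc, smul_mul_assoc, one_mul]
    push_cast
    module

theorem WittRel.two_mul_pow (h : WittRel E) (m : ℕ) :
    E 2 * E 0 ^ (m + 1) = E 0 ^ m * (E 0 * E 2 - (2 * ((m : ℂ) + 1)) • E 1 +
      (((m : ℂ) + 1) * m) • 1) := by
  induction m with
  | zero =>
    simp [h.zero_mul_two]
  | succ m ih =>
    rw [pow_succ (E 0) (m + 1), ← mul_assoc, ih, pow_succ (E 0) m, mul_assoc, mul_assoc]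
    congr 1
    have e1 : E 1 * E 0 = E 0 * E 1 - E 0 := by rw [h.zero_mul_one]; abel
    have e2 : E 2 * E 0 = E 0 * E 2 - (2 : ℂ) • E 1 := by rw [h.zero_mul_two]; abel
    simp only [add_mul, sub_mul, mul_add, mul_sub, mul_assoc, mul_smul_comm, smul_mul_assoc,
      one_mul, mul_one, e1, e2]
    push_cast
    module

theorem WittRel.three_mul_pow (h : WittRel E) (m : ℕ) :
    E 3 * E 0 ^ (m + 2) = E 0 ^ m * (E 0 * E 0 * E 3 - (3 * ((m : ℂ) + 2)) • (E 0 * E 2) +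
      (3 * ((m : ℂ) + 2) * (m + 1)) • E 1 - (((m : ℂ) + 2) * (m + 1) * m) • 1) := by
  have e1 : E 1 * E 0 = E 0 * E 1 - E 0 := by rw [h.zero_mul_one]; abel
  have e2 : E 2 * E 0 = E 0 * E 2 - (2 : ℂ) • E 1 := by rw [h.zero_mul_two]; abel
  have e3 : E 3 * E 0 = E 0 * E 3 - (3 : ℂ) • E 2 := by rw [h.zero_mul_three]; abel
  induction m with
  | zero =>
    rw [zero_add, pow_two, ← mul_assoc, e3, pow_zero, one_mul]
    simp only [add_mul, sub_mul, mul_add, mul_sub, mul_assoc, mul_smul_comm, smul_mul_assoc,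
      mul_one, e2, e3]
    push_cast
    module
  | succ m ih =>
    rw [show m + 1 + 2 = (m + 2) + 1 from rfl, pow_succ (E 0) (m + 2), ← mul_assoc, ih,
      pow_succ (E 0) m, mul_assoc (E 0 ^ m), mul_assoc (E 0 ^ m)]
    congr 1
    simp only [add_mul, sub_mul, mul_add, mul_sub, mul_assoc, mul_smul_comm, smul_mul_assoc,
      one_mul, mul_one, e1, e2, e3]
    push_cast
    module

/-- The bridge between the two halves of the argument: the commutator controlled by growth is, up to
E_0^2, the generator of the space of words at exponent 4. -/
theorem WittRel.word₂_four (h : WittRel E) :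
    word₂ E E ((MvPolynomial.X 0 - MvPolynomial.X 1) ^ 4) * E 0 ^ 2 =
      (2 : ℂ) • (E 0 * E 2 * (E 0 * E 0 * E 3) - E 0 * E 0 * E 3 * (E 0 * E 2)) := by
  have hp : ((MvPolynomial.X 0 - MvPolynomial.X 1) ^ 4 : MvPolynomial (Fin 2) ℂ) =
      MvPolynomial.X 0 ^ 4 * MvPolynomial.X 1 ^ 0 -
      (4 : ℂ) • (MvPolynomial.X 0 ^ 3 * MvPolynomial.X 1 ^ 1) +
      (6 : ℂ) • (MvPolynomial.X 0 ^ 2 * MvPolynomial.X 1 ^ 2) -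
      (4 : ℂ) • (MvPolynomial.X 0 ^ 1 * MvPolynomial.X 1 ^ 3) +
      MvPolynomial.X 0 ^ 0 * MvPolynomial.X 1 ^ 4 := by
    rw [Algebra.smul_def, Algebra.smul_def, Algebra.smul_def]
    simp only [map_ofNat]
    ring
  rw [hp]
  simp only [map_add, map_sub, map_smul, word₂_apply]
  simp only [pow_two]
  have e1 : E 1 * E 0 = E 0 * E 1 - E 0 := by rw [h.zero_mul_one]; abel
  have e2 : E 2 * E 0 = E 0 * E 2 - (2 : ℂ) • E 1 := by rw [h.zero_mul_two]; abel
  have e3 : E 3 * E 0 = E 0 * E 3 - (3 : ℂ) • E 2 := by rw [h.zero_mul_three]; abel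
  have e21 : E 2 * E 1 = E 1 * E 2 - E 2 := by
    have := h 1 2
    norm_num at this
    linear_combination (norm := module) (-1 : ℂ) • this
  have e31 : E 3 * E 1 = E 1 * E 3 - (2 : ℂ) • E 3 := by
    have := h 1 3
    norm_num at this
    linear_combination (norm := module) (-1 : ℂ) • this
  -- With E_4 eliminated, both sides reduce to a normal form in E_0, ..., E_3.
  have e4 : E 4 = E 2 * E 3 - E 3 * E 2 := by
    have := h 2 3
    norm_num at this
    rw [this]
  have assoc : ∀ {a b c : R}, a * b = c → ∀ x, a * (b * x) = c * x := fun h x => by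
    rw [← h, mul_assoc]
  have f1 := assoc e1
  have f2 := assoc e2
  have f3 := assoc e3
  simp only [e4, mul_assoc, add_mul, sub_mul, smul_mul_assoc]
  simp only [mul_assoc, sub_mul, mul_sub, mul_smul_comm, smul_mul_assoc,
    e1, e2, e3, e21, e31, f1, f2, f3]
  module

end Identities

/-! ### Weight families and chains of invariant subspaces -/

/-- A family of weight spaces for the operators `E a = t^a d/dt`. -/
structure WittWeights {M : Type*} [AddCommGroup M] [Module ℂ M] (E : ℕ → Module.End ℂ M)
    {G : Type*} [AddCommGroup G] (Mw : G → Submodule ℂ M) (δ : G) (ℓ : G → ℂ) : Prop where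
  rel : WittRel E
  maps : ∀ (a : ℕ) (w : G), ∀ v ∈ Mw w, E a v ∈ Mw (w + ((a : ℤ) - 1) • δ)
  one : ∀ w, ∀ v ∈ Mw w, E 1 v = ℓ w • v
  ell : ∀ (w : G) (k : ℤ), ℓ (w + k • δ) = ℓ w + k

section Chains

variable {V : Type*} [AddCommGroup V] [Module ℂ V]

theorem IsRec.restrict {Φ : Type*} [AddCommGroup Φ] [Module ℂ Φ] {l : ℂ}
    {L L' : Module.End ℂ Φ} {R R' : Module.End ℂ V} {z : Φ →ₗ[ℂ] V →ₗ[ℂ] (ℕ → ℂ)}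
    (h : IsRec l L L' R R' z) {S : Submodule ℂ V} (hS : ∀ v ∈ S, R v ∈ S)
    (hS' : ∀ v ∈ S, R' v ∈ S) :
    IsRec l L L' (R.restrict hS) (R'.restrict hS') (z.compl₂ S.subtype) :=
  ⟨fun φ v => h.fst_zero φ v, fun φ v => h.fst_succ φ v, fun φ v => h.snd_zero φ v,
    fun φ v => h.snd_one φ v, fun φ v => h.snd_add_two φ v⟩

/-- If the commutator of two operators maps each nonzero invariant subspace into a smaller invariant
one, there is a finite chain of such subspaces. -/
theorem exists_chain [FiniteDimensional ℂ V] (L L' : Module.End ℂ V)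
    (H : ∀ S : Submodule ℂ V, S ≠ ⊥ → (∀ v ∈ S, L v ∈ S) → (∀ v ∈ S, L' v ∈ S) →
      ∃ W < S, (∀ v ∈ W, L v ∈ W) ∧ (∀ v ∈ W, L' v ∈ W) ∧ ∀ v ∈ S, L (L' v) - L' (L v) ∈ W)
    (n : ℕ) : ∀ S : Submodule ℂ V, Module.finrank ℂ S ≤ n → (∀ v ∈ S, L v ∈ S) →
      (∀ v ∈ S, L' v ∈ S) → ∃ c : ℕ → Submodule ℂ V, c 0 = S ∧ (∀ i, ∀ v ∈ c i, L v ∈ c i) ∧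
        (∀ i, ∀ v ∈ c i, L' v ∈ c i) ∧ (∀ i, ∀ v ∈ c i, L (L' v) - L' (L v) ∈ c (i + 1)) ∧
        ∀ i ≥ n, c i = ⊥ := by
  have hbot : ∃ c : ℕ → Submodule ℂ V, c 0 = ⊥ ∧ (∀ i, ∀ v ∈ c i, L v ∈ c i) ∧
      (∀ i, ∀ v ∈ c i, L' v ∈ c i) ∧ (∀ i, ∀ v ∈ c i, L (L' v) - L' (L v) ∈ c (i + 1)) ∧
      ∀ i, c i = ⊥ :=
    ⟨fun _ => ⊥, rfl, by simp, by simp, by simp, fun _ => rfl⟩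
  induction n with
  | zero =>
    intro S hS _ _
    obtain rfl : S = ⊥ := Submodule.finrank_eq_zero.mp (Nat.le_zero.mp hS)
    obtain ⟨c, h1, h2, h3, h4, h5⟩ := hbot
    exact ⟨c, h1, h2, h3, h4, fun i _ => h5 i⟩
  | succ n ih =>
    intro S hS hL hL'
    by_cases hS0 : S = ⊥
    · subst hS0
      obtain ⟨c, h1, h2, h3, h4, h5⟩ := hbot
      exact ⟨c, h1, h2, h3, h4, fun i _ => h5 i⟩
    · obtain ⟨W, hWS, hW, hW', hcomm⟩ := H S hS0 hL hL'
      obtain ⟨c, h1, h2, h3, h4, h5⟩ := ih W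
        (by have := Submodule.finrank_lt_finrank_of_lt hWS; omega) hW hW'
      refine ⟨fun i => Nat.casesOn i S c, rfl, ?_, ?_, ?_, ?_⟩
      · rintro (_ | i)
        · exact hL
        · exact h2 i
      · rintro (_ | i)
        · exact hL'
        · exact h3 i
      · rintro (_ | i)
        · intro v hv
          change _ ∈ c 0
          rw [h1]
          exact hcomm v hv
        · exact h4 i
      · rintro (_ | i) hi
        · omega
        · exact h5 i (by omega)

/-- As the coefficient at K = 0 is φ(v) itself, it is nonzero somewhere on every nonzero invariant
subspace, so `IsRec.exists_proper` applies to each restriction. Dimensions drop strictly, which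
bounds the length. -/
theorem IsRec.exists_chain [FiniteDimensional ℂ V] {l : ℂ} {L L' : Module.End ℂ (Module.Dual ℂ V)}
    {R R' : Module.End ℂ V} {z : Module.Dual ℂ V →ₗ[ℂ] V →ₗ[ℂ] (ℕ → ℂ)}
    (h : IsRec l L L' R R' z) (hz : ∀ φ v, z φ v 0 = φ v) :
    ∃ c : ℕ → Submodule ℂ V, c 0 = ⊤ ∧ (∀ i, ∀ v ∈ c i, R v ∈ c i) ∧
        (∀ i, ∀ v ∈ c i, R' v ∈ c i) ∧ (∀ i, ∀ v ∈ c i, R (R' v) - R' (R v) ∈ c (i + 1)) ∧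
        ∀ i ≥ Module.finrank ℂ V, c i = ⊥ := by
  refine WittSuper.exists_chain R R' (fun S hS0 hS hS' => ?_) _ ⊤
    (by rw [finrank_top]) (fun _ _ => trivial) (fun _ _ => trivial)
  obtain ⟨v, hv, hv0⟩ := Submodule.exists_mem_ne_zero_of_ne_bot hS0
  obtain ⟨φ, hφ⟩ := Module.Projective.exists_dual_ne_zero ℂ hv0
  obtain ⟨W, h1, h2, h3, h4⟩ := (h.restrict hS hS').exists_proper ⟨φ, ⟨v, hv⟩, by
    change z φ v 0 ≠ 0
    rwa [hz]⟩
  refine ⟨W.map S.subtype, lt_of_le_of_ne (Submodule.map_subtype_le S W) fun he => h1 ?_, ?_, ?_,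
    ?_⟩
  · refine eq_top_iff.mpr fun x _ => ?_
    have : (x : V) ∈ W.map S.subtype := he.ge x.2
    obtain ⟨y, hy, hyx⟩ := this
    rwa [← Subtype.ext hyx]
  · rintro _ ⟨x, hx, rfl⟩
    exact ⟨_, h2 x hx, rfl⟩
  · rintro _ ⟨x, hx, rfl⟩
    exact ⟨_, h3 x hx, rfl⟩
  · intro v hv
    exact ⟨_, h4 ⟨v, hv⟩, rfl⟩

end Chains

/-! ### The recursion for D^{K-1} E_K on a weight space -/

section Coefficients

variable {M : Type*} [AddCommGroup M] [Module ℂ M] {E : ℕ → Module.End ℂ M} {G : Type*}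
  [AddCommGroup G] {Mw : G → Submodule ℂ M} {δ : G} {ℓ : G → ℂ}

/-- `D^{K-1} E_K`, and `1` for `K = 0`. -/
def xop (E : ℕ → Module.End ℂ M) : ℕ → Module.End ℂ M
  | 0 => 1
  | K + 1 => E 0 ^ K * E (K + 1)

namespace WittWeights

theorem pow_mem (h : WittWeights E Mw δ ℓ) (n : ℕ) {w : G} {v : M} (hv : v ∈ Mw w) :
    (E 0 ^ n) v ∈ Mw (w - (n : ℤ) • δ) := by
  induction n with
  | zero => simpa using hv
  | succ n ih =>
    rw [pow_succ', Module.End.mul_apply]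
    have := h.maps 0 _ _ ih
    convert this using 2
    push_cast
    module

theorem xop_mem (h : WittWeights E Mw δ ℓ) (K : ℕ) {w : G} {v : M} (hv : v ∈ Mw w) :
    xop E K v ∈ Mw w := by
  rcases K with _ | K
  · exact hv
  · have := h.pow_mem K (h.maps (K + 1) w v hv)
    rwa [show w + (((K + 1 : ℕ) : ℤ) - 1) • δ - (K : ℤ) • δ = w by push_cast; module] at this

theorem two_mem (h : WittWeights E Mw δ ℓ) {w : G} {v : M} (hv : v ∈ Mw w) :
    (E 0 * E 2) v ∈ Mw w := by
  have := h.xop_mem 2 hv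
  simpa [xop] using this

theorem three_mem (h : WittWeights E Mw δ ℓ) {w : G} {v : M} (hv : v ∈ Mw w) :
    (E 0 * E 0 * E 3) v ∈ Mw w := by
  have := h.xop_mem 3 hv
  simpa [xop, pow_two] using this

/-- The elements D^K E_K E_2 are computed in two ways: here from right multiplication by D E_2, in
`fst_coeff` from left multiplication. Equating the two is the first recursion; the elements D^{K+1}
E_K E_3 give the second in the same way. -/
theorem xop_succ_mul_two (h : WittWeights E Mw δ ℓ) (K : ℕ) :
    xop E (K + 1) * (E 0 * E 2) =
      E 0 ^ (K + 1) * E (K + 1) * E 2 - ((K : ℂ) + 1) • (E 0 ^ K * E K * E 2) := by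
  have e := h.rel.zero_mul (K + 1)
  rw [Nat.add_sub_cancel] at e
  have e' : E (K + 1) * E 0 = E 0 * E (K + 1) - ((K + 1 : ℕ) : ℂ) • E K := by rw [e]; abel
  rw [xop, mul_assoc, ← mul_assoc (E (K + 1)), e', pow_succ]
  push_cast
  simp only [sub_mul, mul_sub, smul_mul_assoc, mul_smul_comm, mul_assoc]

theorem xop_one_mul_three (h : WittWeights E Mw δ ℓ) :
    xop E 1 * (E 0 * E 0 * E 3) = E 0 ^ 2 * E 1 * E 3 - (2 : ℂ) • (E 0 * E 0 * E 3) := by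
  have e1 : E 1 * E 0 = E 0 * E 1 - E 0 := by rw [h.rel.zero_mul_one]; abel
  have f1 : ∀ x, E 1 * (E 0 * x) = E 0 * (E 1 * x) - E 0 * x := fun x => by
    rw [← mul_assoc, e1, sub_mul, mul_assoc]
  simp only [xop, pow_zero, one_mul, pow_two, mul_assoc, f1, mul_sub, zero_add]
  module

theorem xop_add_two_mul_three (h : WittWeights E Mw δ ℓ) (K : ℕ) :
    xop E (K + 2) * (E 0 * E 0 * E 3) = E 0 ^ (K + 3) * E (K + 2) * E 3 -
      (2 * ((K : ℂ) + 2)) • (E 0 ^ (K + 2) * E (K + 1) * E 3) +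
      (((K : ℂ) + 2) * (K + 1)) • (E 0 ^ (K + 1) * E K * E 3) := by
  have e2 := h.rel.zero_mul (K + 2)
  have e1 := h.rel.zero_mul (K + 1)
  rw [Nat.add_sub_cancel] at e1
  rw [show K + 2 - 1 = K + 1 from rfl] at e2
  push_cast at e1 e2
  have f2 : ∀ x, E (K + 2) * (E 0 * x) = E 0 * (E (K + 2) * x) - ((K : ℂ) + 2) • (E (K + 1) * x) :=
    fun x => by rw [← mul_assoc, ← mul_assoc, e2, add_mul, smul_mul_assoc]; abel
  have f1 : ∀ x, E (K + 1) * (E 0 * x) = E 0 * (E (K + 1) * x) - ((K : ℂ) + 1) • (E K * x) :=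
    fun x => by rw [← mul_assoc, ← mul_assoc, e1, add_mul, smul_mul_assoc]; abel
  simp only [xop, pow_succ, mul_assoc, f2, f1, mul_sub, mul_smul_comm]
  module

/-- Commute E_K past E_2 and then D^K past E_2; on a weight space the resulting E_1 is a scalar. -/
theorem fst_coeff (h : WittWeights E Mw δ ℓ) (K : ℕ) {w : G} {v : M} (hv : v ∈ Mw w) :
    (E 0 ^ K * E K * E 2) v = (E 0 * E 2) (xop E K v) +
      (((K : ℂ) - 1) * (K + 2 * ℓ w)) • xop E K v - ((K : ℂ) - 2) • xop E (K + 1) v := by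
  rcases K with _ | K
  · simp only [xop, pow_zero, one_mul, zero_add, Module.End.one_apply, h.one w v hv]
    push_cast
    module
  · have e := h.rel (K + 1) 2
    rw [show K + 1 + 2 - 1 = K + 2 from rfl] at e
    have e' : E (K + 1) * E 2 = E 2 * E (K + 1) + ((2 : ℂ) - (K + 1)) • E (K + 2) := by
      push_cast at e
      rw [← e]
      abel
    rw [mul_assoc, e', mul_add, ← mul_assoc, h.rel.pow_mul_two, mul_assoc, mul_smul_comm]
    have hx := h.one w _ (h.xop_mem (K + 1) hv)
    change ((E 0 * E 2 + (2 * (K : ℂ)) • (E 1 + 1) + ((K : ℂ) * (K - 1)) • 1) * xop E (K + 1) +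
      ((2 : ℂ) - (K + 1)) • xop E (K + 2)) v = _
    simp only [LinearMap.add_apply, Module.End.mul_apply, LinearMap.smul_apply,
      Module.End.one_apply, hx]
    push_cast
    module

theorem snd_coeff (h : WittWeights E Mw δ ℓ) (K : ℕ) {w : G} {v : M} (hv : v ∈ Mw w) :
    (E 0 ^ (K + 1) * E K * E 3) v = (E 0 * E 0 * E 3) (xop E K v) +
      (3 * ((K : ℂ) - 1)) • ((E 0 * E 2) (xop E K v) + (2 * ℓ w + 2) • xop E K v) +
      (3 * ((K : ℂ) - 1) * (K - 2) * (ℓ w + 2) + ((K : ℂ) - 1) * (K - 2) * (K - 3)) • xop E K v -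
      ((K : ℂ) - 3) • xop E (K + 2) v := by
  rcases K with _ | K
  · simp only [xop, pow_one, zero_add, Module.End.one_apply]
    push_cast
    module
  · have e := h.rel (K + 1) 3
    rw [show K + 1 + 3 - 1 = K + 3 from rfl] at e
    have e' : E (K + 1) * E 3 = E 3 * E (K + 1) + ((3 : ℂ) - (K + 1)) • E (K + 3) := by
      push_cast at e
      rw [← e]
      abel
    rw [mul_assoc, e', mul_add, ← mul_assoc, h.rel.pow_mul_three, mul_assoc, mul_smul_comm]
    have hx := h.one w _ (h.xop_mem (K + 1) hv)
    change ((E 0 * E 0 * E 3 + (3 * (K : ℂ)) • (E 0 * E 2 + (2 : ℂ) • (E 1 + 1)) +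
      (3 * (K : ℂ) * (K - 1)) • (E 1 + (2 : ℂ) • 1) +
      ((K : ℂ) * (K - 1) * (K - 2)) • 1) * xop E (K + 1) +
      ((3 : ℂ) - (K + 1)) • xop E (K + 3)) v = _
    simp only [LinearMap.add_apply, Module.End.mul_apply, LinearMap.smul_apply,
      Module.End.one_apply, hx]
    push_cast
    module

theorem exists_chain (h : WittWeights E Mw δ ℓ) (w : G) [FiniteDimensional ℂ (Mw w)] :
    ∃ c : ℕ → Submodule ℂ M, c 0 = Mw w ∧ (∀ i, c i ≤ Mw w) ∧
      (∀ i, ∀ v ∈ c i, (E 0 * E 2) v ∈ c i) ∧ (∀ i, ∀ v ∈ c i, (E 0 * E 0 * E 3) v ∈ c i) ∧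
      (∀ i, ∀ v ∈ c i, (E 0 * E 2 * (E 0 * E 0 * E 3) - E 0 * E 0 * E 3 * (E 0 * E 2)) v ∈
        c (i + 1)) ∧ ∀ i ≥ Module.finrank ℂ (Mw w), c i = ⊥ := by
  let R : Module.End ℂ (Mw w) := (E 0 * E 2).restrict fun _ hv => h.two_mem hv
  let R' : Module.End ℂ (Mw w) := (E 0 * E 0 * E 3).restrict fun _ hv => h.three_mem hv
  let x : ℕ → Module.End ℂ (Mw w) := fun K => (xop E K).restrict fun _ hv => h.xop_mem K hv
  -- Division by K! turns the coefficients K + 1 and (K+2)(K+1) of the right-hand products into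
  -- plain first and second differences.
  let z : Module.Dual ℂ (Mw w) →ₗ[ℂ] Mw w →ₗ[ℂ] (ℕ → ℂ) :=
    LinearMap.mk₂ ℂ (fun φ v K => ((K.factorial : ℂ))⁻¹ * φ (x K v))
      (fun φ φ' v => by funext K; simp [mul_add])
      (fun c φ v => by funext K; simp [mul_left_comm])
      (fun φ v v' => by funext K; simp [mul_add])
      (fun c φ v => by funext K; simp [mul_left_comm])
  have hz : ∀ φ v K, z φ v K = ((K.factorial : ℂ))⁻¹ * φ (x K v) := fun _ _ _ => rfl
  let y : ℕ → Mw w → Mw w := fun K v => R (x K v) + (((K : ℂ) - 1) * (K + 2 * ℓ w)) • x K v -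
    ((K : ℂ) - 2) • x (K + 1) v
  let y' : ℕ → Mw w → Mw w := fun K v => R' (x K v) +
      (3 * ((K : ℂ) - 1)) • (R (x K v) + (2 * ℓ w + 2) • x K v) +
      (3 * ((K : ℂ) - 1) * (K - 2) * (ℓ w + 2) + ((K : ℂ) - 1) * (K - 2) * (K - 3)) • x K v -
      ((K : ℂ) - 3) • x (K + 2) v
  have hy : ∀ K (v : Mw w), (y K v : M) = (E 0 ^ K * E K * E 2) (v : M) := fun K v => by
    rw [h.fst_coeff K v.2]
    rfl
  have hy' : ∀ K (v : Mw w), (y' K v : M) = (E 0 ^ (K + 1) * E K * E 3) (v : M) := fun K v => by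
    rw [h.snd_coeff K v.2]
    rfl
  have hfac : ∀ K : ℕ, (K.factorial : ℂ) ≠ 0 := fun K => Nat.cast_ne_zero.mpr K.factorial_ne_zero
  have hg : ∀ φ v K, recG (ℓ w) R.dualMap z φ v K = ((K.factorial : ℂ))⁻¹ * φ (y K v) := by
    intro φ v K
    simp only [recG, hz, y, map_add, map_sub, map_smul, smul_eq_mul, LinearMap.dualMap_apply,
      Nat.factorial_succ, Nat.cast_mul]
    have := hfac K
    have h2 : ((K : ℂ) + 1) ≠ 0 := Nat.cast_add_one_ne_zero K
    push_cast
    field_simp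
  have hh : ∀ φ v K, recH (ℓ w) R.dualMap R'.dualMap z φ v K =
      ((K.factorial : ℂ))⁻¹ * φ (y' K v) := by
    intro φ v K
    simp only [recH, hz, y', map_add, map_sub, map_smul, smul_eq_mul, LinearMap.dualMap_apply,
      Nat.factorial_succ, Nat.cast_mul]
    have := hfac K
    have h2 : ((K : ℂ) + 1) ≠ 0 := Nat.cast_add_one_ne_zero K
    have h3 : ((K : ℂ) + 1 + 1) ≠ 0 := by
      have := Nat.cast_add_one_ne_zero (R := ℂ) (K + 1)
      push_cast at this
      exact this
    push_cast
    field_simp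
    ring
  -- Left multiplication is moved to the functional, which is why the dual maps appear; right
  -- multiplication acts on the vector.
  have hrec : IsRec (ℓ w) R.dualMap R'.dualMap R R' z := by
    refine ⟨fun φ v => ?_, fun φ v K => ?_, fun φ v => ?_, fun φ v => ?_, fun φ v K => ?_⟩
    · rw [hg, hz]
      congr 2
      refine Subtype.ext ?_
      rw [hy, pow_zero, one_mul]
      rfl
    · rw [hg, hg, hz]
      have e : x (K + 1) (R v) = y (K + 1) v - ((K : ℂ) + 1) • y K v := by
        refine Subtype.ext ?_
        rw [Submodule.coe_sub, Submodule.coe_smul, hy, hy]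
        exact LinearMap.congr_fun (h.xop_succ_mul_two K) (v : M)
      rw [e, map_sub, map_smul, smul_eq_mul, Nat.factorial_succ]
      have := hfac K
      have h2 : ((K : ℂ) + 1) ≠ 0 := Nat.cast_add_one_ne_zero K
      push_cast
      field_simp
    · rw [hh, hz]
      congr 2
      refine Subtype.ext ?_
      rw [hy', zero_add, pow_one]
      rfl
    · rw [hh, hh, hz]
      have e : x 1 (R' v) = y' 1 v - (2 : ℂ) • y' 0 v := by
        refine Subtype.ext ?_
        rw [Submodule.coe_sub, Submodule.coe_smul, hy', hy', zero_add, pow_one]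
        exact LinearMap.congr_fun h.xop_one_mul_three (v : M)
      rw [e, map_sub, map_smul, smul_eq_mul, Nat.factorial_one, Nat.factorial_zero]
      push_cast
      ring
    · rw [hh, hh, hh, hz]
      have e : x (K + 2) (R' v) = y' (K + 2) v - (2 * ((K : ℂ) + 2)) • y' (K + 1) v +
          (((K : ℂ) + 2) * (K + 1)) • y' K v := by
        refine Subtype.ext ?_
        rw [Submodule.coe_add, Submodule.coe_sub, Submodule.coe_smul, Submodule.coe_smul, hy', hy',
          hy']
        exact LinearMap.congr_fun (h.xop_add_two_mul_three K) (v : M)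
      rw [e, map_add, map_sub, map_smul, map_smul, smul_eq_mul, smul_eq_mul,
        show K + 2 = K + 1 + 1 from rfl, Nat.factorial_succ, Nat.factorial_succ]
      have := hfac K
      have h2 : ((K : ℂ) + 1) ≠ 0 := Nat.cast_add_one_ne_zero K
      have h3 : ((K : ℂ) + 1 + 1) ≠ 0 := by
        have := Nat.cast_add_one_ne_zero (R := ℂ) (K + 1)
        push_cast at this
        exact this
      push_cast
      field_simp
      ring
  obtain ⟨c, h1, h2, h3, h4, h5⟩ := hrec.exists_chain fun φ v => by
    rw [hz, Nat.factorial_zero, Nat.cast_one, inv_one, one_mul]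
    rfl
  refine ⟨fun i => (c i).map (Mw w).subtype, ?_, fun i => Submodule.map_subtype_le _ _, ?_, ?_, ?_,
    fun i hi => ?_⟩
  · simp only [h1, Submodule.map_top, Submodule.range_subtype]
  · rintro i _ ⟨v, hv, rfl⟩
    exact ⟨_, h2 i v hv, rfl⟩
  · rintro i _ ⟨v, hv, rfl⟩
    exact ⟨_, h3 i v hv, rfl⟩
  · rintro i _ ⟨v, hv, rfl⟩
    exact ⟨_, h4 i v hv, rfl⟩
  · simp only [h5 i hi, Submodule.map_bot]

end WittWeights

end Coefficients

/-! ### Pushing down the chains -/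

section Filtration

variable {M : Type*} [AddCommGroup M] [Module ℂ M] {E : ℕ → Module.End ℂ M} {G : Type*}
  [AddCommGroup G] {Mw : G → Submodule ℂ M} {δ : G} {ℓ : G → ℂ}

/-- Chains of length `N` in the weight spaces, whose factors are commutative for `D E_2` and
`D^2 E_3`. -/
structure IsChain (E : ℕ → Module.End ℂ M) (Mw : G → Submodule ℂ M) (c : G → ℕ → Submodule ℂ M)
    (N : ℕ) : Prop where
  zero : ∀ w, c w 0 = Mw w
  le : ∀ w i, c w i ≤ Mw w
  two : ∀ w i, ∀ v ∈ c w i, (E 0 * E 2) v ∈ c w i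
  three : ∀ w i, ∀ v ∈ c w i, (E 0 * E 0 * E 3) v ∈ c w i
  comm : ∀ w i, ∀ v ∈ c w i,
    (E 0 * E 2 * (E 0 * E 0 * E 3) - E 0 * E 0 * E 3 * (E 0 * E 2)) v ∈ c w (i + 1)
  eq_bot : ∀ w, ∀ i ≥ N, c w i = ⊥

/-- The operators of degree `d` that lower the chains by `q` steps. -/
def loweringSub (E : ℕ → Module.End ℂ M) (Mw : G → Submodule ℂ M) (c : G → ℕ → Submodule ℂ M)
    (d q : ℕ) : Submodule ℂ (Module.End ℂ M) where
  carrier := {f | ∀ w n, d ≤ n → ∃ g : Module.End ℂ M,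
    (∀ v ∈ Mw w, f ((E 0 ^ n) v) = (E 0 ^ (n - d)) (g v)) ∧ ∀ i, ∀ v ∈ c w i, g v ∈ c w (i + q)}
  zero_mem' := fun w n _ => ⟨0, by simp, by simp⟩
  add_mem' := by
    intro f f' hf hf' w n hn
    obtain ⟨g, h1, h2⟩ := hf w n hn
    obtain ⟨g', h1', h2'⟩ := hf' w n hn
    exact ⟨g + g', fun v hv => by
      rw [LinearMap.add_apply, LinearMap.add_apply, map_add, h1 v hv, h1' v hv],
      fun i v hv => Submodule.add_mem _ (h2 i v hv) (h2' i v hv)⟩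
  smul_mem' := by
    intro z f hf w n hn
    obtain ⟨g, h1, h2⟩ := hf w n hn
    exact ⟨z • g, fun v hv => by rw [LinearMap.smul_apply, LinearMap.smul_apply, map_smul, h1 v hv],
      fun i v hv => Submodule.smul_mem _ _ (h2 i v hv)⟩

variable {c : G → ℕ → Submodule ℂ M} {N : ℕ}

namespace IsChain

theorem map_mem (hc : IsChain E Mw c N) {w : G} {q : ℕ} {g : Module.End ℂ M}
    (hg : ∀ i, ∀ v ∈ c w i, g v ∈ c w (i + q)) {v : M} (hv : v ∈ Mw w) : g v ∈ Mw w :=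
  hc.le _ _ (hg 0 v (by rwa [hc.zero]))

theorem mul_mem (hc : IsChain E Mw c N) {d q d' q' : ℕ} {f f' : Module.End ℂ M}
    (hf : f ∈ loweringSub E Mw c d q) (hf' : f' ∈ loweringSub E Mw c d' q') :
    f * f' ∈ loweringSub E Mw c (d + d') (q + q') := by
  intro w n hn
  obtain ⟨g', h1', h2'⟩ := hf' w n (by omega)
  obtain ⟨g, h1, h2⟩ := hf w (n - d') (by omega)
  refine ⟨g * g', fun v hv => ?_, fun i v hv => ?_⟩
  · rw [Module.End.mul_apply, h1' v hv, h1 _ (hc.map_mem h2' hv), Module.End.mul_apply,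
      show n - d' - d = n - (d + d') by omega]
  · have := h2 _ _ (h2' i v hv)
    rwa [add_assoc, add_comm q' q] at this

theorem one_mem : (1 : Module.End ℂ M) ∈ loweringSub E Mw c 0 0 :=
  fun _ _ _ => ⟨1, fun _ _ => rfl, fun _ _ hv => hv⟩

theorem two_mul_pow_apply (h : WittWeights E Mw δ ℓ) (m : ℕ) {w : G} {v : M} (hv : v ∈ Mw w) :
    E 2 ((E 0 ^ (m + 1)) v) = (E 0 ^ m) ((E 0 * E 2 - (2 * ((m : ℂ) + 1) * ℓ w -
      ((m : ℂ) + 1) * m) • 1 : Module.End ℂ M) v) := by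
  have := LinearMap.congr_fun (h.rel.two_mul_pow m) v
  rw [Module.End.mul_apply, Module.End.mul_apply] at this
  rw [this]
  congr 1
  simp only [LinearMap.add_apply, LinearMap.sub_apply, LinearMap.smul_apply, Module.End.one_apply,
    h.one w v hv]
  module

theorem three_mul_pow_apply (h : WittWeights E Mw δ ℓ) (m : ℕ) {w : G} {v : M} (hv : v ∈ Mw w) :
    E 3 ((E 0 ^ (m + 2)) v) = (E 0 ^ m) ((E 0 * E 0 * E 3 - (3 * ((m : ℂ) + 2)) • (E 0 * E 2) +
      (3 * ((m : ℂ) + 2) * (m + 1) * ℓ w - ((m : ℂ) + 2) * (m + 1) * m) • 1 :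
      Module.End ℂ M) v) := by
  have := LinearMap.congr_fun (h.rel.three_mul_pow m) v
  rw [Module.End.mul_apply, Module.End.mul_apply] at this
  rw [this]
  congr 1
  simp only [LinearMap.add_apply, LinearMap.sub_apply, LinearMap.smul_apply, Module.End.one_apply,
    h.one w v hv]
  module

/-- Commuting with an operator that preserves the chains up to powers of `D`. -/
theorem comm_mem (hc : IsChain E Mw c N) {F : Module.End ℂ M} {e : ℕ}
    (hF : ∀ (w : G) (m : ℕ), ∃ g : Module.End ℂ M,
      (∀ v ∈ Mw w, F ((E 0 ^ (m + e)) v) = (E 0 ^ m) (g v)) ∧ ∀ i, ∀ v ∈ c w i, g v ∈ c w i)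
    {d q : ℕ} {f : Module.End ℂ M} (hf : f ∈ loweringSub E Mw c d q) :
    F * f - f * F ∈ loweringSub E Mw c (d + e) q := by
  intro w n hn
  obtain ⟨m, rfl⟩ := Nat.exists_eq_add_of_le hn
  obtain ⟨g, h1, h2⟩ := hf w (d + e + m) (by omega)
  obtain ⟨g', h1', h2'⟩ := hf w (d + m) (by omega)
  obtain ⟨a, h3, h4⟩ := hF w m
  obtain ⟨a', h3', h4'⟩ := hF w (d + m)
  refine ⟨a * g - g' * a', fun v hv => ?_, fun i v hv =>
    Submodule.sub_mem _ (h4 _ _ (h2 i v hv)) (h2' _ _ (h4' i v hv))⟩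
  have ha' : a' v ∈ Mw w := hc.map_mem (q := 0) h4' hv
  rw [LinearMap.sub_apply, Module.End.mul_apply, Module.End.mul_apply, h1 v hv,
    show d + e + m - d = m + e by omega, h3 _ (hc.map_mem h2 hv),
    show d + e + m = d + m + e by omega, h3' v hv, h1' _ ha', LinearMap.sub_apply, map_sub,
    show d + m - d = m by omega, show d + m + e - (d + e) = m by omega]
  rfl

theorem two_comm_mem (h : WittWeights E Mw δ ℓ) (hc : IsChain E Mw c N) {d q : ℕ}
    {f : Module.End ℂ M} (hf : f ∈ loweringSub E Mw c d q) :
    E 2 * f - f * E 2 ∈ loweringSub E Mw c (d + 1) q := by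
  refine hc.comm_mem (fun w m => ⟨_, fun v hv => two_mul_pow_apply h m hv, fun i v hv => ?_⟩) hf
  exact Submodule.sub_mem _ (hc.two w i v hv) (Submodule.smul_mem _ _ hv)

theorem three_comm_mem (h : WittWeights E Mw δ ℓ) (hc : IsChain E Mw c N) {d q : ℕ}
    {f : Module.End ℂ M} (hf : f ∈ loweringSub E Mw c d q) :
    E 3 * f - f * E 3 ∈ loweringSub E Mw c (d + 2) q := by
  refine hc.comm_mem (fun w m => ⟨_, fun v hv => three_mul_pow_apply h m hv, fun i v hv => ?_⟩) hf
  exact Submodule.add_mem _ (Submodule.sub_mem _ (hc.three w i v hv)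
    (Submodule.smul_mem _ _ (hc.two w i v hv))) (Submodule.smul_mem _ _ hv)

theorem comm_zero_word₂ (h : WittRel E) (r : ℕ) :
    E 0 * word₂ E E ((X 0 - X 1) ^ r) = word₂ E E ((X 0 - X 1) ^ r) * E 0 := by
  rw [← sub_eq_zero, comm_word₂ h, lieX_apply, lieY_apply]
  simp [Derivation.leibniz_pow]

/-- By `word₂_four` the operator g of `loweringSub` is twice the commutator. The word commutes with
E_0, so the remaining powers of E_0 can be pulled out. -/
theorem four_mem (h : WittWeights E Mw δ ℓ) (hc : IsChain E Mw c N) :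
    word₂ E E ((X 0 - X 1) ^ 4) ∈ loweringSub E Mw c 2 1 := by
  intro w n hn
  refine ⟨(2 : ℂ) • (E 0 * E 2 * (E 0 * E 0 * E 3) - E 0 * E 0 * E 3 * (E 0 * E 2)),
    fun v _ => ?_, fun i v hv => Submodule.smul_mem _ _ (hc.comm w i v hv)⟩
  rw [← h.rel.word₂_four, ← Module.End.mul_apply, ← Module.End.mul_apply]
  obtain ⟨m, rfl⟩ := Nat.exists_eq_add_of_le hn
  have hcm : Commute (E 0 ^ m) (word₂ E E ((X 0 - X 1) ^ 4)) :=
    Commute.pow_left (comm_zero_word₂ h.rel 4) m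
  rw [Nat.add_sub_cancel_left, ← mul_assoc, hcm.eq, mul_assoc, ← pow_add, add_comm]

/-- The lowering operators are closed under commutators with E_2 and E_3, because those two preserve
the chains up to powers of E_0. `mem_of_lie_closed` then extends `four_mem` to the whole ideal. -/
theorem diagSpan_four_le (h : WittWeights E Mw δ ℓ) (hc : IsChain E Mw c N) :
    diagSpan E E 4 ≤ ⨆ d, loweringSub E Mw c d 1 := by
  rintro _ ⟨q, rfl⟩
  rw [LinearMap.comp_apply, LinearMap.mulLeft_apply]
  refine mem_of_lie_closed (S := (⨆ d, loweringSub E Mw c d 1).comap (word₂ E E)) (r := 0)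
    (fun s k => ?_) (fun p hp => ?_) (fun p hp => ?_) ?_ q
  · rw [Submodule.mem_comap, word₂_odd h.rel]
    exact Submodule.zero_mem _
  · rw [Submodule.mem_comap, LinearMap.add_apply, ← comm_word₂ h.rel]
    refine Submodule.iSup_induction (fun d => loweringSub E Mw c d 1)
      (motive := fun f => E 2 * f - f * E 2 ∈ ⨆ d, loweringSub E Mw c d 1) hp
      (fun d f hf => Submodule.mem_iSup_of_mem (d + 1) (hc.two_comm_mem h hf)) ?_
      fun f f' hf hf' => ?_
    · rw [mul_zero, zero_mul, sub_zero]
      exact Submodule.zero_mem _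
    · rw [mul_add, add_mul, add_sub_add_comm]
      exact Submodule.add_mem _ hf hf'
  · rw [Submodule.mem_comap, LinearMap.add_apply, ← comm_word₂ h.rel]
    refine Submodule.iSup_induction (fun d => loweringSub E Mw c d 1)
      (motive := fun f => E 3 * f - f * E 3 ∈ ⨆ d, loweringSub E Mw c d 1) hp
      (fun d f hf => Submodule.mem_iSup_of_mem (d + 2) (hc.three_comm_mem h hf)) ?_
      fun f f' hf hf' => ?_
    · rw [mul_zero, zero_mul, sub_zero]
      exact Submodule.zero_mem _
    · rw [mul_add, add_mul, add_sub_add_comm]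
      exact Submodule.add_mem _ hf hf'
  · exact Submodule.mem_iSup_of_mem 2 (hc.four_mem h)

theorem pow_le (hc : IsChain E Mw c N) (p : ℕ) :
    (⨆ d, loweringSub E Mw c d 1) ^ p ≤ ⨆ d, loweringSub E Mw c d p := by
  induction p with
  | zero =>
    rw [Submodule.pow_zero, Submodule.one_le]
    exact Submodule.mem_iSup_of_mem 0 one_mem
  | succ p ih =>
    rw [Submodule.pow_succ]
    refine (mul_le_mul' ih le_rfl).trans ?_
    rw [Submodule.iSup_mul]
    refine iSup_le fun d => ?_
    rw [Submodule.mul_iSup]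
    refine iSup_le fun d' => Submodule.mul_le.mpr fun f hf f' hf' => ?_
    exact Submodule.mem_iSup_of_mem (d + d') (hc.mul_mem hf hf')

/-- Lowering by at least the length of the chains leaves zero on every weight space; n only has to
exceed the degrees that occur. -/
theorem exists_mul_pow_eq_zero (hc : IsChain E Mw c N) (htop : ⨆ w, Mw w = ⊤) {p : ℕ}
    (hp : N ≤ p) {f : Module.End ℂ M} (hf : f ∈ ⨆ d, loweringSub E Mw c d p) :
    ∃ n, f * E 0 ^ n = 0 := by
  -- Vanishing for all larger exponents is what makes the claim additive over degrees.
  suffices H : ∃ n, ∀ m, f * E 0 ^ (n + m) = 0 from H.imp fun n hn => hn 0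
  refine Submodule.iSup_induction (fun d => loweringSub E Mw c d p)
      (motive := fun f => ∃ n, ∀ m, f * E 0 ^ (n + m) = 0) hf
      (fun d f hf => ⟨d, fun m => ?_⟩) ⟨0, fun m => zero_mul _⟩ ?_
  · have : (⊤ : Submodule ℂ M) ≤ LinearMap.ker (f * E 0 ^ (d + m)) := by
      rw [← htop]
      refine iSup_le fun w v hv => ?_
      obtain ⟨g, h1, h2⟩ := hf w (d + m) (by omega)
      have h3 := h2 0 v (by rwa [hc.zero])
      rw [hc.eq_bot w _ (by omega), Submodule.mem_bot] at h3
      rw [LinearMap.mem_ker, Module.End.mul_apply, h1 v hv, h3, map_zero]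
    exact LinearMap.ker_eq_top.mp (top_le_iff.mp this)
  · rintro f f' ⟨n, hn⟩ ⟨n', hn'⟩
    refine ⟨n + n', fun m => ?_⟩
    have h1 := hn (n' + m)
    have h2 := hn' (n + m)
    rw [add_mul, show n + n' + m = n + (n' + m) by ring, h1,
      show n + (n' + m) = n' + (n + m) by ring, h2, add_zero]

end IsChain

/-- A power of `(X 0 - X 1)` gives an operator that is annihilated by a power of `D`. -/
theorem WittWeights.exists_word₂_mul_pow (h : WittWeights E Mw δ ℓ) (htop : ⨆ w, Mw w = ⊤) {N : ℕ}
    (hfin : ∀ w, FiniteDimensional ℂ (Mw w)) (hN : ∀ w, Module.finrank ℂ (Mw w) ≤ N) :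
    ∃ n, word₂ E E ((X 0 - X 1) ^ 4 ^ (N + 1)) * E 0 ^ n = 0 := by
  choose c h1 h2 h3 h4 h5 h6 using fun w => haveI := hfin w; h.exists_chain w
  have hc : IsChain E Mw c N := ⟨h1, h2, h3, h4, h5, fun w i hi => h6 w i ((hN w).trans hi)⟩
  -- Exponent 4^{N+1} yields 2^N lowering factors, which is at least N.
  refine hc.exists_mul_pow_eq_zero htop (p := 2 ^ N) Nat.lt_two_pow_self.le ?_
  have := word₂_mem_diagSpan E E (4 ^ (N + 1)) 1
  rw [mul_one] at this
  exact (hc.pow_le _) (pow_le_pow_left' (hc.diagSpan_four_le h) _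
    (diagSpan_le_pow h.rel N this))

end Filtration

/-! ### D-nilpotent and D-divisible vectors -/

section Nilpotent

variable {M : Type*} [AddCommGroup M] [Module ℂ M] {E : ℕ → Module.End ℂ M}

/-- The vectors annihilated by a power of `D`. -/
def nilp (D : Module.End ℂ M) : Submodule ℂ M where
  carrier := {v | ∃ k, (D ^ k) v = 0}
  zero_mem' := ⟨0, rfl⟩
  add_mem' := by
    rintro u v ⟨k, hk⟩ ⟨l, hl⟩
    refine ⟨k + l, ?_⟩
    rw [map_add, pow_add, Module.End.mul_apply, Module.End.mul_apply, hl, map_zero, add_zero,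
      ← Module.End.mul_apply, ← pow_add, add_comm, pow_add, Module.End.mul_apply, hk, map_zero]
  smul_mem' := by
    rintro c v ⟨k, hk⟩
    exact ⟨k, by rw [map_smul, hk, smul_zero]⟩

/-- The infinitely `D`-divisible vectors in `nilp D`. -/
def nilpCore (D : Module.End ℂ M) : Submodule ℂ M := ⨅ k : ℕ, (nilp D).map (D ^ k)

theorem mem_nilp {D : Module.End ℂ M} {v : M} : v ∈ nilp D ↔ ∃ k, (D ^ k) v = 0 := Iff.rfl

theorem mem_nilpCore {D : Module.End ℂ M} {v : M} :
    v ∈ nilpCore D ↔ ∀ k : ℕ, ∃ u ∈ nilp D, (D ^ k) u = v := by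
  simp only [nilpCore, Submodule.mem_iInf, Submodule.mem_map]

theorem mem_nilp_of_apply {D : Module.End ℂ M} {v : M} (h : D v ∈ nilp D) : v ∈ nilp D := by
  obtain ⟨k, hk⟩ := h
  exact ⟨k + 1, by rwa [pow_succ, Module.End.mul_apply]⟩

theorem pow_apply_mem_nilp {D : Module.End ℂ M} {v : M} (h : v ∈ nilp D) (n : ℕ) :
    (D ^ n) v ∈ nilp D := by
  obtain ⟨k, hk⟩ := h
  refine ⟨k, ?_⟩
  rw [← Module.End.mul_apply, ← pow_add, add_comm, pow_add, Module.End.mul_apply, hk, map_zero]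

theorem WittRel.zero_apply (h : WittRel E) (a : ℕ) (v : M) :
    E 0 (E a v) = E a (E 0 v) + (a : ℂ) • E (a - 1) v :=
  LinearMap.congr_fun (h.zero_mul a) v

theorem WittRel.apply_mem_nilp (h : WittRel E) (a : ℕ) :
    ∀ v ∈ nilp (E 0), E a v ∈ nilp (E 0) := by
  induction a with
  | zero => exact fun v hv => pow_apply_mem_nilp hv 1
  | succ a iha =>
    have : ∀ k v, (E 0 ^ k) v = 0 → E (a + 1) v ∈ nilp (E 0) := by
      intro k
      induction k with
      | zero =>
        intro v hv
        have hv : v = 0 := hv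
        rw [hv, map_zero]
        exact Submodule.zero_mem _
      | succ k ihk =>
        intro v hv
        refine mem_nilp_of_apply ?_
        rw [h.zero_apply, Nat.add_sub_cancel]
        refine Submodule.add_mem _ (ihk _ ?_) (Submodule.smul_mem _ _ (iha v ⟨k + 1, hv⟩))
        rwa [pow_succ, Module.End.mul_apply] at hv
    rintro v ⟨k, hk⟩
    exact this k v hk

/-- Moving E_a to the right past one E_0 either brings out an E_0 on the left or lowers a, and the
latter can happen at most a times. So at most a of the p powers are lost. -/
theorem WittRel.apply_pow_mem (h : WittRel E) (a : ℕ) :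
    ∀ k p : ℕ, k + a ≤ p → ∀ u ∈ nilp (E 0), E a ((E 0 ^ p) u) ∈ (nilp (E 0)).map (E 0 ^ k) := by
  induction a with
  | zero =>
    intro k p hp u hu
    obtain ⟨d, rfl⟩ := Nat.exists_eq_add_of_le hp
    refine ⟨(E 0 ^ (d + 1)) u, pow_apply_mem_nilp hu _, ?_⟩
    rw [← Module.End.mul_apply, ← Module.End.mul_apply, ← pow_add, ← pow_succ']
    rfl
  | succ a iha =>
    intro k
    induction k with
    | zero =>
      intro p _ u hu
      exact ⟨_, h.apply_mem_nilp _ _ (pow_apply_mem_nilp hu p), rfl⟩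
    | succ k ihk =>
      intro p hp u hu
      obtain ⟨p, rfl⟩ : ∃ p', p = p' + 1 := ⟨p - 1, by omega⟩
      have e := h.zero_apply (a + 1) ((E 0 ^ p) u)
      rw [Nat.add_sub_cancel, ← Module.End.mul_apply (E 0) (E 0 ^ p), ← pow_succ'] at e
      rw [eq_sub_of_add_eq e.symm]
      refine Submodule.sub_mem _ ?_ (Submodule.smul_mem _ _ (iha (k + 1) p (by omega) u hu))
      obtain ⟨y, hy, hyu⟩ := ihk p (by omega) u hu
      exact ⟨y, hy, by rw [pow_succ', Module.End.mul_apply, hyu]⟩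

theorem WittRel.apply_mem_nilpCore (h : WittRel E) (a : ℕ) {v : M} (hv : v ∈ nilpCore (E 0)) :
    E a v ∈ nilpCore (E 0) := by
  rw [mem_nilpCore] at hv ⊢
  intro k
  obtain ⟨u, hu, rfl⟩ := hv (k + a)
  exact h.apply_pow_mem a k _ le_rfl u hu

end Nilpotent

/-! ### Removing the power of D, and the rank one result -/

section Core

variable {M : Type*} [AddCommGroup M] [Module ℂ M] {E : ℕ → Module.End ℂ M} {G : Type*}
  [AddCommGroup G] {Mw : G → Submodule ℂ M} {δ : G} {ℓ : G → ℂ}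

namespace WittWeights

theorem two_pow_mem (h : WittWeights E Mw δ ℓ) (k : ℕ) {w : G} {v : M} (hv : v ∈ Mw w) :
    (E 2 ^ k) v ∈ Mw (w + (k : ℤ) • δ) := by
  induction k with
  | zero => simpa using hv
  | succ k ih =>
    rw [pow_succ', Module.End.mul_apply]
    have := h.maps 2 _ _ ih
    convert this using 2
    push_cast
    module

/-- The usual relation in the sl_2 spanned by E_0, E_1, E_2. -/
theorem zero_two_pow (h : WittWeights E Mw δ ℓ) (k : ℕ) {w : G} {v : M} (hv : v ∈ Mw w) :
    E 0 ((E 2 ^ (k + 1)) v) = (E 2 ^ (k + 1)) (E 0 v) +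
      (((k : ℂ) + 1) * (2 * ℓ w + k)) • (E 2 ^ k) v := by
  induction k with
  | zero =>
    rw [zero_add, pow_one, h.rel.zero_apply]
    simp [h.one w v hv, smul_smul]
  | succ k ih =>
    have h1 := h.one _ _ (h.two_pow_mem (k + 1) hv)
    rw [h.ell] at h1
    rw [pow_succ' _ (k + 1), Module.End.mul_apply, h.rel.zero_apply, ih, map_add, map_smul,
      show 2 - 1 = 1 from rfl, h1, ← Module.End.mul_apply (E 2) (E 2 ^ k), ← pow_succ',
      Module.End.mul_apply]
    push_cast
    module

/-- Modulo the divisible part v is killed by E_0, so E_0^k E_2^k v is a multiple of v with factor a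
product of terms (i+1)(2ℓ+i). For Re ℓ > 0 this is nonzero, so v is divisible by E_0^k. -/
theorem mem_nilpCore_of_apply (h : WittWeights E Mw δ ℓ) {w : G} (hw : 0 < (ℓ w).re) {v : M}
    (hv : v ∈ Mw w) (hn : v ∈ nilp (E 0)) (h0 : E 0 v ∈ nilpCore (E 0)) : v ∈ nilpCore (E 0) := by
  have hpow : ∀ (F : Module.End ℂ M), (∀ x ∈ nilpCore (E 0), F x ∈ nilpCore (E 0)) →
      ∀ (k : ℕ), ∀ x ∈ nilpCore (E 0), (F ^ k) x ∈ nilpCore (E 0) := fun F hF k => by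
    induction k with
    | zero => exact fun x hx => hx
    | succ k ih =>
      intro x hx
      rw [pow_succ', Module.End.mul_apply]
      exact hF _ (ih x hx)
  have key : ∀ k : ℕ, ∃ c : ℂ, c ≠ 0 ∧ (E 0 ^ k) ((E 2 ^ k) v) - c • v ∈ nilpCore (E 0) := by
    intro k
    induction k with
    | zero => exact ⟨1, one_ne_zero, by simp⟩
    | succ k ih =>
      obtain ⟨c, hc, hk⟩ := ih
      refine ⟨(((k : ℂ) + 1) * (2 * ℓ w + k)) * c, mul_ne_zero (mul_ne_zero
        (Nat.cast_add_one_ne_zero k) fun h0 => ?_) hc, ?_⟩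
      · have := congrArg Complex.re h0
        simp at this
        have hk0 : (0 : ℝ) ≤ k := Nat.cast_nonneg k
        linarith
      · rw [pow_succ (E 0), Module.End.mul_apply, h.zero_two_pow k hv, map_add, map_smul,
          add_sub_assoc, mul_smul _ c, ← smul_sub]
        refine Submodule.add_mem _ (hpow _ (fun x hx => h.rel.apply_mem_nilpCore 0 hx) k _
          (hpow _ (fun x hx => h.rel.apply_mem_nilpCore 2 hx) _ _ h0)) (Submodule.smul_mem _ _ hk)
  rw [nilpCore, Submodule.mem_iInf]
  intro k
  obtain ⟨c, hc, hk⟩ := key k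
  rw [nilpCore, Submodule.mem_iInf] at hk
  have hn2 : (E 2 ^ k) v ∈ nilp (E 0) := by
    clear hk
    induction k with
    | zero => exact hn
    | succ k ih =>
      rw [pow_succ', Module.End.mul_apply]
      exact h.rel.apply_mem_nilp 2 _ ih
  have := Submodule.sub_mem _ (Submodule.mem_map_of_mem (f := E 0 ^ k) hn2) (hk k)
  rw [sub_sub_cancel] at this
  exact (Submodule.smul_mem_iff _ hc).mp this

theorem mem_nilpCore_of_pow_apply (h : WittWeights E Mw δ ℓ) {w : G} (hw : 0 < (ℓ w).re) (j : ℕ) :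
    ∀ v ∈ Mw (w + (j : ℤ) • δ), v ∈ nilp (E 0) → (E 0 ^ j) v ∈ nilpCore (E 0) →
      v ∈ nilpCore (E 0) := by
  induction j with
  | zero => exact fun v _ _ hv => hv
  | succ j ih =>
    intro v hv hn hj
    rw [pow_succ, Module.End.mul_apply] at hj
    refine h.mem_nilpCore_of_apply ?_ hv hn (ih _ ?_ (pow_apply_mem_nilp hn 1) hj)
    · rw [h.ell]
      simp
      positivity
    · have := h.maps 0 _ _ hv
      convert this using 2
      push_cast
      module

/-- Inside one fixed finite-dimensional weight space the images under E_0^k of nilpotent vectors of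
weight k steps higher decrease, hence stabilise, and the stable value is divisible.
`mem_nilpCore_of_pow_apply` lifts this back to the higher weights. -/
theorem eventually_mem_nilpCore (h : WittWeights E Mw δ ℓ)
    (hfin : ∀ w, FiniteDimensional ℂ (Mw w)) (w : G) :
    ∃ K : ℕ, ∀ k ≥ K, ∀ v ∈ Mw (w + (k : ℤ) • δ), v ∈ nilp (E 0) → v ∈ nilpCore (E 0) := by
  -- Shift the base point to where the real part of ℓ is positive, as the sl_2 argument requires.
  obtain ⟨p, hp⟩ := exists_nat_gt (-(ℓ w).re)
  let ν := w + (p : ℤ) • δ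
  have hν : 0 < (ℓ ν).re := by
    rw [h.ell]
    simp
    linarith
  let Y : ℕ → Submodule ℂ M := fun k => (nilp (E 0) ⊓ Mw (ν + (k : ℤ) • δ)).map (E 0 ^ k)
  have hYle : ∀ k, Y k ≤ Mw ν := by
    rintro k _ ⟨u, ⟨_, hu⟩, rfl⟩
    have := h.pow_mem k hu
    rwa [add_sub_cancel_right] at this
  have hYanti : Antitone Y := by
    refine antitone_nat_of_succ_le fun k => ?_
    rintro _ ⟨u, ⟨hu, hu'⟩, rfl⟩
    refine ⟨E 0 u, ⟨pow_apply_mem_nilp hu 1, ?_⟩, by rw [pow_succ, Module.End.mul_apply]⟩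
    have := h.maps 0 _ _ hu'
    rwa [show ν + ((k + 1 : ℕ) : ℤ) • δ + (((0 : ℕ) : ℤ) - 1) • δ = ν + (k : ℤ) • δ by
      push_cast
      module] at this
  have hYfin : ∀ k, FiniteDimensional ℂ (Y k) := fun k =>
    haveI := hfin ν
    Submodule.finiteDimensional_of_le (hYle k)
  let k₀ := Function.argmin fun k => Module.finrank ℂ (Y k)
  have hk₀ : ∀ k, Module.finrank ℂ (Y k₀) ≤ Module.finrank ℂ (Y k) := fun k =>
    Function.argmin_le (fun k => Module.finrank ℂ (Y k)) k
  have hYeq : ∀ k ≥ k₀, Y k = Y k₀ := fun k hk =>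
    haveI := hYfin k₀
    Submodule.eq_of_le_of_finrank_le (hYanti hk) (hk₀ k)
  have hYcore : Y k₀ ≤ nilpCore (E 0) := by
    refine le_iInf fun k => ?_
    have hmap : ∀ k, Y k ≤ (nilp (E 0)).map (E 0 ^ k) := fun k => Submodule.map_mono inf_le_left
    rcases le_total k k₀ with hk | hk
    · exact (hYanti hk).trans (hmap k)
    · exact (hYeq k hk).ge.trans (hmap k)
  refine ⟨p + k₀, fun k hk v hv hn => ?_⟩
  obtain ⟨j, rfl⟩ : ∃ j, k = p + j := ⟨k - p, by omega⟩
  have hv' : v ∈ Mw (ν + (j : ℤ) • δ) := by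
    convert hv using 2
    simp only [ν]
    push_cast
    module
  refine h.mem_nilpCore_of_pow_apply hν j v hv' hn (hYcore ?_)
  rw [← hYeq j (by omega)]
  exact ⟨v, ⟨hn, hv'⟩, rfl⟩

/-- For large a the vector E_a v has a weight where nilpotent vectors are divisible. The bracket of
E_0 and E_{a+1} is (a+1) E_a, so the property descends to small a. -/
theorem apply_mem_nilpCore_of_mem (h : WittWeights E Mw δ ℓ)
    (hfin : ∀ w, FiniteDimensional ℂ (Mw w)) {w : G} {v : M} (hv : v ∈ Mw w)
    (hn : v ∈ nilp (E 0)) (a : ℕ) : E a v ∈ nilpCore (E 0) := by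
  obtain ⟨K, hK⟩ := h.eventually_mem_nilpCore hfin w
  obtain ⟨n, hn0⟩ := mem_nilp.mp hn
  -- All E_0^i v are treated together, since the descent at v involves E_0 v; only i ≤ n matter, as
  -- E_0^n v = 0.
  have hlarge : ∀ a ≥ K + n + 1, ∀ i, E a ((E 0 ^ i) v) ∈ nilpCore (E 0) := by
    intro a ha i
    rcases Nat.lt_or_ge n i with hi | hi
    · obtain ⟨d, rfl⟩ := Nat.exists_eq_add_of_le hi.le
      rw [add_comm, pow_add, Module.End.mul_apply, hn0, map_zero, map_zero]
      exact Submodule.zero_mem _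
    · refine hK (a - 1 - i) (by omega) _ ?_ (h.rel.apply_mem_nilp a _ (pow_apply_mem_nilp hn i))
      have := h.maps a _ _ (h.pow_mem i hv)
      rwa [show w - (i : ℤ) • δ + ((a : ℤ) - 1) • δ = w + ((a - 1 - i : ℕ) : ℤ) • δ by
        rw [show ((a - 1 - i : ℕ) : ℤ) = (a : ℤ) - 1 - i by omega]
        module] at this
  have hdown : ∀ b a, K + n + 1 ≤ a + b → ∀ i, E a ((E 0 ^ i) v) ∈ nilpCore (E 0) := by
    intro b
    induction b with
    | zero => exact hlarge
    | succ b ih =>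
      intro a ha i
      have h1 := ih (a + 1) (by omega) i
      have h2 := ih (a + 1) (by omega) (i + 1)
      have e := h.rel.zero_apply (a + 1) ((E 0 ^ i) v)
      rw [← Module.End.mul_apply (E 0) (E 0 ^ i), ← pow_succ', Nat.add_sub_cancel] at e
      have h3 := Submodule.sub_mem _ (h.rel.apply_mem_nilpCore 0 h1) h2
      rw [e, add_sub_cancel_left] at h3
      exact (Submodule.smul_mem_iff _ (Nat.cast_ne_zero.mpr (Nat.succ_ne_zero a))).mp h3
  exact hdown (K + n + 1) a (by omega) 0

/-- E_0^k translates all weights by the same amount, so it kills a vector only if it kills each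
weight component. -/
theorem nilp_le (h : WittWeights E Mw δ ℓ) (htop : ⨆ w, Mw w = ⊤) (hind : iSupIndep Mw) :
    nilp (E 0) ≤ ⨆ w, nilp (E 0) ⊓ Mw w := by
  classical
  rintro v ⟨k, hk⟩
  have hv : v ∈ ⨆ w, Mw w := htop ▸ trivial
  obtain ⟨f, hf, rfl⟩ := (Submodule.mem_iSup_iff_exists_finsupp _ _).mp hv
  have hind' : iSupIndep fun w => Mw (w - (k : ℤ) • δ) :=
    hind.comp (f := fun w => w - (k : ℤ) • δ) (sub_left_injective)
  rw [Finsupp.sum, map_sum] at hk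
  have h0 := (iSupIndep_iff_finsetSum_eq_zero_imp_eq_zero _).mp hind' f.support
    (fun w => (E 0 ^ k) (f w)) (fun w _ => h.pow_mem k (hf w)) hk
  exact Submodule.sum_mem _ fun w hw => Submodule.mem_iSup_of_mem w ⟨⟨k, h0 w hw⟩, hf w⟩

theorem apply_mem_nilpCore (h : WittWeights E Mw δ ℓ) (htop : ⨆ w, Mw w = ⊤)
    (hind : iSupIndep Mw) (hfin : ∀ w, FiniteDimensional ℂ (Mw w)) {v : M}
    (hv : v ∈ nilp (E 0)) (a : ℕ) : E a v ∈ nilpCore (E 0) := by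
  have : ⨆ w, nilp (E 0) ⊓ Mw w ≤ (nilpCore (E 0)).comap (E a) :=
    iSup_le fun w v hv => h.apply_mem_nilpCore_of_mem hfin hv.2 hv.1 a
  exact this (h.nilp_le htop hind hv)

end WittWeights

theorem word₂_mem_of_stable {S : Submodule ℂ M} {T : Submodule ℂ M} (f : ℕ → Module.End ℂ M)
    (h : ∀ a b, ∀ v ∈ S, f a (f b v) ∈ T) (q : MvPolynomial (Fin 2) ℂ) {v : M} (hv : v ∈ S) :
    word₂ f f q v ∈ T := by
  have := mem_of_prod₂ (S := T.comap ((LinearMap.applyₗ v) ∘ₗ word₂ f f)) (fun a b => by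
    rw [Submodule.mem_comap, LinearMap.comp_apply, LinearMap.applyₗ_apply_apply, word₂_apply]
    exact h a b v hv) q
  exact this

/-- Words in the ideal of a power of `x - y` inherit mapping properties from that power. -/
theorem WittRel.diagSpan_maps (h : WittRel E) {S T : Submodule ℂ M}
    (hS : ∀ a, ∀ v ∈ S, E a v ∈ S) (hT : ∀ a, ∀ v ∈ T, E a v ∈ T) {r : ℕ}
    (hr : ∀ v ∈ S, word₂ E E ((X 0 - X 1) ^ (2 * r + 4)) v ∈ T) {f : Module.End ℂ M}
    (hf : f ∈ diagSpan E E (2 * r + 4)) {v : M} (hv : v ∈ S) : f v ∈ T := by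
  obtain ⟨q, rfl⟩ := hf
  rw [LinearMap.comp_apply, LinearMap.mulLeft_apply]
  let P : Submodule ℂ (Module.End ℂ M) :=
    { carrier := {f | ∀ v ∈ S, f v ∈ T}
      zero_mem' := fun _ _ => Submodule.zero_mem _
      add_mem' := fun hf hg v hv => Submodule.add_mem _ (hf v hv) (hg v hv)
      smul_mem' := fun c _ hf v hv => Submodule.smul_mem _ c (hf v hv) }
  have hcomm : ∀ a f, f ∈ P → E a * f - f * E a ∈ P := fun a f hf v hv =>
    Submodule.sub_mem _ (hT a _ (hf v hv)) (hf _ (hS a v hv))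
  have key := mem_of_lie_closed (S := P.comap (word₂ E E)) (r := r)
    (fun s k => by
      rw [Submodule.mem_comap, word₂_odd h]
      exact Submodule.zero_mem _)
    (fun p hp => by
      rw [Submodule.mem_comap, LinearMap.add_apply, ← comm_word₂ h]
      exact hcomm 2 _ hp)
    (fun p hp => by
      rw [Submodule.mem_comap, LinearMap.add_apply, ← comm_word₂ h]
      exact hcomm 3 _ hp) hr q
  exact key v hv

/-- Words in the ideal map M to nilpotent vectors, these to divisible ones, and these to zero, so
threefold products vanish. Two uses of `diagSpan_le_mul` write exponent 4^{N+3} in terms of fourfold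
products at exponent 4^{N+1}. -/
theorem WittWeights.diagSpan_eq_bot (h : WittWeights E Mw δ ℓ) (htop : ⨆ w, Mw w = ⊤)
    (hind : iSupIndep Mw) {N : ℕ} (hfin : ∀ w, FiniteDimensional ℂ (Mw w))
    (hN : ∀ w, Module.finrank ℂ (Mw w) ≤ N) : diagSpan E E (4 ^ (N + 3)) = ⊥ := by
  obtain ⟨n, hn⟩ := h.exists_word₂_mul_pow htop hfin hN
  obtain ⟨r, hr⟩ : ∃ r, 4 ^ (N + 1) = 2 * r + 4 := by
    refine ⟨2 * 4 ^ N - 2, ?_⟩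
    have := Nat.one_le_pow N 4 (by norm_num)
    rw [pow_succ]
    omega
  rw [hr] at hn
  have hcomm : Commute (E 0 ^ n) (word₂ E E ((X 0 - X 1) ^ (2 * r + 4))) :=
    Commute.pow_left (IsChain.comm_zero_word₂ h.rel _) n
  have hstab := fun a v hv => h.rel.apply_mem_nilp a v hv
  have hstab' : ∀ a, ∀ v ∈ nilpCore (E 0), E a v ∈ nilpCore (E 0) :=
    fun a v hv => h.rel.apply_mem_nilpCore a hv
  have h1 : ∀ f ∈ diagSpan E E (2 * r + 4), ∀ v, f v ∈ nilp (E 0) := fun f hf v =>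
    h.rel.diagSpan_maps (S := ⊤) (fun _ _ _ => trivial) hstab (fun v _ => ⟨n, by
      rw [← Module.End.mul_apply, hcomm.eq, hn, LinearMap.zero_apply]⟩) hf trivial
  have h2 : ∀ f ∈ diagSpan E E (2 * r + 4), ∀ v ∈ nilp (E 0), f v ∈ nilpCore (E 0) := by
    -- Nothing about the polynomial is needed in the middle layer: a single letter already maps into
    -- the divisible part.
    rintro _ ⟨q, rfl⟩ v hv
    exact word₂_mem_of_stable E (fun a b v hv => hstab' a _
      (h.apply_mem_nilpCore htop hind hfin hv b)) _ hv
  have h3 : ∀ f ∈ diagSpan E E (2 * r + 4), ∀ v ∈ nilpCore (E 0), f v = 0 := fun f hf v hv => by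
    have := h.rel.diagSpan_maps (T := ⊥) hstab' (fun a v hv => by
      rw [(Submodule.mem_bot ℂ).mp hv, map_zero]
      exact Submodule.zero_mem _) (fun v hv => by
        obtain ⟨u, _, rfl⟩ := mem_nilpCore.mp hv n
        rw [← Module.End.mul_apply, hn, LinearMap.zero_apply]
        exact Submodule.zero_mem _) hf hv
    exact (Submodule.mem_bot ℂ).mp this
  have hA : diagSpan E E (2 * r + 4) * diagSpan E E (2 * r + 4) *
      (diagSpan E E (2 * r + 4) * diagSpan E E (2 * r + 4)) ≤ ⊥ := by
    have hz : diagSpan E E (2 * r + 4) * (diagSpan E E (2 * r + 4) * diagSpan E E (2 * r + 4)) ≤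
        ⊥ := by
      rw [Submodule.mul_le]
      intro f hf g hg
      rw [Submodule.mem_bot]
      have : diagSpan E E (2 * r + 4) * diagSpan E E (2 * r + 4) ≤
          LinearMap.ker (LinearMap.mulLeft ℂ f) := by
        rw [Submodule.mul_le]
        intro a ha b hb
        rw [LinearMap.mem_ker, LinearMap.mulLeft_apply]
        ext v
        exact h3 f hf _ (h2 a ha _ (h1 b hb v))
      exact this hg
    rw [mul_assoc, le_bot_iff.mp hz, Submodule.mul_bot]
  have hle : diagSpan E E (4 ^ (N + 3)) ≤ diagSpan E E (2 * r + 4) * diagSpan E E (2 * r + 4) *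
      (diagSpan E E (2 * r + 4) * diagSpan E E (2 * r + 4)) := by
    have s1 := diagSpan_le_mul h.rel (2 * r + 2)
    have s2 := diagSpan_le_mul h.rel (4 * (2 * r + 4) - 2)
    rw [show 4 * (2 * r + 4) - 2 + 2 = 4 * (2 * r + 4) by omega] at s2
    rw [show 4 ^ (N + 3) = 4 * (4 * (2 * r + 4)) by rw [← hr]; ring]
    exact s2.trans (mul_le_mul' s1 s1)
  exact le_bot_iff.mp (hle.trans hA)

end Core

theorem sub_smul_eq_add_neg_smul {V : Type*} [AddCommGroup V] [Module ℂ V] (z : ℂ) (x y : V) :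
    x - z • y = x + -z • y := by
  rw [neg_smul, sub_eq_add_neg]

/-! ### Superbrackets of vector fields a ∂ -/

section Fields

variable {m n : ℕ}

theorem APart_sup_eq_top (m n : ℕ) : APart m n 0 ⊔ APart m n 1 = ⊤ := by
  refine eq_top_iff.mpr fun a _ => ?_
  induction a using TensorProduct.induction_on with
  | zero => exact Submodule.zero_mem _
  | add a b ha hb => exact Submodule.add_mem _ (ha trivial) (hb trivial)
  | tmul f x =>
    have hx : x ∈ extPart n 0 ⊔ extPart n 1 := by
      have := (CliffordAlgebra.evenOdd_isCompl (0 : QuadraticForm ℂ (Fin n → ℂ))).sup_eq_top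
      exact this.ge trivial
    obtain ⟨y, hy, z, hz, rfl⟩ := Submodule.mem_sup.mp hx
    rw [TensorProduct.tmul_add]
    exact Submodule.add_mem _ (Submodule.mem_sup_left (tmul_mem f hy))
      (Submodule.mem_sup_right (tmul_mem f hz))

theorem mulLeft_comp_mem_W (s : Fin m ⊕ Fin n) (a : A m n) :
    LinearMap.mulLeft ℂ a ∘ₗ partialD m n s ∈ W m n := by
  have ha : a ∈ APart m n 0 ⊔ APart m n 1 := APart_sup_eq_top m n ▸ trivial
  obtain ⟨y, hy, z, hz, rfl⟩ := Submodule.mem_sup.mp ha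
  have e : LinearMap.mulLeft ℂ (y + z) ∘ₗ partialD m n s = LinearMap.mulLeft ℂ y ∘ₗ
      partialD m n s + LinearMap.mulLeft ℂ z ∘ₗ partialD m n s := by
    refine LinearMap.ext fun c => ?_
    simp only [LinearMap.comp_apply, LinearMap.add_apply, LinearMap.mulLeft_apply, add_mul]
  rw [e]
  exact Submodule.add_mem _ (WPart_le_W _ (mulLeft_mem hy (partialD_mem s)))
    (WPart_le_W _ (mulLeft_mem hz (partialD_mem s)))

/-- The vector field `a ∂`. -/
def field (s : Fin m ⊕ Fin n) : A m n →ₗ[ℂ] W m n where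
  toFun a := ⟨LinearMap.mulLeft ℂ a ∘ₗ partialD m n s, mulLeft_comp_mem_W s a⟩
  map_add' a b := by
    refine Subtype.ext (LinearMap.ext fun c => ?_)
    simp [add_mul]
  map_smul' z a := by
    refine Subtype.ext (LinearMap.ext fun c => ?_)
    simp [smul_mul_assoc]

theorem field_apply (s : Fin m ⊕ Fin n) (a c : A m n) :
    (field s a : Module.End ℂ (A m n)) c = a * partialD m n s c :=
  rfl

theorem field_mem {p : ZMod 2} {a : A m n} (ha : a ∈ APart m n p) (s : Fin m ⊕ Fin n) :
    (field s a : Module.End ℂ (A m n)) ∈ WPart m n (p + parD s) :=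
  mulLeft_mem ha (partialD_mem s)

theorem partialD_inl_tmul (i : Fin m) (f : MvPolynomial (Fin m) ℂ) (x : Ext n) :
    partialD m n (Sum.inl i) (f ⊗ₜ x) = MvPolynomial.pderiv i f ⊗ₜ x :=
  rfl

theorem partialD_inr_tmul (i : Fin n) (f : MvPolynomial (Fin m) ℂ) (x : Ext n) :
    partialD m n (Sum.inr i) (f ⊗ₜ x) = f ⊗ₜ CliffordAlgebra.contractLeft
      (LinearMap.proj i : Module.Dual ℂ (Fin n → ℂ)) x :=
  rfl

theorem pderiv_pderiv_comm (i k : Fin m) (f : MvPolynomial (Fin m) ℂ) :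
    MvPolynomial.pderiv k (MvPolynomial.pderiv i f) =
      MvPolynomial.pderiv i (MvPolynomial.pderiv k f) := by
  have h : ⁅MvPolynomial.pderiv (R := ℂ) k, MvPolynomial.pderiv i⁆ = 0 :=
    MvPolynomial.derivation_ext fun l => by
      rw [Derivation.commutator_apply, MvPolynomial.pderiv_X, MvPolynomial.pderiv_X]
      rw [Pi.single_apply, Pi.single_apply]
      split_ifs <;> simp
  have := Derivation.congr_fun h f
  rw [Derivation.commutator_apply, Derivation.zero_apply, sub_eq_zero] at this
  exact this

theorem partialD_comm (s s' : Fin m ⊕ Fin n) (a : A m n) : partialD m n s' (partialD m n s a) =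
    sgn (parD s) (parD s') • partialD m n s (partialD m n s' a) := by
  induction a using TensorProduct.induction_on with
  | zero => simp
  | add a b ha hb => simp only [map_add, ha, hb, smul_add]
  | tmul f x =>
    rcases s with i | i <;> rcases s' with k | k
    · rw [partialD_inl_tmul, partialD_inl_tmul, partialD_inl_tmul, partialD_inl_tmul,
        pderiv_pderiv_comm, parD, sgn_zero_left, one_smul]
    · rw [partialD_inl_tmul, partialD_inr_tmul, partialD_inr_tmul, partialD_inl_tmul,
        parD, sgn_zero_left, one_smul]
    · rw [partialD_inl_tmul, partialD_inr_tmul, partialD_inr_tmul, partialD_inl_tmul,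
        sgn_comm, parD, sgn_zero_left, one_smul]
    · rw [partialD_inr_tmul, partialD_inr_tmul, partialD_inr_tmul, partialD_inr_tmul,
        CliffordAlgebra.contractLeft_comm, TensorProduct.tmul_neg, parD, parD, sgn_one_one]
      exact (neg_one_smul ℂ _).symm

theorem partialD_mul (s : Fin m ⊕ Fin n) {q : ZMod 2} {b : A m n} (hb : b ∈ APart m n q)
    (c : A m n) : partialD m n s (b * c) =
      partialD m n s b * c + sgn (parD s) q • (b * partialD m n s c) :=
  (partialD_mem s).2 q b hb c

/-- The second-order terms cancel because both coefficients and both partial derivatives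
supercommute; only first-order terms remain. -/
theorem bracket_field {p q : ZMod 2} {a b : A m n} (ha : a ∈ APart m n p) (hb : b ∈ APart m n q)
    (s s' : Fin m ⊕ Fin n) :
    bracket (p + parD s) (q + parD s') (field s a : Module.End ℂ (A m n)) (field s' b) =
      (field s' (a * partialD m n s b) : Module.End ℂ (A m n)) - sgn (p + parD s) (q + parD s') •
        (field s (b * partialD m n s' a) : Module.End ℂ (A m n)) := by
  refine LinearMap.ext fun c => ?_
  simp only [bracket, LinearMap.sub_apply, LinearMap.smul_apply, Module.End.mul_apply, field_apply]
  rw [partialD_mul s hb, partialD_mul s' ha, partialD_comm s s' c]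
  simp only [mul_add, mul_smul_comm, ← mul_assoc]
  rw [APart_comm hb ha]
  have h1 := sgn_mul_self p q
  have h2 := sgn_mul_self p (parD s')
  have h3 := sgn_mul_self (parD s) (parD s')
  simp only [smul_mul_assoc, sgn_add_left, sgn_add_right]
  rw [sgn_comm q p, sgn_comm (parD s') p]
  have e : sgn p q * sgn p (parD s') * (sgn (parD s) q * sgn (parD s) (parD s')) *
      (sgn p (parD s') * (sgn (parD s) (parD s') * sgn p q)) = sgn (parD s) q := by
    linear_combination sgn (parD s) q * (sgn p (parD s') * sgn p (parD s')) *
      (sgn (parD s) (parD s') * sgn (parD s) (parD s')) * h1 + sgn (parD s) q *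
      (sgn (parD s) (parD s') * sgn (parD s) (parD s')) * h2 + sgn (parD s) q * h3
  generalize a * b * partialD m n s (partialD m n s' c) = z
  generalize a * partialD m n s b * partialD m n s' c = z1
  match_scalars <;> first | ring1 | linear_combination e | linear_combination -e

/-- The even variable `t_j` as an element of `A_{m,n}`. -/
def tvar (n : ℕ) (j : Fin m) : A m n := MvPolynomial.X j ⊗ₜ 1

theorem tvar_pow (j : Fin m) (k : ℕ) : tvar n j ^ k = (MvPolynomial.X j ^ k) ⊗ₜ 1 := by
  rw [tvar, Algebra.TensorProduct.tmul_pow, one_pow]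

theorem tvar_pow_mem (j : Fin m) (k : ℕ) : tvar n j ^ k ∈ APart m n 0 := by
  rw [tvar_pow]
  exact tmul_mem _ (one_mem_extPart n)

theorem one_mem_APart : (1 : A m n) ∈ APart m n 0 :=
  tmul_mem _ (one_mem_extPart n)

theorem tvar_pow_comm (j : Fin m) (k : ℕ) (a : A m n) : tvar n j ^ k * a = a * tvar n j ^ k := by
  have h : Commute (tvar n j) a := by
    induction a using TensorProduct.induction_on with
    | zero => exact Commute.zero_right _
    | add a b ha hb => exact ha.add_right hb
    | tmul f x =>
      change _ * _ = _ * _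
      rw [tvar, Algebra.TensorProduct.tmul_mul_tmul, Algebra.TensorProduct.tmul_mul_tmul, one_mul,
        mul_one, mul_comm]
  exact h.pow_left k

theorem mul_tvar_pow_mul (j : Fin m) (c k : ℕ) (a b : A m n) :
    tvar n j ^ c * a * (tvar n j ^ k * b) = tvar n j ^ (k + c) * (a * b) := by
  rw [mul_assoc, ← mul_assoc a, ← tvar_pow_comm, mul_assoc, ← mul_assoc, ← pow_add, add_comm]

theorem tvar_pow_mul_mem (j : Fin m) (k : ℕ) {p : ZMod 2} {a : A m n} (ha : a ∈ APart m n p) :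
    tvar n j ^ k * a ∈ APart m n p := by
  have := mul_mem_APart (tvar_pow_mem (n := n) j k) ha
  rwa [zero_add] at this

theorem partialD_tvar_pow_mul_of_ne {j : Fin m} {s : Fin m ⊕ Fin n} (hs : s ≠ Sum.inl j) (k : ℕ)
    (a : A m n) : partialD m n s (tvar n j ^ k * a) = tvar n j ^ k * partialD m n s a := by
  have h : partialD m n s (tvar n j ^ k) = 0 := by
    rw [tvar_pow]
    rcases s with i | i
    · rw [partialD_inl_tmul, Derivation.leibniz_pow, MvPolynomial.pderiv_X_of_ne, smul_zero,
        smul_zero, TensorProduct.zero_tmul]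
      rintro rfl
      exact hs rfl
    · rw [partialD_inr_tmul, CliffordAlgebra.contractLeft_one, TensorProduct.tmul_zero]
  rw [partialD_mul s (tvar_pow_mem j k), h, zero_mul, zero_add, sgn_comm, sgn_zero_left, one_smul]

theorem partialD_tvar_pow_mul (j : Fin m) (k : ℕ) {a : A m n}
    (ha : partialD m n (Sum.inl j) a = 0) : partialD m n (Sum.inl j) (tvar n j ^ k * a) =
      (k : ℂ) • (tvar n j ^ (k - 1) * a) := by
  have h : partialD m n (Sum.inl j) (tvar n j ^ k) = (k : ℂ) • tvar n j ^ (k - 1) := by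
    rw [tvar_pow, tvar_pow, partialD_inl_tmul, Derivation.leibniz_pow, MvPolynomial.pderiv_X_self,
      smul_eq_mul, mul_one, TensorProduct.smul_tmul', Nat.cast_smul_eq_nsmul]
  rw [partialD_mul _ (tvar_pow_mem j k), h, ha, mul_zero, smul_zero, add_zero, smul_mul_assoc]

theorem partialD_one (s : Fin m ⊕ Fin n) : partialD m n s 1 = 0 := by
  rw [Algebra.TensorProduct.one_def]
  rcases s with i | i
  · rw [partialD_inl_tmul, Derivation.map_one_eq_zero, TensorProduct.zero_tmul]
  · rw [partialD_inr_tmul, CliffordAlgebra.contractLeft_one, TensorProduct.tmul_zero]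

theorem partialD_mul_eq_zero {j : Fin m} {a b : A m n} (ha : partialD m n (Sum.inl j) a = 0)
    (hb : partialD m n (Sum.inl j) b = 0) {p : ZMod 2} (hp : a ∈ APart m n p) :
    partialD m n (Sum.inl j) (a * b) = 0 := by
  rw [partialD_mul _ hp, ha, hb, zero_mul, mul_zero, smul_zero, add_zero]

theorem partialD_partialD_eq_zero {j : Fin m} {a : A m n} (ha : partialD m n (Sum.inl j) a = 0)
    (s : Fin m ⊕ Fin n) : partialD m n (Sum.inl j) (partialD m n s a) = 0 := by
  rw [partialD_comm, ha, map_zero, smul_zero]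

end Fields

/-! ### The families t_j^k a ∂ acting on M -/

namespace WModule

variable {m n : ℕ} {M : Type*} [AddCommGroup M] [Module ℂ M] (ρ : WModule m n M)

/-- The operators on `M` given by the vector fields `t_j^k a ∂`, `k ≥ 0`. -/
def fam (j : Fin m) (s : Fin m ⊕ Fin n) (a : A m n) (k : ℕ) : Module.End ℂ M :=
  ρ.act (field s (tvar n j ^ k * a))

theorem act_field_bracket {p q : ZMod 2} {a b : A m n} (ha : a ∈ APart m n p)
    (hb : b ∈ APart m n q) (s s' : Fin m ⊕ Fin n) :
    ρ.act (field s a) * ρ.act (field s' b) - sgn (p + parD s) (q + parD s') •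
      (ρ.act (field s' b) * ρ.act (field s a)) =
    ρ.act (field s' (a * partialD m n s b)) - sgn (p + parD s) (q + parD s') •
      ρ.act (field s (b * partialD m n s' a)) := by
  have h := ρ.act_bracket _ _ _ _ (field_mem ha s) (field_mem hb s')
  rw [sub_smul_eq_add_neg_smul _ (ρ.act (field s' _)), ← map_smul, ← map_add]
  refine h.symm.trans (congrArg ρ.act (Subtype.ext ?_))
  refine (bracket_field ha hb s s').trans ?_
  exact sub_smul_eq_add_neg_smul (V := Module.End ℂ (A m n)) _ _ _

variable {j : Fin m} {p q : ZMod 2} {a b h : A m n}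

theorem fam_bracket_self (ha : a ∈ APart m n p) (hb : b ∈ APart m n q)
    (ha' : partialD m n (Sum.inl j) a = 0) (hb' : partialD m n (Sum.inl j) b = 0) (c k : ℕ) :
    ρ.fam j (Sum.inl j) a c * ρ.fam j (Sum.inl j) b k -
      sgn p q • (ρ.fam j (Sum.inl j) b k * ρ.fam j (Sum.inl j) a c) =
    ((k : ℂ) - c) • ρ.fam j (Sum.inl j) (a * b) (k + c - 1) := by
  have e := ρ.act_field_bracket (tvar_pow_mul_mem j c ha) (tvar_pow_mul_mem j k hb) (Sum.inl j)
    (Sum.inl j)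
  simp only [parD, add_zero] at e
  refine e.trans ?_
  rw [partialD_tvar_pow_mul j k hb', partialD_tvar_pow_mul j c ha', mul_smul_comm, mul_smul_comm,
    mul_tvar_pow_mul, mul_tvar_pow_mul, APart_comm ha hb, sub_smul]
  simp only [map_smul, fam, mul_smul_comm]
  congr 1
  · rcases k with _ | k
    · simp
    · rw [show k + 1 + c - 1 = k + 1 - 1 + c by omega]
  · rw [smul_comm]
    rcases c with _ | c
    · simp
    · rw [show k + (c + 1) - 1 = c + 1 - 1 + k by omega]

/-- The index c + 1 avoids truncated subtraction when t_j^{c+1} is differentiated and keeps the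
factor c + 1 nonzero. -/
theorem fam_bracket_self_right {s : Fin m ⊕ Fin n} (hs : s ≠ Sum.inl j) (hh : h ∈ APart m n p)
    (hb : b ∈ APart m n q) (hh' : partialD m n (Sum.inl j) h = 0) (c k : ℕ) :
    ρ.fam j s h (c + 1) * ρ.fam j (Sum.inl j) b k -
      sgn (p + parD s) q • (ρ.fam j (Sum.inl j) b k * ρ.fam j s h (c + 1)) =
    ρ.fam j (Sum.inl j) (h * partialD m n s b) (k + (c + 1)) -
      (sgn (p + parD s) q * ((c : ℂ) + 1)) • ρ.fam j s (b * h) (k + c) := by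
  have e := ρ.act_field_bracket (tvar_pow_mul_mem j (c + 1) hh) (tvar_pow_mul_mem j k hb) s
    (Sum.inl j)
  rw [show q + parD (Sum.inl j : Fin m ⊕ Fin n) = q from add_zero q] at e
  refine e.trans ?_
  rw [partialD_tvar_pow_mul_of_ne hs, partialD_tvar_pow_mul j _ hh', mul_smul_comm,
    mul_tvar_pow_mul, mul_tvar_pow_mul, map_smul, map_smul, smul_smul, Nat.add_sub_cancel,
    add_comm c k, Nat.cast_add_one]
  rfl

theorem fam_bracket_of_ne {s s' : Fin m ⊕ Fin n} (hs : s ≠ Sum.inl j) (hs' : s' ≠ Sum.inl j)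
    (ha : a ∈ APart m n p) (hb : b ∈ APart m n q) (c k : ℕ) :
    ρ.fam j s a c * ρ.fam j s' b k -
      sgn (p + parD s) (q + parD s') • (ρ.fam j s' b k * ρ.fam j s a c) =
    ρ.fam j s' (a * partialD m n s b) (k + c) -
      sgn (p + parD s) (q + parD s') • ρ.fam j s (b * partialD m n s' a) (k + c) := by
  have e := ρ.act_field_bracket (tvar_pow_mul_mem j c ha) (tvar_pow_mul_mem j k hb) s s'
  refine e.trans ?_
  rw [partialD_tvar_pow_mul_of_ne hs, partialD_tvar_pow_mul_of_ne hs', mul_tvar_pow_mul,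
    mul_tvar_pow_mul, add_comm c k]
  rfl

end WModule

/-! ### Passing diagonal vanishing from one pair of families to another -/

section Diagonal

variable {R : Type*} [Ring R] [Algebra ℂ R]

/-- The generating form `f(x) g(y)` is annihilated by `(x - y)^r`. -/
def KillsDiag (f g : ℕ → R) (r : ℕ) : Prop :=
  ∀ q, word₂ f g ((X 0 - X 1) ^ r * q) = 0

variable {f g E A B C D F G H K : ℕ → R} {r : ℕ}

theorem killsDiag_of_diagSpan_eq_bot (h : diagSpan f g r = ⊥) : KillsDiag f g r := fun q =>
  (Submodule.eq_bot_iff _).mp h _ (word₂_mem_diagSpan f g r q)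

theorem KillsDiag.mono (h : KillsDiag f g r) {r' : ℕ} (hr : r ≤ r') : KillsDiag f g r' :=
  fun q => by
    obtain ⟨k, rfl⟩ := Nat.exists_eq_add_of_le hr
    rw [pow_add, mul_assoc]
    exact h _

theorem KillsDiag.mul_left (h : KillsDiag f g r) (p q : MvPolynomial (Fin 2) ℂ) :
    word₂ f g (p * ((X 0 - X 1) ^ r * q)) = 0 := by
  rw [mul_left_comm]
  exact h _

theorem pderiv_zero_diag (r : ℕ) (q : MvPolynomial (Fin 2) ℂ) :
    pderiv 0 ((X 0 - X 1) ^ (r + 1) * q) =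
      (X 0 - X 1) ^ r * ((r + 1 : MvPolynomial (Fin 2) ℂ) * q + (X 0 - X 1) * pderiv 0 q) := by
  rw [Derivation.leibniz, Derivation.leibniz_pow, map_sub, pderiv_X_self,
    pderiv_X_of_ne (by decide : (1 : Fin 2) ≠ 0)]
  simp only [smul_eq_mul, nsmul_eq_mul, Nat.add_sub_cancel]
  push_cast
  ring

theorem KillsDiag.lieX (h : KillsDiag f g r) (c : ℕ) (q : MvPolynomial (Fin 2) ℂ) :
    word₂ f g (lieX c ((X 0 - X 1) ^ (r + 1) * q)) = 0 := by
  rw [lieX_apply, pderiv_zero_diag, map_sub, map_smul, h.mul_left,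
    (h.mono r.le_succ).mul_left, smul_zero, sub_zero]

/-- Commuting with A_c turns vanishing E E words into a relation between A E and E A words. A
combination over several c and multipliers eliminates the E A part, at the cost of two powers of X 0
- X 1. -/
theorem KillsDiag.of_bracket_left (hE : KillsDiag E E r) (hA : ∀ c k, A c * E k -
    (1 : ℂ) • (E k * A c) = ((k : ℂ) - c) • A (k + c - 1)) : KillsDiag A E (r + 2) := by
  intro q
  have hw : ∀ c p, word₂ A E (WittSuper.lieX c (p * ((X 0 - X 1) ^ r * q))) +
      word₂ E A (lieY c (p * ((X 0 - X 1) ^ r * q))) = 0 := fun c p => by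
    have h := mul_word₂ (A c) (hA c) (hA c) (p * ((X 0 - X 1) ^ r * q))
    rw [hE.mul_left, mul_zero, zero_mul, smul_zero, sub_zero, one_smul, word₂_lieX,
      word₂_lieY] at h
    exact h.symm
  rw [pow_add, mul_comm (_ ^ r), mul_assoc]
  generalize (X 0 - X 1 : MvPolynomial (Fin 2) ℂ) ^ r * q = P at hw ⊢
  -- The multipliers are chosen so that all derivatives of P cancel and the same combination for
  -- `lieY`, in `eY`, is identically zero.
  have eX : WittSuper.lieX 2 (X 0 * P) + WittSuper.lieX 0 (X 1 ^ 2 * X 0 * P) -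
      (2 : ℂ) • WittSuper.lieX 1 (X 1 * X 0 * P) - WittSuper.lieX 3 (1 * P) -
      WittSuper.lieX 1 (X 1 ^ 2 * P) + (2 : ℂ) • WittSuper.lieX 2 (X 1 * P) =
      (2 : ℂ) • ((X 0 - X 1) ^ 2 * P) := by
    simp only [lieX_apply, Derivation.leibniz, Derivation.leibniz_pow, pderiv_X_self,
      pderiv_X_of_ne (by decide : (1 : Fin 2) ≠ 0), smul_eq_mul, nsmul_eq_mul, smul_eq_C_mul,
      map_natCast, map_ofNat, Derivation.map_one_eq_zero]
    push_cast
    ring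
  have eY : lieY 2 (X 0 * P) + lieY 0 (X 1 ^ 2 * X 0 * P) -
      (2 : ℂ) • lieY 1 (X 1 * X 0 * P) - lieY 3 (1 * P) -
      lieY 1 (X 1 ^ 2 * P) + (2 : ℂ) • lieY 2 (X 1 * P) = 0 := by
    simp only [lieY_apply, Derivation.leibniz, Derivation.leibniz_pow, pderiv_X_self,
      pderiv_X_of_ne (by decide : (0 : Fin 2) ≠ 1), smul_eq_mul, nsmul_eq_mul, smul_eq_C_mul,
      map_natCast, map_ofNat, Derivation.map_one_eq_zero]
    push_cast
    ring
  have eX := congrArg (word₂ A E) eX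
  have eY := congrArg (word₂ E A) eY
  simp only [map_add, map_sub, map_smul, map_zero] at eX eY
  have e : (2 : ℂ) • word₂ A E ((X 0 - X 1) ^ 2 * P) = 0 := by
    have hw' := fun c p => eq_neg_of_add_eq_zero_left (hw c p)
    rw [← eX, ← neg_eq_zero, hw', hw', hw', hw', hw', hw']
    refine Eq.trans ?_ eY
    module
  exact (smul_eq_zero.mp e).resolve_left two_ne_zero

/-- Supercommuting B_c with A E words gives C E words, which vanish once one power of X 0 - X 1 is
spent on the derivative, and A B words under `lieY c`. Two values of c recover 2P itself. -/
theorem KillsDiag.of_bracket_right {ε : ℂ} (hε : ε ≠ 0) (hA : KillsDiag A E r)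
    (hC : KillsDiag C E r) (hBA : ∀ c k, B c * A k - ε • (A k * B c) =
      ((k : ℂ) - c) • C (k + c - 1))
    (hBE : ∀ c k, B c * E k - (1 : ℂ) • (E k * B c) = ((k : ℂ) - c) • B (k + c - 1)) :
    KillsDiag A B (r + 1) := by
  intro q
  have hw : ∀ c p, word₂ A B (lieY c (p * ((X 0 - X 1) ^ (r + 1) * q))) = 0 := fun c p => by
    have h := mul_word₂ (B c) (hBA c) (hBE c) (p * ((X 0 - X 1) ^ (r + 1) * q))
    rw [(hA.mono r.le_succ).mul_left, mul_zero, zero_mul, smul_zero, sub_zero, word₂_lieX,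
      word₂_lieY, mul_left_comm p, hC.lieX, zero_add, mul_left_comm] at h
    exact (smul_eq_zero.mp h.symm).resolve_left hε
  have h0 := hw 0 (X 1)
  have h1 := hw 1 1
  generalize (X 0 - X 1 : MvPolynomial (Fin 2) ℂ) ^ (r + 1) * q = P at h0 h1 ⊢
  have e : (2 : ℂ) • P = lieY 0 (X 1 * P) - lieY 1 (1 * P) := by
    simp only [lieY_apply, Derivation.leibniz, pderiv_X_self, smul_eq_mul, smul_eq_C_mul,
      map_natCast, map_ofNat, one_mul]
    push_cast
    ring
  have := congrArg (word₂ A B) e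
  rw [map_smul, map_sub, h0, h1, sub_zero] at this
  exact (smul_eq_zero.mp this).resolve_left two_ne_zero

/-- Here `F c` acts on the family `E` by `-(c+1) H` and on `B` by the families `D` and `G`. -/
theorem KillsDiag.of_transverse_left {ε : ℂ} (hEB : KillsDiag E B r) (hED : KillsDiag E D r)
    (hFE : ∀ c k, F c * E k - (1 : ℂ) • (E k * F c) = (-((c : ℂ) + 1)) • H (k + c))
    (hFB : ∀ c k, F c * B k - ε • (B k * F c) =
      D (k + (c + 1)) - (ε * ((c : ℂ) + 1)) • G (k + c)) :
    KillsDiag H B (r + 1) := by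
  intro q
  have hw : ∀ (c : ℕ) p, ((c : ℂ) + 1) • (word₂ H B (X 0 ^ c * (p * ((X 0 - X 1) ^ r * q))) +
      ε • word₂ E G (X 1 ^ c * (p * ((X 0 - X 1) ^ r * q)))) = 0 := fun c p => by
    have h := mul_word₂ (F c) (hFE c) (hFB c) (p * ((X 0 - X 1) ^ r * q))
    rw [hEB.mul_left, mul_zero, zero_mul, smul_zero, sub_zero, one_smul, word₂_smul_left,
      word₂_sub_right, word₂_smul_right, word₂_shift_left H, word₂_shift_right _ D,
      word₂_shift_right _ G, ← mul_assoc (X 1 ^ (c + 1)), hED.mul_left, zero_sub] at h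
    rw [← neg_eq_zero, h]
    module
  -- The two choices give the same E G term, so their difference isolates H B at (X 0 - X 1) P.
  have h0 := hw 0 (X 1)
  have h1 := hw 1 1
  rw [pow_succ', mul_assoc]
  generalize (X 0 - X 1 : MvPolynomial (Fin 2) ℂ) ^ r * q = P at h0 h1 ⊢
  simp only [pow_zero, pow_one, one_mul, Nat.cast_zero, Nat.cast_one, zero_add, one_smul] at h0 h1
  have h1 := (smul_eq_zero.mp h1).resolve_left (by norm_num)
  rw [sub_mul, map_sub, eq_neg_of_add_eq_zero_left h0, eq_neg_of_add_eq_zero_left h1, sub_self]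

/-- The mirror image of `of_transverse_left`: two choices of c and multiplier share the G E term,
and subtracting them isolates A H. -/
theorem KillsDiag.of_transverse_right {ε : ℂ} (hε : ε ≠ 0) (hAE : KillsDiag A E r)
    (hDE : KillsDiag D E r)
    (hFE : ∀ c k, F c * E k - (1 : ℂ) • (E k * F c) = (-((c : ℂ) + 1)) • H (k + c))
    (hFA : ∀ c k, F c * A k - ε • (A k * F c) =
      D (k + (c + 1)) - (ε * ((c : ℂ) + 1)) • G (k + c)) :
    KillsDiag A H (r + 1) := by
  intro q
  have hw : ∀ (c : ℕ) p, (((c : ℂ) + 1) * ε) • (word₂ G E (X 0 ^ c * (p * ((X 0 - X 1) ^ r * q))) +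
      word₂ A H (X 1 ^ c * (p * ((X 0 - X 1) ^ r * q)))) = 0 := fun c p => by
    have h := mul_word₂ (F c) (hFA c) (hFE c) (p * ((X 0 - X 1) ^ r * q))
    rw [hAE.mul_left, mul_zero, zero_mul, smul_zero, sub_zero, word₂_smul_right,
      word₂_sub_left, word₂_smul_left, word₂_shift_left G, word₂_shift_left D,
      word₂_shift_right _ H, ← mul_assoc (X 0 ^ (c + 1)), hDE.mul_left, zero_sub] at h
    rw [← neg_eq_zero, h]
    module
  have h0 := hw 0 (X 0)
  have h1 := hw 1 1
  rw [pow_succ', mul_assoc]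
  generalize (X 0 - X 1 : MvPolynomial (Fin 2) ℂ) ^ r * q = P at h0 h1 ⊢
  simp only [pow_zero, pow_one, one_mul, Nat.cast_zero, Nat.cast_one, zero_add, smul_eq_zero,
    mul_eq_zero, hε, or_false, false_or] at h0 h1
  have h1 := h1.resolve_left (by norm_num)
  rw [sub_mul, map_sub, eq_neg_of_add_eq_zero_right h0, eq_neg_of_add_eq_zero_right h1, sub_self]

/-- A single operator F suffices: it turns E into K, and its action on H only produces words already
known to vanish, so no power is lost. -/
theorem KillsDiag.of_transverse_transverse {ε : ℂ} (hε : ε ≠ 0) {F : R} (hHE : KillsDiag H E r)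
    (hCE : KillsDiag C E r) (hDE : KillsDiag D E r)
    (hFE : ∀ k, F * E k - (1 : ℂ) • (E k * F) = (-1 : ℂ) • K k)
    (hFH : ∀ k, F * H k - ε • (H k * F) = C (k + 1) - ε • D (k + 1)) :
    KillsDiag H K r := by
  intro q
  have h := mul_word₂ F hFH hFE ((X 0 - X 1) ^ r * q)
  rw [hHE, mul_zero, zero_mul, smul_zero, sub_zero, word₂_smul_right,
    word₂_sub_left, word₂_smul_left, word₂_shift_left C, word₂_shift_left D,
    hCE.mul_left, hDE.mul_left, smul_zero, sub_zero, zero_add, smul_smul] at h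
  exact (smul_eq_zero.mp h.symm).resolve_left (by simpa using hε)

end Diagonal

/-! ### The rank one result applied to W-modules -/

namespace WModule

variable {m n : ℕ} {M : Type*} [AddCommGroup M] [Module ℂ M] (ρ : WModule m n M)

theorem xiSet_empty : (xiSet ∅ : Ext n) = 1 := by
  simp [xiSet]

theorem monom_add_single (α : Fin m →₀ ℕ) (I : Finset (Fin n)) (j : Fin m) (k : ℕ) :
    (monom (α + Finsupp.single j k) I : A m n) =
      tvar n j ^ (α j + k) * monom (α.erase j) I := by
  rw [tvar_pow, monom, monom, Algebra.TensorProduct.tmul_mul_tmul, one_mul,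
    MvPolynomial.X_pow_eq_monomial, MvPolynomial.monomial_mul, one_mul]
  congr 2
  rw [Finsupp.single_add, add_right_comm, Finsupp.single_add_erase]

theorem act_vec_add_single (α : Fin m →₀ ℕ) (I : Finset (Fin n)) (s : Fin m ⊕ Fin n) (j : Fin m)
    (k : ℕ) : ρ.act (vec (α + Finsupp.single j k) I s) =
      ρ.fam j s (monom (α.erase j) I) (α j + k) := by
  rw [fam, ← monom_add_single]
  rfl

theorem partialD_monom_erase (α : Fin m →₀ ℕ) (I : Finset (Fin n)) (j : Fin m) :
    partialD m n (Sum.inl j) (monom (α.erase j) I) = 0 := by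
  rw [monom, partialD_inl_tmul, MvPolynomial.pderiv_monomial, Finsupp.erase_same, Nat.cast_zero,
    mul_zero, map_zero, TensorProduct.zero_tmul]

theorem sgn_zero_right (p : ZMod 2) : sgn p 0 = 1 := by
  rw [sgn_comm, sgn_zero_left]

theorem sgn_ne_zero (p q : ZMod 2) : sgn p q ≠ 0 := by
  intro h
  simpa [h] using sgn_mul_self p q

theorem fam_one_one (j : Fin m) : ρ.fam j (Sum.inl j) 1 1 =
    ρ.act (vec (Finsupp.single j 1) ∅ (Sum.inl j)) := by
  have h := ρ.act_vec_add_single 0 ∅ (Sum.inl j) j 1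
  rw [zero_add, Finsupp.zero_apply, zero_add, Finsupp.erase_zero] at h
  rw [h, monom, xiSet_empty, MvPolynomial.monomial_zero', map_one, Algebra.TensorProduct.one_def]

/-- Applied to the remaining Euler fields, this shows that t_j^k ∂/∂t_j moves only the j-th weight.
-/
theorem act_field_commute {j : Fin m} {s : Fin m ⊕ Fin n} (hs : s ≠ Sum.inl j) {u : A m n}
    (hu : u ∈ APart m n (parD s)) (hu' : partialD m n (Sum.inl j) u = 0) (k : ℕ) :
    ρ.act (field s u) * ρ.fam j (Sum.inl j) 1 k = ρ.fam j (Sum.inl j) 1 k * ρ.act (field s u) := by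
  have h := ρ.act_field_bracket hu (tvar_pow_mul_mem j k one_mem_APart) s (Sum.inl j)
  rw [CharTwo.add_self_eq_zero, sgn_zero_left, one_smul, one_smul,
    partialD_tvar_pow_mul_of_ne hs, partialD_one, hu', mul_zero, mul_zero, mul_zero, map_zero,
    map_zero, map_zero, map_zero, sub_zero] at h
  exact sub_eq_zero.mp h

theorem fam_mem_weightSpace (j : Fin m) (a : ℕ) (w : (Fin m → ℂ) × (Fin n → ℂ)) {v : M}
    (hv : v ∈ ρ.weightSpace w) : ρ.fam j (Sum.inl j) 1 a v ∈
      ρ.weightSpace (w + ((a : ℤ) - 1) • (Pi.single j 1, 0)) := by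
  refine ⟨fun i => ?_, fun k => ?_⟩
  · by_cases hij : i = j
    · subst hij
      have h := ρ.fam_bracket_self (one_mem_APart (m := m) (n := n)) one_mem_APart
        (partialD_one (Sum.inl i)) (partialD_one (Sum.inl i)) 1 a
      rw [sgn_zero_left, one_smul, mul_one, Nat.add_sub_cancel, fam_one_one] at h
      have h := LinearMap.congr_fun h v
      rw [LinearMap.sub_apply, Module.End.mul_apply, Module.End.mul_apply, hv.1 i, map_smul,
        sub_eq_iff_eq_add] at h
      rw [h, LinearMap.smul_apply, ← add_smul]
      congr 1
      simp [add_comm]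
    · have h := ρ.act_field_commute (j := j) (s := Sum.inl i) (u := monom (Finsupp.single i 1) ∅)
        (fun h => hij (Sum.inl_injective h)) (by simpa [parD] using monom_mem (m := m) (n := n) _ ∅) (by
          rw [monom, partialD_inl_tmul, MvPolynomial.pderiv_monomial,
            Finsupp.single_eq_of_ne (Ne.symm hij), Nat.cast_zero, mul_zero, map_zero,
            TensorProduct.zero_tmul]) a
      have h := LinearMap.congr_fun h v
      rw [Module.End.mul_apply, Module.End.mul_apply] at h
      refine h.trans ?_
      have := hv.1 i
      rw [show ρ.act (field (Sum.inl i) (monom (Finsupp.single i 1) ∅)) v = w.1 i • v from this,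
        map_smul]
      congr 1
      simp [hij]
  · have h := ρ.act_field_commute (j := j) (s := Sum.inr k) (u := monom 0 {k})
      Sum.inr_ne_inl (by simpa [parD] using monom_mem (m := m) 0 {k}) (by
        rw [monom, partialD_inl_tmul, MvPolynomial.pderiv_monomial, Finsupp.zero_apply,
          Nat.cast_zero, mul_zero, map_zero, TensorProduct.zero_tmul]) a
    have h := LinearMap.congr_fun h v
    rw [Module.End.mul_apply, Module.End.mul_apply] at h
    refine h.trans ?_
    rw [show ρ.act (field (Sum.inr k) (monom 0 {k})) v = w.2 k • v from hv.2 k, map_smul]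
    congr 1
    simp

theorem wittWeights (j : Fin m) : WittWeights (ρ.fam j (Sum.inl j) 1) ρ.weightSpace
    (Pi.single j 1, 0) (fun w => w.1 j) where
  rel a b := by
    have h := ρ.fam_bracket_self (one_mem_APart (m := m) (n := n)) one_mem_APart
      (partialD_one (Sum.inl j)) (partialD_one (Sum.inl j)) a b
    rwa [sgn_zero_left, one_smul, mul_one, add_comm b a] at h
  maps a w v hv := ρ.fam_mem_weightSpace j a w hv
  one w v hv := by
    rw [fam_one_one]
    exact hv.1 j
  ell w k := by simp

/-- The exponent depends only on the bound for the weight multiplicities, so one r serves every j.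
-/
theorem exists_killsDiag (hρ : ρ.IsBounded) : ∃ r, ∀ j : Fin m,
    KillsDiag (ρ.fam j (Sum.inl j) 1) (ρ.fam j (Sum.inl j) 1) r := by
  classical
  obtain ⟨hw, N, hN⟩ := hρ
  have hw' : DirectSum.IsInternal ρ.weightSpace := by
    unfold IsWeight at hw
    convert hw
  have hfin : ∀ w, FiniteDimensional ℂ (ρ.weightSpace w) := fun w =>
    Module.rank_lt_aleph0_iff.mp ((hN w).trans_lt (Cardinal.natCast_lt_aleph0))
  refine ⟨4 ^ (N + 3), fun j => killsDiag_of_diagSpan_eq_bot ((ρ.wittWeights j).diagSpan_eq_bot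
    hw'.submodule_iSup_eq_top hw'.submodule_iSupIndep hfin fun w => ?_)⟩
  have := hN w
  rw [← Module.finrank_eq_rank] at this
  exact_mod_cast this

/-! ### From t_j^k ∂/∂t_j to all pairs of families -/

section Propagation

variable {ρ} {j : Fin m} {r : ℕ} {p q : ZMod 2} {a b h h' : A m n} {s s' : Fin m ⊕ Fin n}

theorem killsDiag_self_one
    (hE : KillsDiag (ρ.fam j (Sum.inl j) 1) (ρ.fam j (Sum.inl j) 1) r)
    (ha : a ∈ APart m n p) (ha' : partialD m n (Sum.inl j) a = 0) :
    KillsDiag (ρ.fam j (Sum.inl j) a) (ρ.fam j (Sum.inl j) 1) (r + 2) :=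
  hE.of_bracket_left fun c k => by
    have h := ρ.fam_bracket_self ha one_mem_APart ha' (partialD_one (Sum.inl j)) c k
    rwa [sgn_zero_right, mul_one] at h

theorem killsDiag_self_self
    (hE : KillsDiag (ρ.fam j (Sum.inl j) 1) (ρ.fam j (Sum.inl j) 1) r)
    (ha : a ∈ APart m n p) (ha' : partialD m n (Sum.inl j) a = 0)
    (hb : b ∈ APart m n q) (hb' : partialD m n (Sum.inl j) b = 0) :
    KillsDiag (ρ.fam j (Sum.inl j) a) (ρ.fam j (Sum.inl j) b) (r + 3) := by
  refine KillsDiag.of_bracket_right (sgn_ne_zero q p) (killsDiag_self_one hE ha ha')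
    (killsDiag_self_one hE (mul_mem_APart hb ha) (partialD_mul_eq_zero hb' ha' hb))
    (ρ.fam_bracket_self hb ha hb' ha') fun c k => ?_
  have h := ρ.fam_bracket_self hb one_mem_APart hb' (partialD_one (Sum.inl j)) c k
  rwa [sgn_zero_right, mul_one] at h

theorem fam_bracket_one (hs : s ≠ Sum.inl j) (hh : h ∈ APart m n p)
    (hh' : partialD m n (Sum.inl j) h = 0) (c k : ℕ) :
    ρ.fam j s h (c + 1) * ρ.fam j (Sum.inl j) 1 k -
      (1 : ℂ) • (ρ.fam j (Sum.inl j) 1 k * ρ.fam j s h (c + 1)) =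
    (-((c : ℂ) + 1)) • ρ.fam j s h (k + c) := by
  have e := ρ.fam_bracket_self_right hs hh one_mem_APart hh' c k
  rw [sgn_zero_right, partialD_one, mul_zero, one_mul, one_mul] at e
  rw [e, neg_smul, fam, mul_zero, map_zero, map_zero, zero_sub]

theorem partialD_mul_partialD_eq_zero (ha : a ∈ APart m n p)
    (ha' : partialD m n (Sum.inl j) a = 0) (hb' : partialD m n (Sum.inl j) b = 0) :
    partialD m n (Sum.inl j) (a * partialD m n s b) = 0 :=
  partialD_mul_eq_zero ha' (partialD_partialD_eq_zero hb' s) ha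

theorem mul_partialD_mem (ha : a ∈ APart m n p) (hb : b ∈ APart m n q) :
    a * partialD m n s b ∈ APart m n (p + (parD s + q)) :=
  mul_mem_APart ha ((partialD_mem s).1 q b hb)

theorem killsDiag_ne_self
    (hE : KillsDiag (ρ.fam j (Sum.inl j) 1) (ρ.fam j (Sum.inl j) 1) r) (hs : s ≠ Sum.inl j)
    (hh : h ∈ APart m n p) (hh' : partialD m n (Sum.inl j) h = 0)
    (hb : b ∈ APart m n q) (hb' : partialD m n (Sum.inl j) b = 0) :
    KillsDiag (ρ.fam j s h) (ρ.fam j (Sum.inl j) b) (r + 4) :=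
  KillsDiag.of_transverse_left
    (killsDiag_self_self hE one_mem_APart (partialD_one _) hb hb')
    (killsDiag_self_self hE one_mem_APart (partialD_one _) (mul_partialD_mem hh hb)
      (partialD_mul_partialD_eq_zero hh hh' hb'))
    (fam_bracket_one hs hh hh') (ρ.fam_bracket_self_right hs hh hb hh')

theorem killsDiag_self_ne
    (hE : KillsDiag (ρ.fam j (Sum.inl j) 1) (ρ.fam j (Sum.inl j) 1) r) (hs : s ≠ Sum.inl j)
    (hh : h ∈ APart m n p) (hh' : partialD m n (Sum.inl j) h = 0)
    (hb : b ∈ APart m n q) (hb' : partialD m n (Sum.inl j) b = 0) :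
    KillsDiag (ρ.fam j (Sum.inl j) b) (ρ.fam j s h) (r + 4) :=
  KillsDiag.of_transverse_right (sgn_ne_zero _ _)
    (killsDiag_self_self hE hb hb' one_mem_APart (partialD_one _))
    (killsDiag_self_self hE (mul_partialD_mem hh hb)
      (partialD_mul_partialD_eq_zero hh hh' hb') one_mem_APart (partialD_one _))
    (fam_bracket_one hs hh hh') (ρ.fam_bracket_self_right hs hh hb hh')

theorem killsDiag_ne_ne
    (hE : KillsDiag (ρ.fam j (Sum.inl j) 1) (ρ.fam j (Sum.inl j) 1) r)
    (hs : s ≠ Sum.inl j) (hs' : s' ≠ Sum.inl j)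
    (ha : a ∈ APart m n p) (ha' : partialD m n (Sum.inl j) a = 0)
    (hb : b ∈ APart m n q) (hb' : partialD m n (Sum.inl j) b = 0) :
    KillsDiag (ρ.fam j s a) (ρ.fam j s' b) (r + 4) := by
  -- F is the field t_j b ∂', whose bracket with t_j^k ∂/∂t_j is minus t_j^k b ∂'.
  refine KillsDiag.of_transverse_transverse (F := ρ.fam j s' b 1) (sgn_ne_zero _ _)
    (killsDiag_ne_self hE hs ha ha' one_mem_APart (partialD_one _))
    (killsDiag_ne_self hE hs (mul_partialD_mem hb ha)
      (partialD_mul_partialD_eq_zero hb hb' ha') one_mem_APart (partialD_one _))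
    (killsDiag_ne_self hE hs' (mul_partialD_mem ha hb)
      (partialD_mul_partialD_eq_zero ha ha' hb') one_mem_APart (partialD_one _))
    (fun k => ?_) (ρ.fam_bracket_of_ne hs' hs hb ha 1)
  have h := ρ.fam_bracket_one hs' hb hb' 0 k
  rwa [Nat.cast_zero, zero_add, zero_add, add_zero] at h

theorem killsDiag_fam
    (hE : KillsDiag (ρ.fam j (Sum.inl j) 1) (ρ.fam j (Sum.inl j) 1) r)
    (ha : a ∈ APart m n p) (ha' : partialD m n (Sum.inl j) a = 0)
    (hb : b ∈ APart m n q) (hb' : partialD m n (Sum.inl j) b = 0) (s s' : Fin m ⊕ Fin n) :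
    KillsDiag (ρ.fam j s a) (ρ.fam j s' b) (r + 4) := by
  by_cases hs : s = Sum.inl j <;> by_cases hs' : s' = Sum.inl j
  · subst hs hs'
    exact (killsDiag_self_self hE ha ha' hb hb').mono (Nat.le_succ _)
  · subst hs
    exact killsDiag_self_ne hE hs' hb hb' ha ha'
  · subst hs'
    exact killsDiag_ne_self hE hs ha ha' hb hb'
  · exact killsDiag_ne_ne hE hs hs' ha ha' hb hb'

end Propagation

/-- The coefficients of ω are those of the binomial expansion of (x - y)^r. Splitting off the
t_j-parts of α and β contributes the monomial x^{α_j} y^{β_j}. -/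
theorem actU_omega (r : ℕ) (j : Fin m) (s s' : Fin m ⊕ Fin n) (α β : Fin m →₀ ℕ)
    (I J : Finset (Fin n)) : ρ.actU (omega r j s s' α β I J) =
      word₂ (ρ.fam j s (monom (α.erase j) I)) (ρ.fam j s' (monom (β.erase j) J))
        ((MvPolynomial.X 0 - MvPolynomial.X 1) ^ r *
          (MvPolynomial.X 0 ^ α j * MvPolynomial.X 1 ^ β j)) := by
  rw [sub_eq_neg_add, add_pow, Finset.sum_mul, map_sum, omega, map_sum]
  refine Finset.sum_congr rfl fun i _ => ?_
  rw [map_smul, map_mul, actU_toU, actU_toU, act_vec_add_single, act_vec_add_single,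
    ← word₂_apply (ρ.fam j s _), ← map_smul]
  congr 1
  rw [MvPolynomial.smul_eq_C_mul]
  simp only [map_mul, map_pow, map_neg, map_one, map_natCast]
  rw [neg_pow]
  ring

end WModule

end WittSuper

end

theorem lemma4p2 (m n : ℕ) (hm : 1 ≤ m) (M : Type*) [AddCommGroup M] [Module ℂ M]
    (ρ : WittSuper.WModule m n M) (hρ : ρ.IsBounded) :
    ∃ r : ℕ, 1 ≤ r ∧ ∀ (α β : Fin m →₀ ℕ) (I J : Finset (Fin n)) (j : Fin m)
      (s s' : Fin m ⊕ Fin n) (v : M),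
      ρ.actU (WittSuper.omega r j s s' α β I J) v = 0 := by
  obtain ⟨r, hr⟩ := ρ.exists_killsDiag hρ
  -- The extra 4 is the loss in the propagation: two for the first family, one for the second, one
  -- for a transverse derivation.
  refine ⟨r + 4, by omega, fun α β I J j s s' v => ?_⟩
  rw [ρ.actU_omega, WittSuper.WModule.killsDiag_fam (hr j) (WittSuper.monom_mem _ I)
    (WittSuper.WModule.partialD_monom_erase α I j) (WittSuper.monom_mem _ J)
    (WittSuper.WModule.partialD_monom_erase β J j), LinearMap.zero_apply]
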